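/- Let $K$ be a field of arbitrary characteristic. Let $Vect$ be the category of $\mathbb N$-graded $K$-vector spaces $V=\bigoplus_n V_n$ with $V_0=0$, and $Vect^+$ that of graded vector spaces with $V_0=K$; morphisms are the linear maps homogeneous of degree $0$ (and equal to the identity on $K$ in the case of $Vect^+$). For $V\in Vect^+$ let $\epsilon:V\to V_0=K$ be the projection. For $V\in Vect$ let $T(V)=\bigoplus_n V^{\otimes n}\in Vect^+$, graded by $|v_1\cdots v_n|=|v_1|+\dots+|v_n|$. All structures below live in $Vect^+$: products and coproducts are homogeneous, units and counits are given by $V_0=K$. A shuffle bialgebra is a commutative bialgebra with product $*$ and coproduct $\Delta$, together with a half-shuffle $\prec$ on $\mathrm{Ker}\,\epsilon$, such that, for $x,y,z\in\mathrm{Ker}\,\epsilon$ and $x\succ y:=y\prec x$, one has $x* y=x\prec y+x\succ y$, $(x\prec y)\prec z=x\prec(y\prec z+y\succ z)$, and $\Delta(x\prec y)=x_1\prec y_1\otimes x_2* y_2$, that is, with $\Delta(x)=x\otimes1+1\otimes x+x'\otimes x''$, $$\Delta(x\prec y)=x\prec y\otimes 1+1\otimes x\prec y+x\otimes y+x\prec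 y'\otimes y''+x'\prec y\otimes x''+x'\otimes x''* y+x'\prec y'\otimes x''* y''.$$ An unshuffle bialgebra is a cocommutative bialgebra with product $\cdot$ and coproduct $\delta$, together with $\delta_\prec:\mathrm{Ker}\,\epsilon\to V\otimes V$ such that, on $\mathrm{Ker}\,\epsilon$ and with $\delta_\succ:=\tau\circ\delta_\prec$ ($\tau$ the switch), $\delta=\delta_\prec+\delta_\succ$, $(\delta_\prec\otimes Id)\delta_\prec=(Id\otimes\delta)\delta_\prec$, $(\epsilon\otimes Id)\delta_\prec(x)=0$, $(Id\otimes\epsilon)\delta_\prec(x)=x$ and $\delta_\prec(x\cdot y)=\delta_\prec(x)\cdot\delta(y)$. An infinitesimal bialgebra is an associative unital algebra and coassociative counital coalgebra such that $\Delta(x\cdot y)=x\cdot y_1\otimes y_2+x_1\otimes x_2\cdot y-x\otimes y$. Morphisms are the morphisms of $Vect^+$ that preserve all these operations. Let $\mathbf S$ be the (non-unital) algebra with basis the graded permutations $(\sigma,d)$, $\sigma\in\mathfrak S_k$, $d:[k]\to\mathbb N_{>0}$, $k\ge0$, and product $(\sigma,d)(\tau,e)=(\tau\circ\sigma,d)$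 if $\sigma,\tau$ are permutations of the same set $[k]$ and $d=e\circ\sigma$, and $0$ otherwise. The element $(\sigma,d)$ acts on $T(V)$ by the linear map $\Phi_{(\sigma,d)}$ that sends a word $v_1\cdots v_l$ in homogeneous elements to $v_{\sigma(1)}\cdots v_{\sigma(l)}$ if $l=k$ and $|v_{\sigma(i)}|=d(i)$ for all $i$, and to $0$ otherwise. **Theorem.** The categories of shuffle bialgebras, of unshuffle bialgebras and of infinitesimal bialgebras are isomorphic over $Vect^+$: there are mutually inverse functors between any two of them which do not change the underlying graded vector spaces and linear maps (so that every object of one of the three categories carries naturally the other two structures). They are all equipped with a natural action of $\mathbf S$. More precisely, each of the three categories is a Schur--Weyl category: there are a functor $P$ to $Vect$ and isomorphisms $I_B:T(P(B))\to B$ in $Vect^+$, natural in $B$. Here $I_B$ maps $P(B)$ onto the space of primitive elements $\{x\mid\Delta(x)=x\otimes1+1\otimes x\}$ for shuffle and infinitesimal bialgebras, and onto $\{x\in\mathrm{Ker}\,\epsilon\mid\delta_\prec(x)=x\otimes 1\}$ for unshuffle bialgebras; $I_B$ is multiplicative for the concatenation product of $T(P(B))$ in the unshuffle and infinitesimal cases,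 and satisfies $I_B(v_1\cdots v_n)=I_B(v_1)\prec(I_B(v_2)\prec(\cdots\prec I_B(v_n)))$ in the shuffle case. The algebra $\mathbf S$ acts on every object $B$ by linear endomorphisms homogeneous of degree $0$, naturally in $B$, in such a way that $(\sigma,d)\cdot I_B(t)=I_B(\Phi_{(\sigma,d)}(t))$. The isomorphisms between the three categories can be chosen compatible with the functors $P$ (up to natural isomorphism), with the isomorphisms $I$, and with the actions of $\mathbf S$. -/

import Mathlib

open CategoryTheory TensorProduct

universe u v w

namespace SchurWeyl

/-! ### Graded vector spaces -/

/-- An `ℕ`-graded vector space over `K`. -/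
structure GrSpace (K : Type u) [Field K] where
  carrier : Type v
  [grp : AddCommGroup carrier]
  [mod : Module K carrier]
  /-- the homogeneous components -/
  deg : ℕ → Submodule K carrier
  internal : DirectSum.IsInternal deg

attribute [instance] GrSpace.grp GrSpace.mod

instance (K : Type u) [Field K] : CoeSort (GrSpace.{u, v} K) (Type v) := ⟨GrSpace.carrier⟩

/-- The decomposition of a graded vector space as the direct sum of its components. -/
noncomputable def GrSpace.equiv {K : Type u} [Field K] (V : GrSpace.{u, v} K) :
    (DirectSum ℕ fun i => V.deg i) ≃ₗ[K] V :=
  LinearEquiv.ofBijective (DirectSum.coeLinearMap V.deg) V.internal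

/-- The projection of a graded vector space onto its component of degree `n`. -/
noncomputable def GrSpace.proj {K : Type u} [Field K] (V : GrSpace.{u, v} K) (n : ℕ) :
    V →ₗ[K] V :=
  (V.deg n).subtype ∘ₗ DirectSum.component K ℕ (fun i => V.deg i) n ∘ₗ
    V.equiv.symm.toLinearMap

/-- The category `Vect`: graded vector spaces with zero component of degree `0`. -/
structure GrVect (K : Type u) [Field K] extends GrSpace.{u, v} K where
  deg_zero : deg 0 = ⊥

/-- The category `Vect⁺`: graded vector spaces whose component of degree `0` is the ground
field, embedded by `c ↦ c • one`. -/
structure GrVectPlus (K : Type u) [Field K] extends GrSpace.{u, v} K where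
  one : carrier
  one_ne_zero : one ≠ 0
  deg_zero : deg 0 = Submodule.span K {one}

section

variable {K : Type u} [Field K]

/-- Morphisms of `Vect`: linear maps homogeneous of degree `0`. -/
@[ext]
structure GrVect.Hom (V W : GrVect.{u, v} K) where
  lin : V.carrier →ₗ[K] W.carrier
  map_deg : ∀ n, ∀ x ∈ V.deg n, lin x ∈ W.deg n

instance : Category (GrVect.{u, v} K) where
  Hom := GrVect.Hom
  id V := ⟨LinearMap.id, fun _ _ hx => hx⟩
  comp f g := ⟨g.lin ∘ₗ f.lin, fun n x hx => g.map_deg n _ (f.map_deg n x hx)⟩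

/-- Morphisms of `Vect⁺`: linear maps homogeneous of degree `0` that are the identity on `K`. -/
@[ext]
structure GrVectPlus.Hom (V W : GrVectPlus.{u, v} K) where
  lin : V.carrier →ₗ[K] W.carrier
  map_deg : ∀ n, ∀ x ∈ V.deg n, lin x ∈ W.deg n
  map_one : lin V.one = W.one

instance : Category (GrVectPlus.{u, v} K) where
  Hom := GrVectPlus.Hom
  id V := ⟨LinearMap.id, fun _ _ hx => hx, rfl⟩
  comp f g := ⟨g.lin ∘ₗ f.lin, fun n x hx => g.map_deg n _ (f.map_deg n x hx), by
    simp [f.map_one, g.map_one]⟩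

theorem GrSpace.equiv_symm_of_mem (V : GrSpace.{u, v} K) (n : ℕ) (x : V) (hx : x ∈ V.deg n) :
    V.equiv.symm x = DirectSum.lof K ℕ (fun i => V.deg i) n ⟨x, hx⟩ := by
  rw [LinearEquiv.symm_apply_eq]
  exact (DirectSum.coeLinearMap_lof V.deg n ⟨x, hx⟩).symm

theorem GrSpace.proj_mem (V : GrSpace.{u, v} K) (n : ℕ) (x : V) : V.proj n x ∈ V.deg n := by
  exact Subtype.property _

theorem GrSpace.proj_of_mem (V : GrSpace.{u, v} K) (m n : ℕ) (x : V) (hx : x ∈ V.deg m) :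
    V.proj n x = if m = n then x else 0 := by
  have h := V.equiv_symm_of_mem m x hx
  simp only [GrSpace.proj, LinearMap.comp_apply, LinearEquiv.coe_coe, h]
  split_ifs with hmn
  · subst hmn
    simp [DirectSum.component.lof_self]
  · simp [DirectSum.component.of, hmn]

/-- The augmentation `ε`: the canonical projection onto the component `K` of degree `0`. -/
noncomputable def GrVectPlus.aug (V : GrVectPlus.{u, v} K) : V.carrier →ₗ[K] K :=
  (LinearEquiv.coord K V.carrier V.one V.one_ne_zero) ∘ₗ
    (V.toGrSpace.proj 0).codRestrict (Submodule.span K {V.one})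
      (fun x => V.deg_zero ▸ V.toGrSpace.proj_mem 0 x)

/-- The component of degree `n` of `V ⊗ V`. -/
def GrSpace.tensorDeg (V : GrSpace.{u, v} K) (n : ℕ) : Submodule K (V ⊗[K] V) :=
  ⨆ p ∈ Finset.HasAntidiagonal.antidiagonal n, LinearMap.range (TensorProduct.mapIncl (V.deg p.1) (V.deg p.2))

/-! ### Algebras and coalgebras in `Vect⁺` -/

/-- A graded associative product on `V` with unit `1 ∈ K = V₀`. -/
structure AlgStr (V : GrVectPlus.{u, v} K) where
  mul : V.carrier →ₗ[K] V.carrier →ₗ[K] V.carrier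
  one_mul : ∀ x, mul V.one x = x
  mul_one : ∀ x, mul x V.one = x
  mul_assoc : ∀ x y z, mul (mul x y) z = mul x (mul y z)
  mul_deg : ∀ m n, ∀ x ∈ V.deg m, ∀ y ∈ V.deg n, mul x y ∈ V.deg (m + n)

/-- A graded coassociative coproduct on `V` with counit the augmentation. -/
structure CoalgStr (V : GrVectPlus.{u, v} K) where
  comul : V.carrier →ₗ[K] V.carrier ⊗[K] V.carrier
  coassoc : TensorProduct.assoc K V.carrier V.carrier V.carrier ∘ₗ comul.rTensor V.carrier ∘ₗ comul
    = comul.lTensor V.carrier ∘ₗ comul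
  rTensor_counit : ∀ x, V.aug.rTensor V.carrier (comul x) = 1 ⊗ₜ[K] x
  lTensor_counit : ∀ x, V.aug.lTensor V.carrier (comul x) = x ⊗ₜ[K] 1
  comul_deg : ∀ n, ∀ x ∈ V.deg n, comul x ∈ V.toGrSpace.tensorDeg n

/-- The reduced coproduct `x ↦ x' ⊗ x'' = Δ(x) - x ⊗ 1 - 1 ⊗ x` (used on `Ker ε`). -/
noncomputable def CoalgStr.reduced {V : GrVectPlus.{u, v} K} (C : CoalgStr V) :
    V.carrier →ₗ[K] V.carrier ⊗[K] V.carrier :=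
  C.comul - (TensorProduct.mk K V.carrier V.carrier).flip V.one
    - TensorProduct.mk K V.carrier V.carrier V.one

/-- Compatibility of a product and a coproduct in an ordinary bialgebra:
the coproduct is a morphism of unital algebras. -/
structure IsBialg {V : GrVectPlus.{u, v} K} (A : AlgStr V) (C : CoalgStr V) : Prop where
  comul_one : C.comul V.one = V.one ⊗ₜ[K] V.one
  comul_mul : ∀ x y, C.comul (A.mul x y)
    = TensorProduct.map₂ A.mul A.mul (C.comul x) (C.comul y)

/-! ### The three types of bialgebras -/

/-- The structure of a shuffle bialgebra on `V`. Here `mul` is the shuffle product, `prec` is the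
left half-shuffle `≺`; the right half-shuffle is `x ≻ y = y ≺ x`. As a bilinear map on `V`, `≺` is
normalized by `x ≺ 1 = x` for `x ∈ Ker ε`, `1 ≺ x = 0` for `x ∈ Ker ε`; the value `1 ≺ 1`, which
has no meaning and is used nowhere, is set to `0`. -/
structure ShuffleStr (V : GrVectPlus.{u, v} K) extends AlgStr V, CoalgStr V where
  mul_comm : ∀ x y, mul x y = mul y x
  bialg : IsBialg toAlgStr toCoalgStr
  prec : V.carrier →ₗ[K] V.carrier →ₗ[K] V.carrier
  prec_deg : ∀ m n, ∀ x ∈ V.deg m, ∀ y ∈ V.deg n, prec x y ∈ V.deg (m + n)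
  prec_one : ∀ x ∈ LinearMap.ker V.aug, prec x V.one = x
  one_prec : ∀ x, prec V.one x = 0
  mul_eq : ∀ x ∈ LinearMap.ker V.aug, ∀ y ∈ LinearMap.ker V.aug, mul x y = prec x y + prec y x
  prec_prec : ∀ x ∈ LinearMap.ker V.aug, ∀ y ∈ LinearMap.ker V.aug, ∀ z ∈ LinearMap.ker V.aug,
    prec (prec x y) z = prec x (prec y z + prec z y)
  /-- `Δ(x≺y) = x≺y ⊗ 1 + 1 ⊗ x≺y + x ⊗ y + x≺y' ⊗ y'' + x'≺y ⊗ x'' + x' ⊗ x''⧢y + x'≺y' ⊗ x''⧢y''` -/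
  comul_prec : ∀ x ∈ LinearMap.ker V.aug, ∀ y ∈ LinearMap.ker V.aug,
    comul (prec x y) = prec x y ⊗ₜ[K] V.one + V.one ⊗ₜ[K] prec x y + x ⊗ₜ[K] y
      + (prec x).rTensor V.carrier (toCoalgStr.reduced y)
      + (prec.flip y).rTensor V.carrier (toCoalgStr.reduced x)
      + (mul.flip y).lTensor V.carrier (toCoalgStr.reduced x)
      + TensorProduct.map₂ prec mul (toCoalgStr.reduced x) (toCoalgStr.reduced y)

/-- The structure of an unshuffle bialgebra on `V`. Here `comul` is the coproduct `δ` and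
`halfComul` is the left half-unshuffle `δ_≺ : Ker ε → V ⊗ V`, extended by `δ_≺(1) = 0`; the right
half-unshuffle is `δ_≻ = τ ∘ δ_≺`. -/
structure UnshuffleStr (V : GrVectPlus.{u, v} K) extends AlgStr V, CoalgStr V where
  cocomm : ∀ x, TensorProduct.comm K V.carrier V.carrier (comul x) = comul x
  bialg : IsBialg toAlgStr toCoalgStr
  halfComul : V.carrier →ₗ[K] V.carrier ⊗[K] V.carrier
  halfComul_deg : ∀ n, ∀ x ∈ V.deg n, halfComul x ∈ V.toGrSpace.tensorDeg n
  halfComul_one : halfComul V.one = 0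
  comul_eq : ∀ x ∈ LinearMap.ker V.aug,
    comul x = halfComul x + TensorProduct.comm K V.carrier V.carrier (halfComul x)
  halfComul_assoc : ∀ x ∈ LinearMap.ker V.aug,
    TensorProduct.assoc K V.carrier V.carrier V.carrier
      (halfComul.rTensor V.carrier (halfComul x)) = comul.lTensor V.carrier (halfComul x)
  rTensor_halfComul : ∀ x ∈ LinearMap.ker V.aug, V.aug.rTensor V.carrier (halfComul x) = 0
  lTensor_halfComul : ∀ x ∈ LinearMap.ker V.aug,
    V.aug.lTensor V.carrier (halfComul x) = x ⊗ₜ[K] 1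
  halfComul_mul : ∀ x ∈ LinearMap.ker V.aug, ∀ y ∈ LinearMap.ker V.aug,
    halfComul (mul x y) = TensorProduct.map₂ mul mul (halfComul x) (comul y)

/-- The structure of an infinitesimal bialgebra on `V`:
`Δ(x·y) = x·y₁ ⊗ y₂ + x₁ ⊗ x₂·y - x ⊗ y`. -/
structure InfinitesimalStr (V : GrVectPlus.{u, v} K) extends AlgStr V, CoalgStr V where
  comul_mul : ∀ x y, comul (mul x y)
    = (mul x).rTensor V.carrier (comul y) + (mul.flip y).lTensor V.carrier (comul x) - x ⊗ₜ[K] y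

end

/-- Shuffle bialgebras. -/
structure ShuffleBialg (K : Type u) [Field K] where
  space : GrVectPlus.{u, v} K
  str : ShuffleStr space

/-- Unshuffle bialgebras. -/
structure UnshuffleBialg (K : Type u) [Field K] where
  space : GrVectPlus.{u, v} K
  str : UnshuffleStr space

/-- Infinitesimal bialgebras. -/
structure InfinitesimalBialg (K : Type u) [Field K] where
  space : GrVectPlus.{u, v} K
  str : InfinitesimalStr space

section

variable {K : Type u} [Field K]

@[ext]
structure ShuffleBialg.Hom (A B : ShuffleBialg.{u, v} K) where
  toHom : A.space ⟶ B.space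
  map_mul : ∀ x y, toHom.lin (A.str.mul x y) = B.str.mul (toHom.lin x) (toHom.lin y)
  map_comul : ∀ x, B.str.comul (toHom.lin x)
    = TensorProduct.map toHom.lin toHom.lin (A.str.comul x)
  map_prec : ∀ x ∈ LinearMap.ker A.space.aug, ∀ y ∈ LinearMap.ker A.space.aug,
    toHom.lin (A.str.prec x y) = B.str.prec (toHom.lin x) (toHom.lin y)

@[ext]
structure UnshuffleBialg.Hom (A B : UnshuffleBialg.{u, v} K) where
  toHom : A.space ⟶ B.space
  map_mul : ∀ x y, toHom.lin (A.str.mul x y) = B.str.mul (toHom.lin x) (toHom.lin y)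
  map_comul : ∀ x, B.str.comul (toHom.lin x)
    = TensorProduct.map toHom.lin toHom.lin (A.str.comul x)
  map_halfComul : ∀ x, B.str.halfComul (toHom.lin x)
    = TensorProduct.map toHom.lin toHom.lin (A.str.halfComul x)

@[ext]
structure InfinitesimalBialg.Hom (A B : InfinitesimalBialg.{u, v} K) where
  toHom : A.space ⟶ B.space
  map_mul : ∀ x y, toHom.lin (A.str.mul x y) = B.str.mul (toHom.lin x) (toHom.lin y)
  map_comul : ∀ x, B.str.comul (toHom.lin x)
    = TensorProduct.map toHom.lin toHom.lin (A.str.comul x)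

theorem GrVectPlus.aug_of_deg_zero (V : GrVectPlus.{u, v} K) (c : K) : V.aug (c • V.one) = c := by
  have h : V.one ∈ V.deg 0 := V.deg_zero ▸ Submodule.mem_span_singleton_self V.one
  have h1 : V.toGrSpace.proj 0 (c • V.one) = c • V.one := by
    rw [V.toGrSpace.proj_of_mem 0 0 _ (Submodule.smul_mem _ c h), if_pos rfl]
  have h2 : (V.toGrSpace.proj 0).codRestrict (Submodule.span K {V.one})
      (fun x => V.deg_zero ▸ V.toGrSpace.proj_mem 0 x) (c • V.one)
      = ⟨c • V.one, Submodule.smul_mem _ c (Submodule.mem_span_singleton_self V.one)⟩ :=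
    Subtype.ext h1
  rw [GrVectPlus.aug, LinearMap.comp_apply, h2]
  exact LinearEquiv.coord_apply_smul K V.carrier V.one V.one_ne_zero
    ⟨c • V.one, Submodule.smul_mem _ c (Submodule.mem_span_singleton_self V.one)⟩ |> fun h3 =>
      smul_left_injective K V.one_ne_zero h3

theorem GrVectPlus.aug_of_deg_pos (V : GrVectPlus.{u, v} K) (n : ℕ) (hn : n ≠ 0) (x : V.carrier)
    (hx : x ∈ V.deg n) : V.aug x = 0 := by
  have h2 : (V.toGrSpace.proj 0).codRestrict (Submodule.span K {V.one})
      (fun x => V.deg_zero ▸ V.toGrSpace.proj_mem 0 x) x = 0 :=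
    Subtype.ext ((V.toGrSpace.proj_of_mem n 0 x hx).trans (if_neg hn))
  rw [GrVectPlus.aug, LinearMap.comp_apply, h2, map_zero]

theorem GrVectPlus.hom_ext_deg {M : Type w} [AddCommGroup M] [Module K M] (V : GrSpace.{u, v} K)
    (f g : V →ₗ[K] M) (h : ∀ n, ∀ x ∈ V.deg n, f x = g x) : f = g := by
  have := V.internal.submodule_iSup_eq_top
  refine LinearMap.ext fun x => ?_
  have hx : x ∈ ⨆ i, V.deg i := this ▸ Submodule.mem_top
  induction hx using Submodule.iSup_induction' with
  | mem i x hx => exact h i x hx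
  | zero => simp
  | add x y _ _ hx hy => simp [hx, hy]

/-- Morphisms of `Vect⁺` preserve the augmentation. -/
theorem GrVectPlus.Hom.aug_lin {V W : GrVectPlus.{u, v} K} (f : V ⟶ W) (x : V.carrier) :
    W.aug (f.lin x) = V.aug x := by
  suffices h : W.aug ∘ₗ f.lin = V.aug from LinearMap.congr_fun h x
  refine GrVectPlus.hom_ext_deg V.toGrSpace _ _ fun n x hx => ?_
  by_cases hn : n = 0
  · subst hn
    rw [V.deg_zero] at hx
    obtain ⟨c, rfl⟩ := Submodule.mem_span_singleton.1 hx
    rw [LinearMap.comp_apply, map_smul, f.map_one, W.aug_of_deg_zero, V.aug_of_deg_zero]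
  · rw [LinearMap.comp_apply, W.aug_of_deg_pos n hn _ (f.map_deg n x hx),
      V.aug_of_deg_pos n hn x hx]

theorem GrVectPlus.Hom.lin_mem_ker {V W : GrVectPlus.{u, v} K} (f : V ⟶ W) {x : V.carrier}
    (hx : x ∈ LinearMap.ker V.aug) : f.lin x ∈ LinearMap.ker W.aug := by
  rw [LinearMap.mem_ker] at hx ⊢
  rw [f.aug_lin, hx]

@[simp] theorem GrVectPlus.id_lin (V : GrVectPlus.{u, v} K) :
    GrVectPlus.Hom.lin (𝟙 V) = LinearMap.id := rfl

@[simp] theorem GrVectPlus.comp_lin {U V W : GrVectPlus.{u, v} K} (f : U ⟶ V) (g : V ⟶ W) :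
    GrVectPlus.Hom.lin (f ≫ g) = g.lin ∘ₗ f.lin := rfl

instance : Category (ShuffleBialg.{u, v} K) where
  Hom := ShuffleBialg.Hom
  id A := ⟨𝟙 A.space, fun _ _ => rfl, fun _ => by simp, fun _ _ _ _ => rfl⟩
  comp f g := ⟨f.toHom ≫ g.toHom,
    fun x y => by simp [f.map_mul, g.map_mul],
    fun x => by simp [f.map_comul, g.map_comul, TensorProduct.map_comp],
    fun x hx y hy => by
      simp [f.map_prec x hx y hy, g.map_prec _ (f.toHom.lin_mem_ker hx) _ (f.toHom.lin_mem_ker hy)]⟩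

instance : Category (UnshuffleBialg.{u, v} K) where
  Hom := UnshuffleBialg.Hom
  id A := ⟨𝟙 A.space, fun _ _ => rfl, fun _ => by simp, fun _ => by simp⟩
  comp f g := ⟨f.toHom ≫ g.toHom,
    fun x y => by simp [f.map_mul, g.map_mul],
    fun x => by simp [f.map_comul, g.map_comul, TensorProduct.map_comp],
    fun x => by simp [f.map_halfComul, g.map_halfComul, TensorProduct.map_comp]⟩

instance : Category (InfinitesimalBialg.{u, v} K) where
  Hom := InfinitesimalBialg.Hom
  id A := ⟨𝟙 A.space, fun _ _ => rfl, fun _ => by simp⟩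
  comp f g := ⟨f.toHom ≫ g.toHom,
    fun x y => by simp [f.map_mul, g.map_mul],
    fun x => by simp [f.map_comul, g.map_comul, TensorProduct.map_comp]⟩

end

/-- The forgetful functor from shuffle bialgebras to `Vect⁺`. -/
def ShuffleBialg.forget (K : Type u) [Field K] : ShuffleBialg.{u, v} K ⥤ GrVectPlus.{u, v} K where
  obj A := A.space
  map f := f.toHom

/-- The forgetful functor from unshuffle bialgebras to `Vect⁺`. -/
def UnshuffleBialg.forget (K : Type u) [Field K] :
    UnshuffleBialg.{u, v} K ⥤ GrVectPlus.{u, v} K where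
  obj A := A.space
  map f := f.toHom

/-- The forgetful functor from infinitesimal bialgebras to `Vect⁺`. -/
def InfinitesimalBialg.forget (K : Type u) [Field K] :
    InfinitesimalBialg.{u, v} K ⥤ GrVectPlus.{u, v} K where
  obj A := A.space
  map f := f.toHom

section

variable {K : Type u} [Field K]

/-- The primitive elements `{x | Δ(x) = x ⊗ 1 + 1 ⊗ x}` of a coalgebra in `Vect⁺`. -/
def CoalgStr.Prim {V : GrVectPlus.{u, v} K} (C : CoalgStr V) : Set V.carrier :=
  {x | C.comul x = x ⊗ₜ[K] V.one + V.one ⊗ₜ[K] x}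

/-- `Prim_≺ = {x ∈ Ker ε | δ_≺(x) = x ⊗ 1}`. -/
def UnshuffleStr.PrimPrec {V : GrVectPlus.{u, v} K} (S : UnshuffleStr V) : Set V.carrier :=
  {x | x ∈ LinearMap.ker V.aug ∧ S.halfComul x = x ⊗ₜ[K] V.one}

/-! ### Tensor spaces -/

/-- `T_n(V)`, spanned by the words `v₁ ⋯ v_k` with `v_i` homogeneous and
`|v₁| + ⋯ + |v_k| = n`. A word is given by the list of the pairs `(|v_i|, v_i)`. -/
def tensorGrading (V : GrSpace.{u, v} K) (n : ℕ) : Submodule K (TensorAlgebra K V) :=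
  Submodule.span K {x | ∃ l : List (ℕ × V), (∀ p ∈ l, p.2 ∈ V.deg p.1) ∧
    (l.map Prod.fst).sum = n ∧ x = (l.map fun p => TensorAlgebra.ι K p.2).prod}

instance tensorGrading_gradedMonoid (V : GrSpace.{u, v} K) :
    SetLike.GradedMonoid (tensorGrading V) where
  one_mem := Submodule.subset_span ⟨[], by simp, by simp, by simp⟩
  mul_mem i j x y hx hy := by
    have h := Submodule.mul_mem_mul hx hy
    rw [tensorGrading, tensorGrading, Submodule.span_mul_span] at h
    refine Submodule.span_mono ?_ h
    rintro _ ⟨_, ⟨l, hl, hs, rfl⟩, _, ⟨l', hl', hs', rfl⟩, rfl⟩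
    refine ⟨l ++ l', fun p hp => ?_, by simp [hs, hs'], by simp⟩
    rcases List.mem_append.1 hp with h | h
    · exact hl p h
    · exact hl' p h

theorem ι_mem_tensorGrading (V : GrSpace.{u, v} K) (n : ℕ) (x : V) (hx : x ∈ V.deg n) :
    TensorAlgebra.ι K x ∈ tensorGrading V n :=
  Submodule.subset_span ⟨[(n, x)], by simpa using hx, by simp, by simp⟩

theorem tensorGrading_internal (V : GrSpace.{u, v} K) :
    DirectSum.IsInternal (tensorGrading V) := by
  let g : (DirectSum ℕ fun i => V.deg i) →ₗ[K] DirectSum ℕ fun i => tensorGrading V i :=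
    DirectSum.toModule K ℕ _ fun n =>
      DirectSum.lof K ℕ (fun i => tensorGrading V i) n ∘ₗ
        ((TensorAlgebra.ι K).restrict (fun x hx => ι_mem_tensorGrading V n x hx))
  let f : TensorAlgebra K V →ₐ[K] DirectSum ℕ fun i => tensorGrading V i :=
    TensorAlgebra.lift K (g ∘ₗ V.equiv.symm.toLinearMap)
  have hf : ∀ n (x : V) (hx : x ∈ V.deg n), f (TensorAlgebra.ι K x)
      = DirectSum.of (fun i => tensorGrading V i) n ⟨_, ι_mem_tensorGrading V n x hx⟩ := by
    intro n x hx
    have h := V.equiv_symm_of_mem n x hx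
    simp only [f, TensorAlgebra.lift_ι_apply, LinearMap.comp_apply, LinearEquiv.coe_coe, h, g,
      DirectSum.toModule_lof]
    rfl
  have hgr : GradedAlgebra (tensorGrading V) := by
    refine GradedAlgebra.ofAlgHom (tensorGrading V) f ?_ ?_
    · ext x
      simp only [AlgHom.comp_toLinearMap, LinearMap.comp_apply, AlgHom.toLinearMap_apply,
        AlgHom.toLinearMap_id, LinearMap.id_apply]
      have key : (DirectSum.coeAlgHom (tensorGrading V)).toLinearMap ∘ₗ f.toLinearMap ∘ₗ
          TensorAlgebra.ι K = TensorAlgebra.ι K := by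
        refine GrVectPlus.hom_ext_deg V _ _ fun n x hx => ?_
        simp [hf n x hx]
      exact LinearMap.congr_fun key x
    · rintro i ⟨x, hx⟩
      have key : ∀ l : List (ℕ × V), (∀ p ∈ l, p.2 ∈ V.deg p.1) → ∀ n,
          (l.map Prod.fst).sum = n → ∀ h : (l.map fun p => TensorAlgebra.ι K p.2).prod
            ∈ tensorGrading V n, f (l.map fun p => TensorAlgebra.ι K p.2).prod
          = DirectSum.of (fun i => tensorGrading V i) n ⟨_, h⟩ := by
        intro l
        induction l with
        | nil =>
          rintro - n rfl h
          simp only [List.map_nil, List.prod_nil, map_one]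
          rfl
        | cons p l ih =>
          rintro hl n rfl h
          have hl' : ∀ q ∈ l, q.2 ∈ V.deg q.1 := fun q hq => hl q (List.mem_cons_of_mem _ hq)
          have hm : (l.map fun p => TensorAlgebra.ι K p.2).prod
              ∈ tensorGrading V (l.map Prod.fst).sum :=
            Submodule.subset_span ⟨l, hl', rfl, rfl⟩
          simp only [List.map_cons, List.prod_cons, map_mul]
          rw [ih hl' _ rfl hm, hf p.1 p.2 (hl p List.mem_cons_self), DirectSum.of_mul_of]
          rfl
      have hx' := hx
      rw [tensorGrading] at hx'
      suffices H : ∀ h : x ∈ tensorGrading V i,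
          f x = DirectSum.lof K ℕ (fun i => tensorGrading V i) i ⟨x, h⟩ from H hx
      induction hx' using Submodule.span_induction with
      | mem x h =>
        obtain ⟨l, hl, hs, rfl⟩ := h
        exact fun h => key l hl i hs h
      | zero =>
        intro h
        rw [map_zero]
        exact (map_zero (DirectSum.lof K ℕ (fun i => tensorGrading V i) i)).symm
      | add x y hx1 hy1 h1 h2 =>
        intro h
        rw [map_add, h1 hx1 hx1, h2 hy1 hy1, ← map_add]
        rfl
      | smul c x hx1 h1 =>
        intro h
        rw [map_smul, h1 hx1 hx1, ← map_smul]
        rfl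
  exact DirectSum.Decomposition.isInternal (tensorGrading V)

theorem tensorGrading_zero (V : GrVect.{u, v} K) :
    tensorGrading V.toGrSpace 0 = Submodule.span K {(1 : TensorAlgebra K V.carrier)} := by
  refine le_antisymm (Submodule.span_le.2 ?_) (Submodule.span_le.2 ?_)
  · rintro _ ⟨l, hl, hs, rfl⟩
    cases l with
    | nil => exact Submodule.subset_span rfl
    | cons p l =>
      have hp : p.1 = 0 := by
        simp only [List.map_cons, List.sum_cons] at hs
        omega
      have h0 := hl p List.mem_cons_self
      rw [hp, V.deg_zero, Submodule.mem_bot] at h0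
      simp [h0]
  · rintro _ rfl
    exact Submodule.subset_span ⟨[], by simp, by simp, by simp⟩

end

/-- `T(f)`: the word `v₁ ⋯ v_n` goes to `f(v₁) ⋯ f(v_n)`. -/
noncomputable def tensorMap {K : Type u} [Field K] {V W : Type v} [AddCommGroup V] [Module K V]
    [AddCommGroup W] [Module K W] (f : V →ₗ[K] W) : TensorAlgebra K V →ₐ[K] TensorAlgebra K W :=
  TensorAlgebra.lift K (TensorAlgebra.ι K ∘ₗ f)

/-- The functor `T : Vect ⥤ Vect⁺`, `V ↦ T(V) = ⨁ₙ V^{⊗ n}`, graded by total degree. -/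
noncomputable def tensorFunctor (K : Type u) [Field K] :
    GrVect.{u, max u v} K ⥤ GrVectPlus.{u, max u v} K where
  obj V :=
    { carrier := TensorAlgebra K V.carrier
      deg := tensorGrading V.toGrSpace
      internal := tensorGrading_internal V.toGrSpace
      one := 1
      one_ne_zero := one_ne_zero
      deg_zero := tensorGrading_zero V }
  map {V W} f :=
    { lin := (tensorMap f.lin).toLinearMap
      map_deg := fun n x hx => by
        refine (Submodule.span_le (p := (tensorGrading W.toGrSpace n).comap
          (tensorMap f.lin).toLinearMap)).2 ?_ hx
        rintro _ ⟨l, hl, hs, rfl⟩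
        refine Submodule.subset_span ⟨l.map fun p => (p.1, f.lin p.2), ?_, ?_, ?_⟩
        · intro p hp
          obtain ⟨q, hq, rfl⟩ := List.mem_map.1 hp
          exact f.map_deg _ _ (hl q hq)
        · rw [List.map_map]
          exact hs
        · simp [tensorMap, map_list_prod, List.map_map, Function.comp_def]
      map_one := map_one (tensorMap f.lin) }
  map_id V := by
    refine GrVectPlus.Hom.ext ?_
    change (tensorMap LinearMap.id).toLinearMap = (AlgHom.id K _).toLinearMap
    congr 1
    exact TensorAlgebra.hom_ext (by ext x; simp [tensorMap])
  map_comp {U V W} f g := by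
    refine GrVectPlus.Hom.ext ?_
    change (tensorMap (g.lin ∘ₗ f.lin)).toLinearMap
      = ((tensorMap g.lin).comp (tensorMap f.lin)).toLinearMap
    congr 1
    exact TensorAlgebra.hom_ext (by ext x; simp [tensorMap])

/-! ### Graded permutations -/

/-- Graded permutations: triples `(k, σ, d)` with `σ ∈ 𝔖_k` and `d : [k] → ℕ_{>0}`. -/
abbrev GradedPerm : Type := Σ k : ℕ, Equiv.Perm (Fin k) × (Fin k → ℕ+)

/-- The vector space `𝐒` spanned by the graded permutations. -/
def GradedPermAlg (K : Type u) [Field K] : Type u := GradedPerm →₀ K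

section

variable {K : Type u} [Field K]

noncomputable instance : AddCommGroup (GradedPermAlg K) :=
  inferInstanceAs (AddCommGroup (GradedPerm →₀ K))

noncomputable instance : Module K (GradedPermAlg K) :=
  inferInstanceAs (Module K (GradedPerm →₀ K))

/-- The basis element of `𝐒` given by a graded permutation. -/
noncomputable def GradedPermAlg.of (K : Type u) [Field K] (p : GradedPerm) : GradedPermAlg K :=
  Finsupp.single p (1 : K)

/-- `(σ, d) ∘ (τ, e)` is `(τ ∘ σ, d)` if `σ`, `τ` permute the same set and `d = e ∘ σ`, and `0`
otherwise. -/
noncomputable def GradedPermAlg.basisMul (K : Type u) [Field K] :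
    GradedPerm → GradedPerm → GradedPermAlg K
  | ⟨k, σ, d⟩, ⟨l, τ, e⟩ =>
    if h : k = l then by
      subst h
      exact if d = e ∘ σ then GradedPermAlg.of K ⟨k, τ * σ, d⟩ else 0
    else 0

/-- The bilinear extension of the composition of graded permutations. -/
noncomputable def GradedPermAlg.mulLin (K : Type u) [Field K] :
    GradedPermAlg K →ₗ[K] GradedPermAlg K →ₗ[K] GradedPermAlg K :=
  Finsupp.linearCombination K fun p =>
    (Finsupp.linearCombination K fun q => GradedPermAlg.basisMul K p q :
      (GradedPerm →₀ K) →ₗ[K] GradedPermAlg K)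

theorem GradedPermAlg.mulLin_of (p q : GradedPerm) :
    GradedPermAlg.mulLin K (of K p) (of K q) = basisMul K p q := by
  have h1 : GradedPermAlg.mulLin K (of K p)
      = (Finsupp.linearCombination K fun q => GradedPermAlg.basisMul K p q :
      (GradedPerm →₀ K) →ₗ[K] GradedPermAlg K) :=
    (Finsupp.linearCombination_single K (1 : K) p).trans (one_smul _ _)
  rw [h1]
  exact (Finsupp.linearCombination_single K (1 : K) q).trans (one_smul _ _)

theorem GradedPermAlg.induction {P : GradedPermAlg K → Prop} (x : GradedPermAlg K)
    (zero : P 0) (add : ∀ x y, P x → P y → P (x + y)) (smul : ∀ (c : K) p, P (c • of K p)) :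
    P x :=
  Finsupp.induction_linear (motive := P) x zero (fun f g => add f g) fun p c => by
    have h : (Finsupp.single p c : GradedPermAlg K) = c • of K p :=
      (Finsupp.smul_single_one p c).symm
    rw [h]
    exact smul c p

theorem GradedPermAlg.mulLin_assoc (x y z : GradedPermAlg K) :
    mulLin K (mulLin K x y) z = mulLin K x (mulLin K y z) := by
  induction x using GradedPermAlg.induction with
  | zero => simp
  | add x x' h h' => simp [h, h']
  | smul a p =>
  induction y using GradedPermAlg.induction with
  | zero => simp
  | add x x' h h' =>
    simp only [map_add, LinearMap.add_apply, h, h']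
  | smul b q =>
  induction z using GradedPermAlg.induction with
  | zero => simp
  | add x x' h h' =>
    simp only [map_add, h, h']
  | smul c r =>
  simp only [map_smul, LinearMap.smul_apply]
  congr 3
  obtain ⟨k, σ, d⟩ := p
  obtain ⟨l, τ, e⟩ := q
  obtain ⟨m, ρ, f⟩ := r
  rw [mulLin_of, mulLin_of]
  by_cases h1 : k = l
  · subst h1
    by_cases h2 : k = m
    · subst h2
      by_cases h3 : d = e ∘ σ
      · subst h3
        by_cases h4 : e = f ∘ τ
        · subst h4
          simp [basisMul, mulLin_of, mul_assoc, Function.comp_assoc]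
        · have h5 : ¬ e ∘ σ = f ∘ τ ∘ σ := fun h => h4 (σ.surjective.injective_comp_right h)
          simp [basisMul, mulLin_of, h4, h5]
      · by_cases h4 : e = f ∘ τ
        · subst h4
          have h6 : ¬ d = (f ∘ τ) ∘ σ := h3
          simp [basisMul, mulLin_of, h6]
        · simp [basisMul, h3, h4]
    · by_cases h3 : d = e ∘ σ <;> simp [basisMul, mulLin_of, h2, h3]
  · by_cases h2 : l = m
    · subst h2
      by_cases h4 : e = f ∘ τ <;> simp [basisMul, mulLin_of, h1, h4]
    · simp [basisMul, h1, h2]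

/-- The (non-unital) algebra of graded permutations. -/
noncomputable instance : NonUnitalRing (GradedPermAlg K) where
  toAddCommGroup := inferInstance
  mul x y := GradedPermAlg.mulLin K x y
  left_distrib x y z := map_add (GradedPermAlg.mulLin K x) y z
  right_distrib x y z := LinearMap.map_add₂ (GradedPermAlg.mulLin K) x y z
  zero_mul x := LinearMap.map_zero₂ (GradedPermAlg.mulLin K) x
  mul_zero x := map_zero (GradedPermAlg.mulLin K x)
  mul_assoc := GradedPermAlg.mulLin_assoc

/-- The endomorphism `Φ_{(σ,d)}` of `T(V)`: it maps a word `v₁ ⋯ v_k` of homogeneous elements to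
`v_{σ(1)} ⋯ v_{σ(k)}` if `|v_{σ(i)}| = d(i)` for all `i`, and to `0` otherwise; it vanishes on words
of length different from `k`. -/
noncomputable def gradedPermMap (V : GrVect.{u, v} K) (p : GradedPerm) :
    TensorAlgebra K V.carrier →ₗ[K] TensorAlgebra K V.carrier :=
  PiTensorProduct.lift (((TensorAlgebra.tprod K V.carrier p.1).compLinearMap
      fun i => V.proj (p.2.2 i)).domDomCongr p.2.1) ∘ₗ
    DirectSum.component K ℕ (fun n => ⨂[K]^n V.carrier) p.1 ∘ₗ
    (TensorAlgebra.equivDirectSum (R := K) (M := V.carrier)).toLinearMap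

/-- `Φ_{(σ,d)}` on words of length `k`. -/
theorem gradedPermMap_tprod (V : GrVect.{u, v} K) {k : ℕ} (σ : Equiv.Perm (Fin k))
    (d : Fin k → ℕ+) (x : Fin k → V.carrier) (c : Fin k → ℕ) (hx : ∀ i, x i ∈ V.deg (c i)) :
    gradedPermMap V ⟨k, σ, d⟩ (TensorAlgebra.tprod K V.carrier k x) =
      if ∀ i, c (σ i) = d i then TensorAlgebra.tprod K V.carrier k (fun i => x (σ i)) else 0 := by
  have h : TensorAlgebra.equivDirectSum (TensorAlgebra.tprod K V.carrier k x)
      = DirectSum.lof K ℕ (fun n => ⨂[K]^n V.carrier) k (PiTensorProduct.tprod K x) :=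
    TensorAlgebra.toDirectSum_tensorPower_tprod x
  have h' : gradedPermMap V ⟨k, σ, d⟩ (TensorAlgebra.tprod K V.carrier k x)
      = TensorAlgebra.tprod K V.carrier k (fun i => V.proj (d i) (x (σ i))) := by
    simp only [gradedPermMap, LinearMap.comp_apply, AlgEquiv.toLinearMap_apply, h,
      DirectSum.component.lof_self, PiTensorProduct.lift.tprod]
    rfl
  rw [h']
  have h2 : ∀ i, V.proj (d i) (x (σ i)) = if c (σ i) = d i then x (σ i) else 0 := fun i =>
    V.toGrSpace.proj_of_mem (c (σ i)) (d i) _ (hx _)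
  simp only [h2]
  split_ifs with hc
  · simp only [hc, if_true]
  · obtain ⟨i, hi⟩ := not_forall.1 hc
    exact (TensorAlgebra.tprod K V.carrier k).map_coord_zero i (if_neg hi)

/-- `Φ_{(σ,d)}` on words of length different from `k`. -/
theorem gradedPermMap_tprod_of_ne (V : GrVect.{u, v} K) {k l : ℕ} (hkl : k ≠ l)
    (σ : Equiv.Perm (Fin k)) (d : Fin k → ℕ+) (x : Fin l → V.carrier) :
    gradedPermMap V ⟨k, σ, d⟩ (TensorAlgebra.tprod K V.carrier l x) = 0 := by
  have h : TensorAlgebra.equivDirectSum (TensorAlgebra.tprod K V.carrier l x)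
      = DirectSum.lof K ℕ (fun n => ⨂[K]^n V.carrier) l (PiTensorProduct.tprod K x) :=
    TensorAlgebra.toDirectSum_tensorPower_tprod x
  have h0 : DirectSum.component K ℕ (fun n => ⨂[K]^n V.carrier) k
      (DirectSum.lof K ℕ (fun n => ⨂[K]^n V.carrier) l (PiTensorProduct.tprod K x)) = 0 := by
    rw [DirectSum.component.of, dif_neg (Ne.symm hkl)]
  simp only [gradedPermMap, LinearMap.comp_apply, AlgEquiv.toLinearMap_apply, h, h0, map_zero]

end

/-! ### Schur-Weyl categories -/

section

variable {K : Type u} [Field K] {C : Type*} [Category C] {D : Type*} [Category D]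

/-- The structure of a Schur-Weyl category on `C` with forgetful functor `F` to `Vect⁺`: a functor
`P : C ⥤ Vect` and natural isomorphisms `T(P(X)) ≅ F(X)` in `Vect⁺`. -/
structure SchurWeylStructure (F : C ⥤ GrVectPlus.{u, max u v} K) where
  P : C ⥤ GrVect.{u, max u v} K
  iso : P ⋙ tensorFunctor.{u, v} K ≅ F

/-- The natural isomorphism `T(P(X)) → F(X)` as a linear map. -/
noncomputable def SchurWeylStructure.lin {F : C ⥤ GrVectPlus.{u, max u v} K}
    (S : SchurWeylStructure.{u, v} F) (X : C) :
    TensorAlgebra K (S.P.obj X).carrier →ₗ[K] (F.obj X).carrier :=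
  GrVectPlus.Hom.lin (S.iso.hom.app X)

/-- A natural action of the algebra `𝐒` on the objects of a category over `Vect⁺`, by linear
endomorphisms homogeneous of degree `0`. -/
structure NaturalAction (F : C ⥤ GrVectPlus.{u, v} K) where
  act : ∀ X : C, GradedPermAlg K →ₙₐ[K] Module.End K (F.obj X).carrier
  act_deg : ∀ X s n, ∀ x ∈ (F.obj X).deg n, act X s x ∈ (F.obj X).deg n
  natural : ∀ {X Y : C} (f : X ⟶ Y) (s : GradedPermAlg K) (x : (F.obj X).carrier),
    (F.map f).lin (act X s x) = act Y s ((F.map f).lin x)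

/-- The action is the one carried over from the tensor spaces, where `(σ, d)` acts
by `Φ_{(σ,d)}`. -/
def NaturalAction.IsInduced {F : C ⥤ GrVectPlus.{u, max u v} K}
    (ρ : NaturalAction F) (S : SchurWeylStructure.{u, v} F) : Prop :=
  ∀ (X : C) (p : GradedPerm) (t : TensorAlgebra K (S.P.obj X).carrier),
    ρ.act X (GradedPermAlg.of K p) (S.lin X t) = S.lin X (gradedPermMap (S.P.obj X) p t)

/-- An isomorphism over `Vect⁺` of two categories with forgetful functors `F`, `G` to `Vect⁺`:
mutually inverse functors that do not change the underlying graded vector spaces and maps. -/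
structure IsoOver (F : C ⥤ GrVectPlus.{u, v} K) (G : D ⥤ GrVectPlus.{u, v} K) where
  functor : C ⥤ D
  inverse : D ⥤ C
  functor_inverse : functor ⋙ inverse = 𝟭 C
  inverse_functor : inverse ⋙ functor = 𝟭 D
  functor_forget : functor ⋙ G = F

/-- The identification of the underlying graded vector spaces. -/
def IsoOver.ident {F : C ⥤ GrVectPlus.{u, v} K} {G : D ⥤ GrVectPlus.{u, v} K} (α : IsoOver F G) :
    α.functor ⋙ G ≅ F :=
  eqToIso α.functor_forget

/-- The isomorphism identifies the two presentations of objects as tensor spaces. -/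
def IsoOver.Compatible {F : C ⥤ GrVectPlus.{u, max u v} K} {G : D ⥤ GrVectPlus.{u, max u v} K}
    (α : IsoOver F G) (S : SchurWeylStructure.{u, v} F) (S' : SchurWeylStructure.{u, v} G) : Prop :=
  ∃ θ : α.functor ⋙ S'.P ≅ S.P, ∀ X : C,
    S'.iso.hom.app (α.functor.obj X) ≫ α.ident.hom.app X
      = (tensorFunctor.{u, v} K).map (θ.hom.app X) ≫ S.iso.hom.app X

/-- The isomorphism commutes with the actions of `𝐒`. -/
def IsoOver.Equivariant {F : C ⥤ GrVectPlus.{u, v} K} {G : D ⥤ GrVectPlus.{u, v} K}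
    (α : IsoOver F G) (ρ : NaturalAction F) (ρ' : NaturalAction G) : Prop :=
  ∀ (X : C) (s : GradedPermAlg K) (x : (G.obj (α.functor.obj X)).carrier),
    (α.ident.hom.app X).lin (ρ'.act (α.functor.obj X) s x)
      = ρ.act X s ((α.ident.hom.app X).lin x)

end

section

variable {K : Type u} [Field K]

/-- The isomorphisms `T(P(B)) ≅ B` identify `P(B)` with `Prim(B)` and words with iterated left
half-shuffles: `v₁ ⋯ v_n ↦ v₁ ≺ (v₂ ≺ (⋯ ≺ v_n))`. -/
def IsShuffleStandard (S : SchurWeylStructure.{u, v} (ShuffleBialg.forget.{u, max u v} K)) : Prop :=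
  ∀ B : ShuffleBialg.{u, max u v} K,
    (Set.range fun x => S.lin B (TensorAlgebra.ι K x)) = B.str.Prim ∧
    ∀ x t, S.lin B (TensorAlgebra.ι K x * t)
      = B.str.prec (S.lin B (TensorAlgebra.ι K x)) (S.lin B t)

/-- The isomorphisms `T(P(B)) ≅ B` identify `P(B)` with `Prim_≺(B)` and words with products. -/
def IsUnshuffleStandard
    (S : SchurWeylStructure.{u, v} (UnshuffleBialg.forget.{u, max u v} K)) : Prop :=
  ∀ B : UnshuffleBialg.{u, max u v} K,
    (Set.range fun x => S.lin B (TensorAlgebra.ι K x)) = B.str.PrimPrec ∧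
    ∀ t t', S.lin B (t * t') = B.str.mul (S.lin B t) (S.lin B t')

/-- The isomorphisms `T(P(B)) ≅ B` identify `P(B)` with `Prim(B)` and words with products. -/
def IsInfinitesimalStandard
    (S : SchurWeylStructure.{u, v} (InfinitesimalBialg.forget.{u, max u v} K)) : Prop :=
  ∀ B : InfinitesimalBialg.{u, max u v} K,
    (Set.range fun x => S.lin B (TensorAlgebra.ι K x)) = B.str.Prim ∧
    ∀ t t', S.lin B (t * t') = B.str.mul (S.lin B t) (S.lin B t')

end

end SchurWeyl

-- All three categories are isomorphic over Vect⁺ to a fourth one, `WordObj`. Its objects are spaces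
-- V of Vect⁺ with a graded subspace P of Ker ε and a graded isomorphism T(P) → V which is the
-- inclusion on letters (`WordStr`). A tensor space carries all three structures: half-shuffle with
-- deconcatenation, concatenation with the half-unshuffle, concatenation with deconcatenation. They
-- are natural in the letters, so transport along T(P) → V gives three functors out of `WordObj`.
--
-- The converse is a rigidity statement: every bialgebra is a tensor space over its primitive
-- elements. In each case there is a half-coproduct D (Δ - 1 ⊗ Id for shuffle and infinitesimal
-- bialgebras, δ_≺ for unshuffle bialgebras) with (D ⊗ Id) D = (Id ⊗ Δ) D, and an operation op (the
-- half-shuffle or the product) with D(op(p, y)) = op(p, y₁) ⊗ y₂ as soon as D(p) = p ⊗ 1.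
-- `HalfBialg` retains just this. A recursion on the degree, e(x) = x - op(e(x'), x''), defines a
-- projection e onto the primitive elements (`HalfBialg.exists_proj`), and e(op(p, y)) = ε(y) p
-- (`HalfBialg.proj_op`). Thus D separates the first letter from the rest of a word: G(x) = ε(x) +
-- e(x') G(x'') inverts the map p₁ ⋯ p_n ↦ op(p₁, op(p₂, ⋯)) (`HalfBialg.word_bijective`). Nothing
-- is divided by an integer, so the characteristic plays no role.
--
-- Induction on words shows that this isomorphism turns the operations of the bialgebra into the
-- standard ones on T(P); hence going from a bialgebra to words and back changes nothing. Going from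
-- words to a bialgebra and back changes nothing either, because the presentation by words is unique
-- (`HalfBialg.toWord_eq`). As the functors do not touch underlying maps and the forgetful functors
-- are faithful, equality on objects suffices (`eq_id_of_comp_faithful`).
--
-- The functor P, the isomorphisms I and the action of 𝐒 are built once, on `WordObj`, and pulled
-- back. The isomorphisms between the three categories pass through `WordObj`, so their
-- compatibility with these data is formal.

namespace SchurWeyl

/-! ### Graded linear algebra -/

section

variable {K : Type u} [Field K]

theorem GrSpace.tmul_mem_tensorDeg (V : GrSpace.{u, w} K) {i j n : ℕ} (h : i + j = n)
    {a b : V.carrier} (ha : a ∈ V.deg i) (hb : b ∈ V.deg j) : a ⊗ₜ[K] b ∈ V.tensorDeg n := by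
  refine Submodule.mem_iSup_of_mem (i, j) (Submodule.mem_iSup_of_mem ?_ ?_)
  · simpa using h
  · exact ⟨(⟨a, ha⟩ : V.deg i) ⊗ₜ[K] (⟨b, hb⟩ : V.deg j), by simp [TensorProduct.mapIncl]⟩

theorem GrSpace.tensorDeg_le (V : GrSpace.{u, w} K) {n : ℕ}
    {S : Submodule K (V.carrier ⊗[K] V.carrier)}
    (h : ∀ i j, i + j = n → ∀ a ∈ V.deg i, ∀ b ∈ V.deg j, a ⊗ₜ[K] b ∈ S) :
    V.tensorDeg n ≤ S := by
  refine iSup₂_le fun p hp => ?_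
  rintro _ ⟨t, rfl⟩
  induction t using TensorProduct.induction_on with
  | zero => simp
  | tmul a b =>
    simpa [TensorProduct.mapIncl] using
      h p.1 p.2 (by simpa using hp) a a.2 b b.2
  | add x y hx hy => simpa using S.add_mem hx hy

theorem GrSpace.eqOn_tensorDeg {M : Type*} [AddCommGroup M] [Module K M]
    (V : GrSpace.{u, w} K) {n : ℕ} {f g : V.carrier ⊗[K] V.carrier →ₗ[K] M}
    (h : ∀ i j, i + j = n → ∀ a ∈ V.deg i, ∀ b ∈ V.deg j, f (a ⊗ₜ[K] b) = g (a ⊗ₜ[K] b)) :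
    ∀ t ∈ V.tensorDeg n, f t = g t :=
  V.tensorDeg_le (S := LinearMap.eqLocus f g) h

theorem GrSpace.map_mem_tensorDeg {V : GrSpace.{u, v} K} {W : GrSpace.{u, w} K}
    {f g : V.carrier →ₗ[K] W.carrier} (hf : ∀ n, ∀ x ∈ V.deg n, f x ∈ W.deg n)
    (hg : ∀ n, ∀ x ∈ V.deg n, g x ∈ W.deg n) {n : ℕ} {t : V.carrier ⊗[K] V.carrier}
    (ht : t ∈ V.tensorDeg n) : TensorProduct.map f g t ∈ W.tensorDeg n :=
  V.tensorDeg_le (S := (W.tensorDeg n).comap (TensorProduct.map f g))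
    (fun i j hij a ha b hb => W.tmul_mem_tensorDeg hij (hf i a ha) (hg j b hb)) ht

theorem GrSpace.deg_induction (V : GrSpace.{u, w} K) {S : Submodule K V.carrier}
    (h : ∀ n, V.deg n ≤ S) (x : V.carrier) : x ∈ S := by
  have := V.internal.submodule_iSup_eq_top
  exact (iSup_le h : ⨆ n, V.deg n ≤ S) (this ▸ Submodule.mem_top)

/-- A linear map can be prescribed on each homogeneous component. -/
theorem GrSpace.exists_extend {M : Type*} [AddCommGroup M] [Module K M] (V : GrSpace.{u, w} K)
    (F : ℕ → V.carrier →ₗ[K] M) :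
    ∃ f : V.carrier →ₗ[K] M, ∀ n, ∀ x ∈ V.deg n, f x = F n x := by
  refine ⟨DirectSum.toModule K ℕ M (fun n => F n ∘ₗ (V.deg n).subtype) ∘ₗ
    V.equiv.symm.toLinearMap, fun n x hx => ?_⟩
  have h := V.equiv_symm_of_mem n x hx
  simp only [LinearMap.comp_apply, LinearEquiv.coe_coe, h, DirectSum.toModule_lof]
  rfl

/-- A recursion in which the values in degree `n` depend only on the values in lower degrees
has a solution. -/
theorem GrSpace.exists_fixedPoint {M : Type*} [AddCommGroup M] [Module K M]
    (V : GrSpace.{u, w} K) (Φ : (V.carrier →ₗ[K] M) → V.carrier →ₗ[K] M)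
    (h : ∀ n f g, (∀ i < n, ∀ x ∈ V.deg i, f x = g x) → ∀ x ∈ V.deg n, Φ f x = Φ g x) :
    ∃ f, Φ f = f := by
  -- The iterates of `Φ` starting from `0` stabilize degree by degree: from the `n`-th one on, they
  -- agree in all degrees below `n`.
  have stable : ∀ n k, ∀ i < n, ∀ x ∈ V.deg i, (Φ^[n + k]) 0 x = (Φ^[n]) 0 x := by
    intro n
    induction n with
    | zero => exact fun k i hi => absurd hi (Nat.not_lt_zero i)
    | succ n ih =>
      intro k i hi x hx
      rw [show n + 1 + k = (n + k) + 1 by omega, Function.iterate_succ_apply',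
        Function.iterate_succ_apply']
      exact h i _ _ (fun j hj y hy => ih k j (by omega) y hy) x hx
  -- Degree `n` is final only from the iterate `n + 1` on, hence the shift.
  obtain ⟨f, hf⟩ := V.exists_extend fun n => (Φ^[n + 1]) 0
  refine ⟨f, GrVectPlus.hom_ext_deg V _ _ fun n x hx => ?_⟩
  rw [hf n x hx, Function.iterate_succ_apply']
  refine h n _ _ (fun i hi y hy => ?_) x hx
  obtain ⟨k, rfl⟩ := Nat.exists_eq_add_of_lt hi
  rw [hf i y hy, show i + k + 1 = (i + 1) + k by omega]
  exact (stable (i + 1) k i (by omega) y hy).symm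

/-- The component of degree `n` of an element of `V ⊗ V` is obtained by projection. -/
theorem GrSpace.sum_map_proj_of_mem (V : GrSpace.{u, w} K) (m n : ℕ)
    (t : V.carrier ⊗[K] V.carrier) (ht : t ∈ V.tensorDeg m) :
    (∑ p ∈ Finset.HasAntidiagonal.antidiagonal n, TensorProduct.map (V.proj p.1) (V.proj p.2)) t
      = if m = n then t else 0 := by
  have key : ∀ i j, i + j = m → ∀ a ∈ V.deg i, ∀ b ∈ V.deg j,
      (∑ p ∈ Finset.HasAntidiagonal.antidiagonal n, TensorProduct.map (V.proj p.1) (V.proj p.2)) (a ⊗ₜ[K] b)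
      = if m = n then a ⊗ₜ[K] b else 0 := by
    intro i j hij a ha b hb
    rw [LinearMap.sum_apply]
    simp only [TensorProduct.map_tmul, V.proj_of_mem i _ a ha, V.proj_of_mem j _ b hb]
    split_ifs with hmn
    · rw [Finset.sum_eq_single (i, j)]
      · simp
      · rintro ⟨i', j'⟩ _ hne
        by_cases h1 : i = i'
        · have h2 : j ≠ j' := fun h2 => hne (by rw [h1, h2])
          simp [h2]
        · simp [h1]
      · intro h
        exact absurd (by simp [hij, hmn]) h
    · refine Finset.sum_eq_zero ?_
      rintro ⟨i', j'⟩ hp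
      by_cases h1 : i = i'
      · have h2 : j ≠ j' := by
          rintro rfl
          subst h1
          exact hmn (hij.symm.trans (by simpa using hp))
        simp [h2]
      · simp [h1]
  split_ifs with hmn
  · exact V.eqOn_tensorDeg (g := LinearMap.id)
      (fun i j hij a ha b hb => (key i j hij a ha b hb).trans (if_pos hmn)) t ht
  · exact V.eqOn_tensorDeg (g := 0)
      (fun i j hij a ha b hb => (key i j hij a ha b hb).trans (if_neg hmn)) t ht

/-- A graded map `V → V ⊗ V` commutes with the projections. -/
theorem GrSpace.map_proj_of_graded (V : GrSpace.{u, w} K)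
    (f : V.carrier →ₗ[K] V.carrier ⊗[K] V.carrier)
    (hf : ∀ n, ∀ x ∈ V.deg n, f x ∈ V.tensorDeg n) (n : ℕ) (x : V.carrier) :
    f (V.proj n x)
      = (∑ p ∈ Finset.HasAntidiagonal.antidiagonal n, TensorProduct.map (V.proj p.1) (V.proj p.2)) (f x) := by
  suffices h : f ∘ₗ V.proj n
      = (∑ p ∈ Finset.HasAntidiagonal.antidiagonal n, TensorProduct.map (V.proj p.1) (V.proj p.2)) ∘ₗ f from
    LinearMap.congr_fun h x
  refine GrVectPlus.hom_ext_deg V _ _ fun m y hy => ?_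
  rw [LinearMap.comp_apply, LinearMap.comp_apply, V.sum_map_proj_of_mem m n _ (hf m y hy),
    V.proj_of_mem m n y hy]
  split_ifs <;> simp

-- The augmentation and the projection onto Ker ε

theorem GrVectPlus.one_mem (V : GrVectPlus.{u, w} K) : V.one ∈ V.deg 0 :=
  V.deg_zero ▸ Submodule.mem_span_singleton_self V.one

@[simp] theorem GrVectPlus.aug_one (V : GrVectPlus.{u, w} K) : V.aug V.one = 1 := by
  simpa using V.aug_of_deg_zero 1

/-- The projection of `V` onto `Ker ε`. -/
noncomputable def GrVectPlus.red (V : GrVectPlus.{u, w} K) : V.carrier →ₗ[K] V.carrier :=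
  LinearMap.id - V.aug.smulRight V.one

theorem GrVectPlus.red_apply (V : GrVectPlus.{u, w} K) (x : V.carrier) :
    V.red x = x - V.aug x • V.one := rfl

@[simp] theorem GrVectPlus.red_one (V : GrVectPlus.{u, w} K) : V.red V.one = 0 := by
  simp [V.red_apply]

@[simp] theorem GrVectPlus.aug_red (V : GrVectPlus.{u, w} K) (x : V.carrier) :
    V.aug (V.red x) = 0 := by
  simp [V.red_apply]

theorem GrVectPlus.red_mem (V : GrVectPlus.{u, w} K) (x : V.carrier) :
    V.red x ∈ LinearMap.ker V.aug :=
  V.aug_red x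

theorem GrVectPlus.red_of_mem (V : GrVectPlus.{u, w} K) {x : V.carrier}
    (hx : x ∈ LinearMap.ker V.aug) : V.red x = x := by
  rw [V.red_apply, LinearMap.mem_ker.1 hx, zero_smul, sub_zero]

theorem GrVectPlus.red_add_aug (V : GrVectPlus.{u, w} K) (x : V.carrier) :
    V.red x + V.aug x • V.one = x := by
  simp [V.red_apply]

theorem GrVectPlus.eq_smul_one (V : GrVectPlus.{u, w} K) {x : V.carrier} (hx : x ∈ V.deg 0) :
    x = V.aug x • V.one := by
  rw [V.deg_zero] at hx
  obtain ⟨c, rfl⟩ := Submodule.mem_span_singleton.1 hx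
  rw [V.aug_of_deg_zero]

theorem GrVectPlus.map_deg_zero {M : Type*} [AddCommGroup M] [Module K M]
    (V : GrVectPlus.{u, w} K) {f : V.carrier →ₗ[K] M} (hf : f V.one = 0) {x : V.carrier}
    (hx : x ∈ V.deg 0) : f x = 0 := by
  rw [V.eq_smul_one hx, map_smul, hf, smul_zero]

/-- On `(V ⊗ V)_n`, a map `f ⊗ h` with `h(1) = 0` depends only on `f` in degrees `< n`. -/
theorem GrVectPlus.map_congr_left {M N : Type*} [AddCommGroup M] [Module K M] [AddCommGroup N]
    [Module K N] (V : GrVectPlus.{u, w} K) {n : ℕ} {f g : V.carrier →ₗ[K] M}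
    {h : V.carrier →ₗ[K] N} (hh : h V.one = 0) (hfg : ∀ i < n, ∀ x ∈ V.deg i, f x = g x)
    {t : V.carrier ⊗[K] V.carrier} (ht : t ∈ V.tensorDeg n) :
    TensorProduct.map f h t = TensorProduct.map g h t := by
  refine V.eqOn_tensorDeg (fun i j hij a ha b hb => ?_) t ht
  rw [TensorProduct.map_tmul, TensorProduct.map_tmul]
  -- In degree `j = 0` the right factor is a multiple of `1`, killed by `h`; otherwise the left
  -- factor has degree below `n`.
  rcases Nat.eq_zero_or_pos j with rfl | hj
  · rw [V.map_deg_zero hh hb, tmul_zero, tmul_zero]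
  · rw [hfg i (by omega) a ha]

/-- On `(V ⊗ V)_n`, a map `h ⊗ f` with `h(1) = 0` depends only on `f` in degrees `< n`. -/
theorem GrVectPlus.map_congr_right {M N : Type*} [AddCommGroup M] [Module K M] [AddCommGroup N]
    [Module K N] (V : GrVectPlus.{u, w} K) {n : ℕ} {f g : V.carrier →ₗ[K] M}
    {h : V.carrier →ₗ[K] N} (hh : h V.one = 0) (hfg : ∀ i < n, ∀ x ∈ V.deg i, f x = g x)
    {t : V.carrier ⊗[K] V.carrier} (ht : t ∈ V.tensorDeg n) :
    TensorProduct.map h f t = TensorProduct.map h g t := by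
  refine V.eqOn_tensorDeg (fun i j hij a ha b hb => ?_) t ht
  rw [TensorProduct.map_tmul, TensorProduct.map_tmul]
  rcases Nat.eq_zero_or_pos i with rfl | hi
  · rw [V.map_deg_zero hh ha, zero_tmul, zero_tmul]
  · rw [hfg j (by omega) b hb]

/-! ### Linear maps out of the tensor algebra -/

/-- Words are built by adding letters on the left. The induction principle of the algebra involves
products of arbitrary elements, so it is applied to the property of `a` that left multiplication by
`a` preserves `S`. -/
theorem tensorAlgebra_induction {M : Type*} [AddCommGroup M] [Module K M]
    {S : Submodule K (TensorAlgebra K M)} (one : 1 ∈ S)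
    (cons : ∀ x, ∀ t ∈ S, TensorAlgebra.ι K x * t ∈ S) (t : TensorAlgebra K M) : t ∈ S := by
  suffices h : ∀ a : TensorAlgebra K M, ∀ t ∈ S, a * t ∈ S by simpa using h t 1 one
  intro a
  induction a using TensorAlgebra.induction with
  | algebraMap r =>
    intro t ht
    rw [← Algebra.smul_def]
    exact S.smul_mem r ht
  | ι x => exact cons x
  | mul a b ha hb =>
    intro t ht
    rw [mul_assoc]
    exact ha _ (hb t ht)
  | add a b ha hb =>
    intro t ht
    rw [add_mul]
    exact S.add_mem (ha t ht) (hb t ht)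

theorem tensorAlgebra_linearMap_ext {M N : Type*} [AddCommGroup M] [Module K M] [AddCommGroup N]
    [Module K N] {f g : TensorAlgebra K M →ₗ[K] N} (one : f 1 = g 1)
    (cons : ∀ x t, f t = g t → f (TensorAlgebra.ι K x * t) = g (TensorAlgebra.ι K x * t)) :
    f = g :=
  LinearMap.ext fun t => tensorAlgebra_induction (S := LinearMap.eqLocus f g) one cons t

/-- The linear map `F` on the tensor algebra with `F(1) = a` and
`F(x t) = A(x)(t) + B(x)(F(t))`. -/
noncomputable def wordRec {M N : Type*} [AddCommGroup M] [Module K M] [AddCommGroup N] [Module K N]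
    (a : N) (A : M →ₗ[K] TensorAlgebra K M →ₗ[K] N) (B : M →ₗ[K] N →ₗ[K] N) :
    TensorAlgebra K M →ₗ[K] N :=
  -- A letter `x` acts on `T(M) × N` by `(t, n) ↦ (x t, A(x)(t) + B(x)(n))`: the first component
  -- keeps track of the word, on which the term with `A` depends. The universal property extends
  -- this to an action of `T(M)`, which is applied to `(1, a)`.
  LinearMap.snd K (TensorAlgebra K M) N ∘ₗ LinearMap.applyₗ ((1 : TensorAlgebra K M), a) ∘ₗ
    (TensorAlgebra.lift K (A := Module.End K (TensorAlgebra K M × N))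
      (LinearMap.mk₂ K (fun x p => (TensorAlgebra.ι K x * p.1, A x p.1 + B x p.2))
        (fun x y p => by ext <;> simp [add_mul]; abel) (fun c x p => by ext <;> simp)
        (fun x p q => by ext <;> simp [mul_add]; abel) (fun c x p => by ext <;> simp))).toLinearMap

section

variable {M N : Type*} [AddCommGroup M] [Module K M] [AddCommGroup N] [Module K N]
    (a : N) (A : M →ₗ[K] TensorAlgebra K M →ₗ[K] N) (B : M →ₗ[K] N →ₗ[K] N)

@[simp] theorem wordRec_one : wordRec a A B 1 = a := by
  simp [wordRec]

theorem wordRec_cons (x : M) (t : TensorAlgebra K M) :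
    wordRec a A B (TensorAlgebra.ι K x * t) = A x t + B x (wordRec a A B t) := by
  -- The first component of the action on `(1, a)` is the word itself.
  have h : ∀ s : TensorAlgebra K M,
      (TensorAlgebra.lift K (A := Module.End K (TensorAlgebra K M × N))
      (LinearMap.mk₂ K (fun x p => (TensorAlgebra.ι K x * p.1, A x p.1 + B x p.2))
        (fun x y p => by ext <;> simp [add_mul]; abel) (fun c x p => by ext <;> simp)
        (fun x p q => by ext <;> simp [mul_add]; abel) (fun c x p => by ext <;> simp)) s (1, a)).1
      = s := by
    intro s
    refine tensorAlgebra_induction (S := LinearMap.eqLocus (LinearMap.fst K _ N ∘ₗ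
      LinearMap.applyₗ ((1 : TensorAlgebra K M), a) ∘ₗ (TensorAlgebra.lift K
        (A := Module.End K (TensorAlgebra K M × N)) _).toLinearMap) LinearMap.id) ?_ ?_ s
    · simp
    · intro x t ht
      simp only [LinearMap.mem_eqLocus, LinearMap.comp_apply, AlgHom.toLinearMap_apply,
        LinearMap.applyₗ_apply_apply, LinearMap.fst_apply, LinearMap.id_apply] at ht ⊢
      rw [map_mul, TensorAlgebra.lift_ι_apply, Module.End.mul_apply]
      simp [ht]
  simp only [wordRec, LinearMap.comp_apply, AlgHom.toLinearMap_apply,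
    LinearMap.applyₗ_apply_apply, LinearMap.snd_apply, map_mul, TensorAlgebra.lift_ι_apply,
    Module.End.mul_apply, LinearMap.mk₂_apply]
  rw [h]

end

end

/-! ### Graded subspaces of `Ker ε` -/

section

variable {K : Type u} [Field K]

/-- Requiring the equality for all large bounds, rather than for one, makes the condition stable
under sums. -/
theorem GrSpace.exists_sum_proj (V : GrSpace.{u, w} K) (x : V.carrier) :
    ∃ N, ∀ M ≥ N, ∑ n ∈ Finset.range M, V.proj n x = x := by
  refine V.deg_induction (S := {
    carrier := {x | ∃ N, ∀ M ≥ N, ∑ n ∈ Finset.range M, V.proj n x = x}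
    add_mem' := ?_
    zero_mem' := ⟨0, by simp⟩
    smul_mem' := ?_ }) ?_ x
  · rintro a b ⟨N, hN⟩ ⟨N', hN'⟩
    refine ⟨max N N', fun M hM => ?_⟩
    simp only [map_add, Finset.sum_add_distrib]
    rw [hN M (le_trans (le_max_left _ _) hM), hN' M (le_trans (le_max_right _ _) hM)]
  · rintro c a ⟨N, hN⟩
    refine ⟨N, fun M hM => ?_⟩
    simp only [map_smul, ← Finset.smul_sum]
    rw [hN M hM]
  · intro m y hy
    refine ⟨m + 1, fun M hM => ?_⟩
    simp only [V.proj_of_mem m _ y hy]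
    rw [Finset.sum_ite_eq, if_pos (Finset.mem_range.2 hM)]

/-- The projections of `V` recover the components of a direct sum of the pieces of `P`, which gives
injectivity; since they preserve `P`, the decomposition of an element of `P` in `V` stays in `P`,
which gives surjectivity. -/
theorem GrSpace.internal_comap (V : GrSpace.{u, w} K) (P : Submodule K V.carrier)
    (hP : ∀ n, ∀ x ∈ P, V.proj n x ∈ P) :
    DirectSum.IsInternal fun n => (V.deg n).comap P.subtype := by
  constructor
  · intro f g hfg
    have key : ∀ n, (V.proj n ∘ₗ P.subtype) ∘ₗ
        DirectSum.coeLinearMap (fun n => (V.deg n).comap P.subtype)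
        = (P.subtype ∘ₗ Submodule.subtype _) ∘ₗ DirectSum.component K ℕ _ n := by
      intro n
      refine DirectSum.linearMap_ext K fun m => LinearMap.ext fun x => ?_
      simp only [LinearMap.comp_apply, DirectSum.coeLinearMap_lof]
      rw [V.proj_of_mem m n _ x.2]
      split_ifs with hmn
      · subst hmn
        rw [DirectSum.component.lof_self]
        rfl
      · rw [DirectSum.component.of, dif_neg hmn]
        simp
    refine DFinsupp.ext fun n => Subtype.ext (Subtype.ext ?_)
    have h1 := LinearMap.congr_fun (key n) f
    have h2 := LinearMap.congr_fun (key n) g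
    have h3 : DirectSum.coeLinearMap (fun n => (V.deg n).comap P.subtype) f
      = DirectSum.coeLinearMap (fun n => (V.deg n).comap P.subtype) g := hfg
    simp only [LinearMap.comp_apply, h3] at h1 h2
    exact h1.symm.trans h2
  · intro x
    obtain ⟨N, hN⟩ := V.exists_sum_proj x.1
    refine ⟨∑ n ∈ Finset.range N, DirectSum.of (fun n => (V.deg n).comap P.subtype) n
      ⟨⟨V.proj n x.1, hP n _ x.2⟩, V.proj_mem n x.1⟩, Subtype.ext ?_⟩
    rw [map_sum]
    simp only [DirectSum.coeAddMonoidHom_of]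
    rw [AddSubmonoidClass.coe_finsetSum]
    exact hN N le_rfl

/-- A graded subspace of `Ker ε` as an object of `Vect`. -/
abbrev GrVectPlus.sub (V : GrVectPlus.{u, w} K) (P : Submodule K V.carrier)
    (hP : ∀ n, ∀ x ∈ P, V.proj n x ∈ P) (haug : P ≤ LinearMap.ker V.aug) : GrVect.{u, w} K where
  carrier := P
  deg n := (V.deg n).comap P.subtype
  internal := V.internal_comap P hP
  deg_zero := by
    refine (Submodule.eq_bot_iff _).2 fun x hx => Subtype.ext ?_
    have h := V.eq_smul_one (x := x.1) hx
    rwa [LinearMap.mem_ker.1 (haug x.2), zero_smul] at h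

/-- The words in homogeneous letters are preserved by a map `F` with `F(1) = 1` as soon as
`F(x t)` is obtained from `F(t)` by an operation of degree `|x|`. -/
theorem tensorGrading_induction {W : GrSpace.{u, v} K} {M : Type*} [AddCommGroup M] [Module K M]
    {D : ℕ → Submodule K M} {F : TensorAlgebra K W.carrier →ₗ[K] M} (one : F 1 ∈ D 0)
    (cons : ∀ i j, ∀ x ∈ W.deg i, ∀ t ∈ tensorGrading W j, F t ∈ D j →
      F (TensorAlgebra.ι K x * t) ∈ D (i + j)) (n : ℕ) :
    ∀ t ∈ tensorGrading W n, F t ∈ D n := by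
  refine fun t ht => (Submodule.span_le (p := (D n).comap F)).2 ?_ ht
  clear ht t
  rintro _ ⟨l, hl, hs, rfl⟩
  rw [SetLike.mem_coe, Submodule.mem_comap]
  induction l generalizing n with
  | nil =>
    obtain rfl : 0 = n := by simpa using hs
    simpa using one
  | cons p l ih =>
    have hl' : ∀ q ∈ l, q.2 ∈ W.deg q.1 := fun q hq => hl q (List.mem_cons_of_mem _ hq)
    obtain rfl : p.1 + (l.map Prod.fst).sum = n := by simpa using hs
    have hm : (l.map fun p => TensorAlgebra.ι K p.2).prod
        ∈ tensorGrading W (l.map Prod.fst).sum :=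
      Submodule.subset_span ⟨l, hl', rfl, rfl⟩
    rw [List.map_cons, List.prod_cons]
    exact cons p.1 _ p.2 (hl p List.mem_cons_self) _ hm (ih _ hl' rfl)

/-- A bijective homogeneous map has a homogeneous inverse. -/
theorem GrSpace.mem_deg_of_bijective {V : GrSpace.{u, v} K} {W : GrSpace.{u, w} K}
    {f : V.carrier →ₗ[K] W.carrier} (hf : Function.Injective f)
    (hdeg : ∀ n, ∀ x ∈ V.deg n, f x ∈ W.deg n) {n : ℕ} {x : V.carrier} (hx : f x ∈ W.deg n) :
    x ∈ V.deg n := by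
  -- A homogeneous map commutes with the projections, so `f` identifies `x` with its component of
  -- degree `n`.
  have h : f ∘ₗ V.proj n = W.proj n ∘ₗ f := by
    refine GrVectPlus.hom_ext_deg V _ _ fun m y hy => ?_
    rw [LinearMap.comp_apply, LinearMap.comp_apply, V.proj_of_mem m n y hy,
      W.proj_of_mem m n _ (hdeg m y hy)]
    split_ifs <;> simp
  have h' : f (V.proj n x) = f x := by
    have h2 := LinearMap.congr_fun h x
    rw [LinearMap.comp_apply, LinearMap.comp_apply, W.proj_of_mem n n _ hx, if_pos rfl] at h2
    exact h2
  rw [← hf h']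
  exact V.proj_mem n x

/-- The projection of the tensor algebra onto the words of length one. -/
noncomputable def tensorLetter {M : Type*} [AddCommGroup M] [Module K M] :
    TensorAlgebra K M →ₗ[K] M :=
  wordRec 0 (LinearMap.smulRightₗ (TensorAlgebra.algebraMapInv (R := K) (M := M)).toLinearMap) 0

section

variable {M : Type*} [AddCommGroup M] [Module K M]

@[simp] theorem tensorLetter_one : tensorLetter (1 : TensorAlgebra K M) = 0 := by
  simp [tensorLetter]

theorem tensorLetter_cons (x : M) (t : TensorAlgebra K M) :
    tensorLetter (TensorAlgebra.ι K x * t) = TensorAlgebra.algebraMapInv t • x := by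
  simp [tensorLetter, wordRec_cons]

@[simp] theorem tensorLetter_ι (x : M) : tensorLetter (TensorAlgebra.ι K x) = x := by
  rw [← mul_one (TensorAlgebra.ι K x), tensorLetter_cons, map_one, one_smul]

end

/-! ### Rigidity -/

/-- The common part of the three types of bialgebras: a coproduct `Δ`, a half-coproduct `D`
with `(D ⊗ Id) D = (Id ⊗ Δ) D` and an operation `op` such that `D(op(p, y)) = op(p, y₁) ⊗ y₂`
when `D(p) = p ⊗ 1`. -/
structure HalfBialg (V : GrVectPlus.{u, w} K) where
  comul : V.carrier →ₗ[K] V.carrier ⊗[K] V.carrier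
  half : V.carrier →ₗ[K] V.carrier ⊗[K] V.carrier
  op : V.carrier →ₗ[K] V.carrier →ₗ[K] V.carrier
  rTensor_counit : ∀ x, V.aug.rTensor V.carrier (comul x) = 1 ⊗ₜ[K] x
  lTensor_counit : ∀ x, V.aug.lTensor V.carrier (comul x) = x ⊗ₜ[K] 1
  comul_deg : ∀ n, ∀ x ∈ V.deg n, comul x ∈ V.toGrSpace.tensorDeg n
  comul_one : comul V.one = V.one ⊗ₜ[K] V.one
  half_deg : ∀ n, ∀ x ∈ V.deg n, half x ∈ V.toGrSpace.tensorDeg n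
  half_one : half V.one = 0
  rTensor_half : ∀ x, V.aug.rTensor V.carrier (half x) = 0
  lTensor_half : ∀ x, V.aug.lTensor V.carrier (half x) = V.red x ⊗ₜ[K] 1
  half_assoc : ∀ x, TensorProduct.assoc K V.carrier V.carrier V.carrier
      (half.rTensor V.carrier (half x)) = comul.lTensor V.carrier (half x)
  op_deg : ∀ m n, ∀ x ∈ V.deg m, ∀ y ∈ V.deg n, half x = x ⊗ₜ[K] V.one → op x y ∈ V.deg (m + n)
  op_one : ∀ x, op x V.one = x
  half_op : ∀ x y, half x = x ⊗ₜ[K] V.one → half (op x y) = (op x).rTensor V.carrier (comul y)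

namespace HalfBialg

variable {V : GrVectPlus.{u, w} K} (H : HalfBialg V)

/-- The space of the elements `p` with `D(p) = p ⊗ 1`. -/
def prim : Submodule K V.carrier :=
  LinearMap.eqLocus H.half ((TensorProduct.mk K V.carrier V.carrier).flip V.one)

theorem mem_prim {x : V.carrier} : x ∈ H.prim ↔ H.half x = x ⊗ₜ[K] V.one := Iff.rfl

/-- Apply `Id ⊗ ε` to `D(x) = x ⊗ 1` and compare with `lTensor_half`: the result is `x = red(x)`. -/
theorem prim_le : H.prim ≤ LinearMap.ker V.aug := by
  intro x hx
  have h := H.lTensor_half x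
  rw [H.mem_prim.1 hx, LinearMap.lTensor_tmul, V.aug_one] at h
  have h2 : x = V.red x := by
    simpa using congrArg (TensorProduct.rid K V.carrier) h
  rw [h2]
  exact V.red_mem x

/-- The space of primitive elements is the kernel of the graded map `D - (· ⊗ 1)`, and graded maps
commute with projections. -/
theorem proj_mem_prim (n : ℕ) (x : V.carrier) (hx : x ∈ H.prim) :
    V.proj n x ∈ H.prim := by
  have h2 := V.toGrSpace.map_proj_of_graded
    (H.half - (TensorProduct.mk K V.carrier V.carrier).flip V.one)
    (fun m y hy => Submodule.sub_mem _ (H.half_deg m y hy)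
      (V.toGrSpace.tmul_mem_tensorDeg (add_zero m) hy V.one_mem)) n x
  rw [LinearMap.sub_apply, LinearMap.sub_apply, H.mem_prim.1 hx, LinearMap.flip_apply,
    LinearMap.flip_apply, TensorProduct.mk_apply, TensorProduct.mk_apply, sub_self, map_zero,
    sub_eq_zero] at h2
  exact h2

/-- Apply `Id ⊗ ε` to `D(op(p, y)) = op(p, y₁) ⊗ y₂`: the counit turns the right side into `op(p, y)
⊗ 1`, and `lTensor_half` gives `red(op(p, y)) ⊗ 1`. -/
theorem aug_op {p : V.carrier} (hp : p ∈ H.prim) (y : V.carrier) : V.red (H.op p y) = H.op p y := by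
  have h := H.lTensor_half (H.op p y)
  have e : V.aug.lTensor V.carrier ((H.op p).rTensor V.carrier (H.comul y))
      = (H.op p).rTensor K (V.aug.lTensor V.carrier (H.comul y)) :=
    LinearMap.congr_fun ((LinearMap.lTensor_comp_rTensor _ _ _).trans
      (LinearMap.rTensor_comp_lTensor _ _ _).symm) (H.comul y)
  rw [H.half_op p y hp, e, H.lTensor_counit, LinearMap.rTensor_tmul] at h
  simpa using (congrArg (TensorProduct.rid K V.carrier) h).symm

/-- Recursions on the degree need the second leg of `D` to have positive degree. Inserting `red`
there costs only the term described by `lTensor_half`; inserting it in the first leg costs nothing,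
by `rTensor_half`. -/
theorem map_red_half {M : Type*} [AddCommGroup M] [Module K M] (f : V.carrier →ₗ[K] M)
    (x : V.carrier) : TensorProduct.map f V.red (H.half x)
      = f.rTensor V.carrier (H.half x) - f (V.red x) ⊗ₜ[K] V.one := by
  have h : TensorProduct.map f V.red = f.rTensor V.carrier
      - TensorProduct.map f (LinearMap.toSpanSingleton K _ V.one) ∘ₗ V.aug.lTensor V.carrier := by
    ext a b
    simp [V.red_apply, tmul_sub]
  rw [h, LinearMap.sub_apply, LinearMap.comp_apply, H.lTensor_half]
  simp

theorem red_map_half {M : Type*} [AddCommGroup M] [Module K M] (f : V.carrier →ₗ[K] M)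
    (x : V.carrier) : TensorProduct.map V.red f (H.half x) = f.lTensor V.carrier (H.half x) := by
  have h : TensorProduct.map V.red f = f.lTensor V.carrier
      - TensorProduct.map (LinearMap.toSpanSingleton K _ V.one) f ∘ₗ V.aug.rTensor V.carrier := by
    ext a b
    simp [V.red_apply, sub_tmul, smul_tmul]
  rw [h, LinearMap.sub_apply, LinearMap.comp_apply, H.rTensor_half]
  simp

theorem half_red (x : V.carrier) : H.half (V.red x) = H.half x := by
  rw [V.red_apply, map_sub, map_smul, H.half_one, smul_zero, sub_zero]

/-- There is a projection onto the primitive elements, `e(x) = x - op(e(x'), x'')`. -/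
theorem exists_proj : ∃ e : V.carrier →ₗ[K] V.carrier, e V.one = 0 ∧
    (∀ x, TensorProduct.lift (H.op ∘ₗ e) (H.half x) = V.red x) ∧ ∀ x, e x ∈ H.prim := by
  -- The factor `red` on the second leg makes the recursion well founded: in degree `n` it only
  -- involves `e` in degrees below `n`.
  obtain ⟨e, he⟩ := V.toGrSpace.exists_fixedPoint
    (fun f => V.red - TensorProduct.lift H.op ∘ₗ TensorProduct.map f V.red ∘ₗ H.half) (by
      intro n f g hfg x hx
      simp only [LinearMap.sub_apply, LinearMap.comp_apply]
      rw [V.map_congr_left V.red_one hfg (H.half_deg n x hx)])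
  have he' : ∀ x, e x = V.red x
      - TensorProduct.lift H.op (TensorProduct.map e V.red (H.half x)) :=
    fun x => (LinearMap.congr_fun he x).symm
  have e1 : e V.one = 0 := by rw [he', H.half_one]; simp
  have ered : ∀ x, e (V.red x) = e x := fun x => by rw [V.red_apply]; simp [e1]
  -- Removing `red` from the second leg restores the term `op(e(x), 1) = e(x)`, so that the
  -- recursion reads `op(e(x'), x'') = red(x)`, summed over the whole of `D(x)`.
  have star : ∀ x, TensorProduct.lift H.op (e.rTensor V.carrier (H.half x)) = V.red x := by
    intro x
    have h := he' x
    rw [H.map_red_half, map_sub, TensorProduct.lift.tmul, H.op_one, ered] at h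
    rw [eq_comm, ← sub_eq_zero] at h ⊢
    rw [← h]
    abel
  have star' : TensorProduct.lift H.op ∘ₗ e.rTensor V.carrier ∘ₗ H.half = V.red :=
    LinearMap.ext star
  refine ⟨e, e1, fun x => ?_, fun x => ?_⟩
  · have : TensorProduct.lift (H.op ∘ₗ e)
        = TensorProduct.lift H.op ∘ₗ e.rTensor V.carrier := by ext; simp
    rw [this, LinearMap.comp_apply, star]
  suffices hn : ∀ n, ∀ x ∈ V.deg n, e x ∈ H.prim from
    V.toGrSpace.deg_induction (S := H.prim.comap e) hn x
  intro n
  induction n using Nat.strong_induction_on with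
  | _ n ih =>
    intro x hx
    -- `Ψ(a ⊗ b ⊗ c) = op(e a, b) ⊗ c`
    let Ψ : V.carrier ⊗[K] (V.carrier ⊗[K] V.carrier) →ₗ[K] V.carrier ⊗[K] V.carrier :=
      (TensorProduct.lift H.op).rTensor V.carrier ∘ₗ (e.rTensor V.carrier).rTensor V.carrier ∘ₗ
        (TensorProduct.assoc K V.carrier V.carrier V.carrier).symm.toLinearMap
    -- Only terms whose second leg has positive degree survive. Their first leg then has degree
    -- below `n`, so its image under `e` is primitive by induction and `half_op` applies.
    have h1 : H.half (TensorProduct.lift H.op (TensorProduct.map e V.red (H.half x)))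
        = Ψ (TensorProduct.map LinearMap.id (H.comul ∘ₗ V.red) (H.half x)) := by
      refine V.toGrSpace.eqOn_tensorDeg
        (f := H.half ∘ₗ TensorProduct.lift H.op ∘ₗ TensorProduct.map e V.red)
        (g := Ψ ∘ₗ TensorProduct.map LinearMap.id (H.comul ∘ₗ V.red)) ?_ _ (H.half_deg n x hx)
      intro i j hij a ha b hb
      simp only [LinearMap.comp_apply, TensorProduct.map_tmul, TensorProduct.lift.tmul]
      rcases Nat.eq_zero_or_pos j with rfl | hj
      · rw [V.map_deg_zero V.red_one hb]; simp
      · rw [H.half_op _ _ (ih i (by omega) a ha)]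
        generalize H.comul (V.red b) = t
        induction t using TensorProduct.induction_on with
        | zero => simp
        | tmul c d => simp [Ψ]
        | add c d hc hd => simp only [map_add, tmul_add, hc, hd]
    have h2 : TensorProduct.map LinearMap.id (H.comul ∘ₗ V.red) (H.half x)
        = H.comul.lTensor V.carrier (H.half x) - V.red x ⊗ₜ[K] (V.one ⊗ₜ[K] V.one) := by
      have h3 := H.map_red_half LinearMap.id x
      have h4 := congrArg (H.comul.lTensor V.carrier) h3
      rw [map_sub, LinearMap.lTensor_tmul, H.comul_one] at h4
      simp only [LinearMap.rTensor_id, LinearMap.id_apply] at h4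
      rw [← h4]
      exact (LinearMap.congr_fun (LinearMap.lTensor_comp_map _ _ _ _) (H.half x)).symm
    -- `(Id ⊗ Δ) D = (D ⊗ Id) D`, and `star` collapses `Ψ ∘ (D ⊗ Id)` to `red ⊗ Id`, which fixes
    -- `D(x)`.
    have h5 : Ψ (H.comul.lTensor V.carrier (H.half x)) = H.half x := by
      rw [← H.half_assoc]
      have : Ψ ∘ₗ (TensorProduct.assoc K V.carrier V.carrier V.carrier).toLinearMap ∘ₗ
          H.half.rTensor V.carrier = TensorProduct.map V.red LinearMap.id := by
        rw [← star']
        ext a b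
        simp [Ψ]
      have h6 := LinearMap.congr_fun this (H.half x)
      rw [H.red_map_half] at h6
      simpa using h6
    -- Altogether `D(e(x)) = D(x) - (D(x) - Ψ(red(x) ⊗ 1 ⊗ 1))`, and `Ψ(red(x) ⊗ 1 ⊗ 1) = e(x) ⊗ 1`.
    rw [H.mem_prim, he' x, map_sub, H.half_red, h1, h2, map_sub, h5, ← he' x]
    simp [Ψ, H.op_one, ered]

/-- Insert `D(op(p, y)) = op(p, y₁) ⊗ y₂` into the recursion for `e`. By induction on the degree of
`y`, the subtracted term is `op(ε(y₁) p, red(y₂)) = op(p, red(y))`, and what is left of `op(p, y)`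
is `ε(y) p`. With `y = 1` this says that `e` fixes the primitive elements. -/
theorem proj_op {e : V.carrier →ₗ[K] V.carrier} (e1 : e V.one = 0)
    (he : ∀ x, TensorProduct.lift (H.op ∘ₗ e) (H.half x) = V.red x) {p : V.carrier}
    (hp : p ∈ H.prim) (y : V.carrier) : e (H.op p y) = V.aug y • p := by
  have ered : ∀ x, e (V.red x) = e x := fun x => by rw [V.red_apply]; simp [e1]
  suffices hn : ∀ n, ∀ y ∈ V.deg n, e (H.op p y) = V.aug y • p from
    V.toGrSpace.deg_induction (S := LinearMap.eqLocus (e ∘ₗ H.op p) (V.aug.smulRight p)) hn y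
  intro n
  induction n using Nat.strong_induction_on with
  | _ n ih =>
    intro y hy
    have h1 : ∀ x, e x = V.red x
        - TensorProduct.lift H.op (TensorProduct.map e V.red (H.half x)) := by
      intro x
      rw [H.map_red_half, map_sub, TensorProduct.lift.tmul, H.op_one, ered, ← he x]
      have : TensorProduct.lift (H.op ∘ₗ e)
          = TensorProduct.lift H.op ∘ₗ e.rTensor V.carrier := by ext; simp
      rw [this, LinearMap.comp_apply]
      abel
    have h2 : TensorProduct.map e V.red ((H.op p).rTensor V.carrier (H.comul y))
        = TensorProduct.map (V.aug.smulRight p) V.red (H.comul y) := by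
      rw [← LinearMap.comp_apply, LinearMap.map_comp_rTensor]
      exact V.map_congr_left V.red_one (fun i hi a ha => ih i hi a ha) (H.comul_deg n y hy)
    have h3 : TensorProduct.map (V.aug.smulRight p) V.red (H.comul y) = p ⊗ₜ[K] V.red y := by
      have : TensorProduct.map (V.aug.smulRight p) V.red
          = TensorProduct.map (LinearMap.toSpanSingleton K _ p) V.red ∘ₗ
            V.aug.rTensor V.carrier := by ext; simp
      rw [this, LinearMap.comp_apply, H.rTensor_counit]
      simp
    rw [h1, H.aug_op hp, H.half_op p y hp, h2, h3, TensorProduct.lift.tmul, V.red_apply, map_sub,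
      map_smul, H.op_one]
    abel

/-- The map `T(P) → V` sending the word `p₁ ⋯ p_n` to `op(p₁, op(p₂, ⋯))`. -/
noncomputable def word (P : Submodule K V.carrier) : TensorAlgebra K P →ₗ[K] V.carrier :=
  wordRec V.one 0 (H.op ∘ₗ P.subtype)

@[simp] theorem word_one (P : Submodule K V.carrier) : H.word P 1 = V.one := by simp [word]

theorem word_cons (P : Submodule K V.carrier) (p : P) (t : TensorAlgebra K P) :
    H.word P (TensorAlgebra.ι K p * t) = H.op p (H.word P t) := by
  simp [word, wordRec_cons]

theorem word_ι (P : Submodule K V.carrier) (p : P) : H.word P (TensorAlgebra.ι K p) = p := by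
  rw [← mul_one (TensorAlgebra.ι K p), word_cons, word_one, H.op_one]

/-- A bialgebra is isomorphic to the tensor space over its primitive elements. -/
theorem word_bijective : Function.Bijective (H.word H.prim) := by
  obtain ⟨e, e1, he, hmem⟩ := H.exists_proj
  let e' : V.carrier →ₗ[K] H.prim := e.codRestrict H.prim hmem
  have e'1 : (TensorAlgebra.ι K ∘ₗ e') V.one = 0 := by
    have : e' V.one = 0 := Subtype.ext e1
    rw [LinearMap.comp_apply, this, map_zero]
  -- The inverse map: `e'` reads the first letter and `G` treats the rest. Since `e'(1) = 0`, only
  -- values of `G` in lower degrees are used.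
  obtain ⟨G, hG⟩ := V.toGrSpace.exists_fixedPoint
    (fun f => V.aug.smulRight (1 : TensorAlgebra K H.prim)
      + LinearMap.mul' K (TensorAlgebra K H.prim) ∘ₗ
        TensorProduct.map (TensorAlgebra.ι K ∘ₗ e') f ∘ₗ H.half) (by
      intro n f g hfg x hx
      simp only [LinearMap.add_apply, LinearMap.comp_apply]
      rw [V.map_congr_right e'1 hfg (H.half_deg n x hx)])
  have hG' : ∀ x, G x = V.aug x • (1 : TensorAlgebra K H.prim)
      + LinearMap.mul' K (TensorAlgebra K H.prim)
        (TensorProduct.map (TensorAlgebra.ι K ∘ₗ e') G (H.half x)) :=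
    fun x => (LinearMap.congr_fun hG x).symm
  have G1 : G V.one = 1 := by rw [hG', H.half_one]; simp
  have hGJ : G ∘ₗ H.word H.prim = LinearMap.id := by
    refine tensorAlgebra_linearMap_ext (by simp [G1]) fun p t ht => ?_
    rw [LinearMap.comp_apply, LinearMap.id_apply] at ht
    -- By `proj_op`, applying `e` to `op(p, y₁)` produces `ε(y₁) p`, and the counit leaves the
    -- single term with first letter `p` and remainder `t`.
    have h1 : TensorProduct.map (TensorAlgebra.ι K ∘ₗ e') G
        ((H.op p).rTensor V.carrier (H.comul (H.word H.prim t)))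
        = TensorAlgebra.ι K p ⊗ₜ[K] t := by
      have h2 : (TensorAlgebra.ι K ∘ₗ e') ∘ₗ H.op p
          = LinearMap.toSpanSingleton K _ (TensorAlgebra.ι K p) ∘ₗ V.aug := by
        refine LinearMap.ext fun y => ?_
        have : e' (H.op p y) = V.aug y • p := Subtype.ext (H.proj_op e1 he p.2 y)
        simp [this]
      rw [← LinearMap.comp_apply, LinearMap.map_comp_rTensor, h2, ← LinearMap.map_comp_rTensor,
        LinearMap.comp_apply, H.rTensor_counit]
      simp [ht]
    have h3 : V.aug (H.op p (H.word H.prim t)) = 0 := by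
      rw [← H.aug_op p.2]
      exact V.aug_red _
    rw [LinearMap.comp_apply, word_cons, hG', H.half_op _ _ p.2, h1, h3]
    simp
  have hJG : ∀ x, H.word H.prim (G x) = x := by
    refine fun x => V.toGrSpace.deg_induction
      (S := LinearMap.eqLocus (H.word H.prim ∘ₗ G) LinearMap.id) ?_ x
    intro n
    induction n using Nat.strong_induction_on with
    | _ n ih =>
      intro x hx
      have h1 : H.word H.prim ∘ₗ LinearMap.mul' K (TensorAlgebra K H.prim) ∘ₗ
          TensorProduct.map (TensorAlgebra.ι K ∘ₗ e') G
          = TensorProduct.lift H.op ∘ₗ TensorProduct.map e (H.word H.prim ∘ₗ G) := by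
        ext a b
        simp [word_cons, e']
      -- As `e(1) = 0`, the second leg matters only in degrees below `n`, where `word ∘ G` is the
      -- identity by induction. What remains is `op(e(x'), x'') = red(x)`.
      have h2 := LinearMap.congr_fun h1 (H.half x)
      rw [LinearMap.comp_apply (TensorProduct.lift H.op),
        V.map_congr_right (g := LinearMap.id) e1 (fun i hi y hy => ih i hi hy)
        (H.half_deg n x hx)] at h2
      have h3 : TensorProduct.lift H.op (TensorProduct.map e LinearMap.id (H.half x)) = V.red x := by
        have : TensorProduct.lift (H.op ∘ₗ e)
            = TensorProduct.lift H.op ∘ₗ TensorProduct.map e LinearMap.id := by ext; simp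
        rw [← he x, this, LinearMap.comp_apply]
      simp only [LinearMap.comp_apply] at h2
      rw [h3] at h2
      rw [LinearMap.mem_eqLocus, LinearMap.comp_apply, hG', map_add, map_smul, h2, word_one,
        add_comm, V.red_add_aug]
      rfl
  exact ⟨Function.LeftInverse.injective (LinearMap.congr_fun hGJ),
    Function.RightInverse.surjective hJG⟩

theorem word_deg {P : Submodule K V.carrier} (hP : P ≤ H.prim)
    (hproj : ∀ n, ∀ x ∈ P, V.proj n x ∈ P) (n : ℕ) :
    ∀ t ∈ tensorGrading (V.sub P hproj (hP.trans H.prim_le)).toGrSpace n, H.word P t ∈ V.deg n := by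
  refine tensorGrading_induction (W := (V.sub P hproj (hP.trans H.prim_le)).toGrSpace)
    (D := V.deg) (F := H.word P) ?_ ?_ n
  · rw [word_one]
    exact V.one_mem
  · intro i j x hx t _ ht
    rw [word_cons]
    exact H.op_deg i j _ hx _ ht (hP x.2)

/-- The primitive elements are determined by any presentation by words. -/
theorem prim_le_of_surjective {P : Submodule K V.carrier} (hP : P ≤ H.prim)
    (h : Function.Surjective (H.word P)) : H.prim ≤ P := by
  intro x hx
  obtain ⟨t, ht⟩ := h x
  -- Words over `P` are words over all primitive elements, so by injectivity of the latter the
  -- preimage `t` of `x` becomes the one-letter word `x`.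
  have h1 : H.word H.prim ∘ₗ (tensorMap (Submodule.inclusion hP)).toLinearMap = H.word P := by
    refine tensorAlgebra_linearMap_ext (by simp) fun p s hs => ?_
    rw [LinearMap.comp_apply] at hs ⊢
    rw [word_cons, ← hs]
    simp [tensorMap, word_cons]
  have h2 : tensorMap (Submodule.inclusion hP) t = TensorAlgebra.ι K ⟨x, hx⟩ := by
    refine H.word_bijective.1 ?_
    rw [word_ι]
    exact (LinearMap.congr_fun h1 t).trans ht
  -- Taking the part of length one commutes with the inclusion of letters; hence `x` is the part of
  -- length one of `t`, an element of `P`.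
  have h3 : tensorLetter ∘ₗ (tensorMap (Submodule.inclusion hP)).toLinearMap
      = Submodule.inclusion hP ∘ₗ tensorLetter := by
    refine tensorAlgebra_linearMap_ext (by simp) fun p s _ => ?_
    have h4 : TensorAlgebra.algebraMapInv.comp (tensorMap (Submodule.inclusion hP))
        = TensorAlgebra.algebraMapInv := TensorAlgebra.hom_ext (by
        ext; simp [tensorMap, TensorAlgebra.algebraMapInv])
    have h5 := AlgHom.congr_fun h4 s
    rw [AlgHom.comp_apply] at h5
    simp only [LinearMap.comp_apply, AlgHom.toLinearMap_apply, map_mul, tensorLetter_cons,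
      map_smul, ← h5]
    rw [tensorMap, TensorAlgebra.lift_ι_apply, LinearMap.comp_apply, tensorLetter_cons]
  have h4 := LinearMap.congr_fun h3 t
  rw [LinearMap.comp_apply, AlgHom.toLinearMap_apply, h2, tensorLetter_ι] at h4
  rw [show x = ((tensorLetter t : P) : V.carrier) from congrArg Subtype.val h4]
  exact Subtype.property _

end HalfBialg

end

/-! ### The operations on tensor spaces -/

section

variable {K : Type u} [Field K] {M : Type w} [AddCommGroup M] [Module K M]

theorem map₂_tmul_tmul {A A' B B' C C' : Type*} [AddCommGroup A] [Module K A] [AddCommGroup A']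
    [Module K A'] [AddCommGroup B] [Module K B] [AddCommGroup B'] [Module K B'] [AddCommGroup C]
    [Module K C] [AddCommGroup C'] [Module K C'] (f : A →ₗ[K] B →ₗ[K] C)
    (g : A' →ₗ[K] B' →ₗ[K] C') (a : A) (a' : A') (b : B) (b' : B') :
    TensorProduct.map₂ f g (a ⊗ₜ[K] a') (b ⊗ₜ[K] b') = f a b ⊗ₜ[K] g a' b' := rfl

theorem map₂_mul_mul {A B : Type*} [Ring A] [Algebra K A] [Ring B] [Algebra K B] (s t : A ⊗[K] B) :
    TensorProduct.map₂ (LinearMap.mul K A) (LinearMap.mul K B) s t = s * t := by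
  have h : TensorProduct.map₂ (LinearMap.mul K A) (LinearMap.mul K B)
      = LinearMap.mul K (A ⊗[K] B) := by
    ext; simp
  rw [h, LinearMap.mul_apply']

/-- The left multiplication by `x ⊗ 1` on `T(M) ⊗ T(M)`. -/
noncomputable def letterMul :
    M →ₗ[K] TensorAlgebra K M ⊗[K] TensorAlgebra K M →ₗ[K]
      TensorAlgebra K M ⊗[K] TensorAlgebra K M :=
  LinearMap.mul K _ ∘ₗ (TensorProduct.mk K _ _).flip 1 ∘ₗ TensorAlgebra.ι K

theorem letterMul_apply (x : M) (s : TensorAlgebra K M ⊗[K] TensorAlgebra K M) :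
    letterMul x s = (TensorAlgebra.ι K x ⊗ₜ[K] 1) * s := rfl

@[simp] theorem letterMul_tmul (x : M) (a b : TensorAlgebra K M) :
    letterMul x (a ⊗ₜ[K] b) = (TensorAlgebra.ι K x * a) ⊗ₜ[K] b := by
  simp [letterMul_apply]

theorem letterMul_eq_rTensor (x : M) :
    letterMul x = (LinearMap.mulLeft K (TensorAlgebra.ι K x)).rTensor (TensorAlgebra K M) := by
  ext; simp

theorem map_letterMul {N N' : Type*} [AddCommGroup N] [Module K N] [AddCommGroup N'] [Module K N']
    (f : TensorAlgebra K M →ₗ[K] N) (g : TensorAlgebra K M →ₗ[K] N') (x : M)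
    (s : TensorAlgebra K M ⊗[K] TensorAlgebra K M) :
    TensorProduct.map f g (letterMul x s)
      = TensorProduct.map (f ∘ₗ LinearMap.mulLeft K (TensorAlgebra.ι K x)) g s := by
  rw [letterMul_eq_rTensor]
  exact LinearMap.congr_fun (LinearMap.map_comp_rTensor _ _ _ _) s

-- Deconcatenation and its relation to concatenation

/-- Deconcatenation, `x₁ ⋯ x_n ↦ ∑ x₁ ⋯ x_i ⊗ x_{i+1} ⋯ x_n`. -/
noncomputable def deconc : TensorAlgebra K M →ₗ[K] TensorAlgebra K M ⊗[K] TensorAlgebra K M :=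
  wordRec (1 ⊗ₜ[K] 1) ((LinearMap.mul K _ ∘ₗ TensorAlgebra.ι K).compr₂ (TensorProduct.mk K _ _ 1))
    letterMul

@[simp] theorem deconc_one : deconc (1 : TensorAlgebra K M) = 1 ⊗ₜ[K] 1 := by simp [deconc]

theorem deconc_cons (x : M) (t : TensorAlgebra K M) :
    deconc (TensorAlgebra.ι K x * t)
      = 1 ⊗ₜ[K] (TensorAlgebra.ι K x * t) + letterMul x (deconc t) := by
  simp [deconc, wordRec_cons]

/-- Both iterated coproducts `F` satisfy the same recursion `F(x t) = 1 ⊗ 1 ⊗ x t + 1 ⊗ (x ⊗ 1) Δ(t)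
+ (x ⊗ 1 ⊗ 1) F(t)`. -/
theorem deconc_coassoc (t : TensorAlgebra K M) :
    TensorProduct.assoc K _ _ _ (deconc.rTensor (TensorAlgebra K M) (deconc t))
      = deconc.lTensor (TensorAlgebra K M) (deconc t) := by
  refine tensorAlgebra_induction (S := LinearMap.eqLocus
    ((TensorProduct.assoc K _ _ _).toLinearMap ∘ₗ deconc.rTensor (TensorAlgebra K M) ∘ₗ deconc)
    (deconc.lTensor (TensorAlgebra K M) ∘ₗ deconc)) ?_ ?_ t
  · simp
  · intro x t ht
    simp only [LinearMap.mem_eqLocus, LinearMap.comp_apply, LinearEquiv.coe_coe] at ht ⊢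
    have h1 : ∀ s : TensorAlgebra K M ⊗[K] TensorAlgebra K M,
        TensorProduct.assoc K _ _ _ (deconc.rTensor (TensorAlgebra K M) (letterMul x s))
        = 1 ⊗ₜ[K] letterMul x s + (LinearMap.mulLeft K (TensorAlgebra.ι K x)).rTensor _
          (TensorProduct.assoc K _ _ _ (deconc.rTensor (TensorAlgebra K M) s)) := by
      intro s
      induction s using TensorProduct.induction_on with
      | zero => simp
      | tmul a b =>
        rw [letterMul_tmul, LinearMap.rTensor_tmul, deconc_cons, add_tmul, map_add,
          TensorProduct.assoc_tmul, LinearMap.rTensor_tmul]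
        congr 1
        induction deconc a using TensorProduct.induction_on with
        | zero => simp
        | tmul c d => simp
        | add c d hc hd => simp only [map_add, add_tmul, hc, hd]
      | add a b ha hb => simp only [map_add, ha, hb, tmul_add]; abel
    have h2 : ∀ s : TensorAlgebra K M ⊗[K] TensorAlgebra K M,
        deconc.lTensor (TensorAlgebra K M) (letterMul x s)
        = (LinearMap.mulLeft K (TensorAlgebra.ι K x)).rTensor _
          (deconc.lTensor (TensorAlgebra K M) s) := by
      intro s
      rw [letterMul_eq_rTensor]
      exact LinearMap.congr_fun ((LinearMap.lTensor_comp_rTensor _ _ _).trans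
        (LinearMap.rTensor_comp_lTensor _ _ _).symm) s
    rw [deconc_cons, map_add, map_add, map_add, h1, ht, h2, LinearMap.rTensor_tmul,
      LinearMap.lTensor_tmul, deconc_one, deconc_cons, TensorProduct.assoc_tmul, tmul_add]
    abel

theorem rTensor_deconc (t : TensorAlgebra K M) :
    (TensorAlgebra.algebraMapInv (R := K) (M := M)).toLinearMap.rTensor (TensorAlgebra K M)
      (deconc t) = 1 ⊗ₜ[K] t := by
  refine tensorAlgebra_induction (S := LinearMap.eqLocus
    (TensorAlgebra.algebraMapInv.toLinearMap.rTensor (TensorAlgebra K M) ∘ₗ deconc)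
    (TensorProduct.mk K K _ 1)) ?_ ?_ t
  · simp
  · intro x t _
    have h : TensorAlgebra.algebraMapInv.toLinearMap.rTensor (TensorAlgebra K M) ∘ₗ letterMul x
        = 0 := by
      ext; simp [TensorAlgebra.algebraMapInv]
    have h' := LinearMap.congr_fun h (deconc t)
    rw [LinearMap.comp_apply] at h'
    simp [deconc_cons, h']

theorem lTensor_deconc (t : TensorAlgebra K M) :
    (TensorAlgebra.algebraMapInv (R := K) (M := M)).toLinearMap.lTensor (TensorAlgebra K M)
      (deconc t) = t ⊗ₜ[K] 1 := by
  refine tensorAlgebra_induction (S := LinearMap.eqLocus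
    (TensorAlgebra.algebraMapInv.toLinearMap.lTensor (TensorAlgebra K M) ∘ₗ deconc)
    ((TensorProduct.mk K _ K).flip 1)) ?_ ?_ t
  · simp
  · intro x t ht
    have h : TensorAlgebra.algebraMapInv.toLinearMap.lTensor (TensorAlgebra K M) ∘ₗ letterMul x
        = (LinearMap.mulLeft K (TensorAlgebra.ι K x)).rTensor K ∘ₗ
          TensorAlgebra.algebraMapInv.toLinearMap.lTensor (TensorAlgebra K M) := by
      ext; simp
    have h' := LinearMap.congr_fun h (deconc t)
    simp only [LinearMap.mem_eqLocus, LinearMap.comp_apply] at h' ht ⊢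
    rw [deconc_cons, map_add, h', ht]
    simp [TensorAlgebra.algebraMapInv]

/-- A cut of `s t` lies in `t` or in `s`; the cut between the two words is counted in both sums,
which explains the subtracted term. -/
theorem deconc_mul (s t : TensorAlgebra K M) :
    deconc (s * t) = (LinearMap.mul K _ s).rTensor _ (deconc t)
      + ((LinearMap.mul K _).flip t).lTensor _ (deconc s) - s ⊗ₜ[K] t := by
  refine tensorAlgebra_induction (S := LinearMap.eqLocus
    (deconc ∘ₗ (LinearMap.mul K _).flip t)
    ((LinearMap.applyₗ (deconc t) ∘ₗ LinearMap.rTensorHom _ ∘ₗ LinearMap.mul K _)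
      + ((LinearMap.mul K _).flip t).lTensor _ ∘ₗ deconc - (TensorProduct.mk K _ _).flip t))
    ?_ ?_ s
  · have h : (LinearMap.mul K (TensorAlgebra K M)) 1 = LinearMap.id := by ext; simp
    simp [h]
  · intro x s hs
    simp only [LinearMap.mem_eqLocus, LinearMap.comp_apply, LinearMap.sub_apply,
      LinearMap.add_apply, LinearMap.flip_apply, LinearMap.applyₗ_apply_apply,
      LinearMap.coe_rTensorHom, LinearMap.mul_apply', TensorProduct.mk_apply] at hs ⊢
    have h1 : (LinearMap.mul K (TensorAlgebra K M)) (TensorAlgebra.ι K x * s)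
        = LinearMap.mulLeft K (TensorAlgebra.ι K x) ∘ₗ LinearMap.mul K _ s := by
      ext; simp [mul_assoc]
    have h2 : ((LinearMap.mul K (TensorAlgebra K M)).flip t).lTensor _ (letterMul x (deconc s))
        = letterMul x (((LinearMap.mul K _).flip t).lTensor _ (deconc s)) := by
      rw [letterMul_eq_rTensor]
      exact LinearMap.congr_fun ((LinearMap.lTensor_comp_rTensor _ _ _).trans
        (LinearMap.rTensor_comp_lTensor _ _ _).symm) (deconc s)
    rw [mul_assoc, deconc_cons, hs, deconc_cons, map_add, h2, h1, LinearMap.rTensor_comp,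
      ← letterMul_eq_rTensor, LinearMap.comp_apply, map_sub, map_add, letterMul_tmul,
      LinearMap.lTensor_tmul, LinearMap.flip_apply, LinearMap.mul_apply', mul_assoc]
    abel

/-! The shuffle product -/

/-- The shuffle product, given by `x a ⧢ b = ∑ b₁ x (a ⧢ b₂)`. -/
noncomputable def shuf : TensorAlgebra K M →ₗ[K] TensorAlgebra K M →ₗ[K] TensorAlgebra K M :=
  wordRec LinearMap.id 0 (LinearMap.mk₂ K
    (fun x F => LinearMap.mul' K _ ∘ₗ
      (LinearMap.mulLeft K (TensorAlgebra.ι K x) ∘ₗ F).lTensor (TensorAlgebra K M) ∘ₗ deconc)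
    (fun x y F => by
      have : LinearMap.mulLeft K (TensorAlgebra.ι K (x + y)) ∘ₗ F
          = LinearMap.mulLeft K (TensorAlgebra.ι K x) ∘ₗ F
            + LinearMap.mulLeft K (TensorAlgebra.ι K y) ∘ₗ F := by ext; simp [add_mul]
      rw [this, LinearMap.lTensor_add, LinearMap.add_comp, LinearMap.comp_add])
    (fun c x F => by
      have : LinearMap.mulLeft K (TensorAlgebra.ι K (c • x)) ∘ₗ F
          = c • LinearMap.mulLeft K (TensorAlgebra.ι K x) ∘ₗ F := by ext; simp
      rw [this, LinearMap.lTensor_smul, LinearMap.smul_comp, LinearMap.comp_smul])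
    (fun x F G => by
      rw [LinearMap.comp_add, LinearMap.lTensor_add, LinearMap.add_comp, LinearMap.comp_add])
    (fun c x F => by
      rw [LinearMap.comp_smul, LinearMap.lTensor_smul, LinearMap.smul_comp, LinearMap.comp_smul]))

@[simp] theorem one_shuf (t : TensorAlgebra K M) : shuf 1 t = t := by simp [shuf]

theorem cons_shuf (x : M) (a b : TensorAlgebra K M) :
    shuf (TensorAlgebra.ι K x * a) b = LinearMap.mul' K _
      ((LinearMap.mulLeft K (TensorAlgebra.ι K x) ∘ₗ shuf a).lTensor _ (deconc b)) := by
  simp [shuf, wordRec_cons]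

@[simp] theorem shuf_one (t : TensorAlgebra K M) : shuf t 1 = t := by
  refine tensorAlgebra_induction (S := LinearMap.eqLocus (shuf.flip 1) LinearMap.id) ?_ ?_ t
  · simp
  · intro x t ht
    simp only [LinearMap.mem_eqLocus, LinearMap.flip_apply, LinearMap.id_apply] at ht ⊢
    simp [cons_shuf, ht]

/-- The definition is a recursion on the left argument alone. The usual symmetric recursion appears
on separating, in the deconcatenation of `y b`, the term with trivial left part from those whose
left part begins with `y`. -/
theorem shuf_cons_cons (x y : M) (a b : TensorAlgebra K M) :
    shuf (TensorAlgebra.ι K x * a) (TensorAlgebra.ι K y * b)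
      = TensorAlgebra.ι K x * shuf a (TensorAlgebra.ι K y * b)
        + TensorAlgebra.ι K y * shuf (TensorAlgebra.ι K x * a) b := by
  rw [cons_shuf, cons_shuf, deconc_cons, map_add, map_add]
  congr 1
  · simp
  · induction deconc b using TensorProduct.induction_on with
    | zero => simp
    | tmul c d => simp [mul_assoc]
    | add c d hc hd => simp only [map_add, hc, hd, mul_add]

theorem shuf_comm (s t : TensorAlgebra K M) : shuf s t = shuf t s := by
  have h : (shuf : TensorAlgebra K M →ₗ[K] _) = shuf.flip := by
    refine tensorAlgebra_linearMap_ext (by ext; simp) fun x a ha => ?_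
    refine tensorAlgebra_linearMap_ext (by simp) fun y b hb => ?_
    have ha' := LinearMap.congr_fun ha (TensorAlgebra.ι K y * b)
    rw [LinearMap.flip_apply] at hb ha' ⊢
    rw [shuf_cons_cons, shuf_cons_cons, hb, ha', add_comm]
  exact LinearMap.congr_fun (LinearMap.congr_fun h s) t

/-- The first letter of a shuffle of `x a`, `y b` and `z c` is `x`, `y` or `z`. Splitting both sides
accordingly, the three pieces agree by the induction hypotheses for `a`, `b` and `c`; the first two
are needed with arbitrary remaining arguments. -/
theorem shuf_assoc (r s t : TensorAlgebra K M) : shuf (shuf r s) t = shuf r (shuf s t) := by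
  have h : shuf.compr₂ shuf = (LinearMap.llcomp K (TensorAlgebra K M) (TensorAlgebra K M)
      (TensorAlgebra K M)).compl₁₂ shuf shuf := by
    refine tensorAlgebra_linearMap_ext (N := TensorAlgebra K M →ₗ[K] TensorAlgebra K M →ₗ[K]
      TensorAlgebra K M) ?_ fun x a ha => ?_
    · refine LinearMap.ext fun b => LinearMap.ext fun c => ?_
      simp
    refine tensorAlgebra_linearMap_ext ?_ fun y b hb => ?_
    · refine LinearMap.ext fun c => ?_
      simp
    refine tensorAlgebra_linearMap_ext ?_ fun z c hc => ?_
    · simp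
    have ha' : ∀ b c, shuf (shuf a b) c = shuf a (shuf b c) := fun b c =>
      LinearMap.congr_fun (LinearMap.congr_fun ha b) c
    have hb' : ∀ c, shuf (shuf (TensorAlgebra.ι K x * a) b) c
        = shuf (TensorAlgebra.ι K x * a) (shuf b c) := fun c => LinearMap.congr_fun hb c
    have hc' : shuf (shuf (TensorAlgebra.ι K x * a) (TensorAlgebra.ι K y * b)) c
        = shuf (TensorAlgebra.ι K x * a) (shuf (TensorAlgebra.ι K y * b) c) := hc
    change shuf (shuf (TensorAlgebra.ι K x * a) (TensorAlgebra.ι K y * b)) (TensorAlgebra.ι K z * c)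
        = shuf (TensorAlgebra.ι K x * a)
          (shuf (TensorAlgebra.ι K y * b) (TensorAlgebra.ι K z * c))
    rw [shuf_cons_cons, map_add, LinearMap.add_apply] at hc'
    rw [shuf_cons_cons, map_add, LinearMap.add_apply, shuf_cons_cons, shuf_cons_cons, ha', hb',
      shuf_cons_cons y z, map_add (shuf (TensorAlgebra.ι K x * a)), shuf_cons_cons x y,
      shuf_cons_cons x z, ← hc', map_add]
    simp only [mul_add]
    abel
  exact LinearMap.congr_fun (LinearMap.congr_fun (LinearMap.congr_fun h r) s) t

-- The half-shuffle and its compatibility with deconcatenation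

/-- The half-shuffle, given by `x a ≺ b = x (a ⧢ b)`. -/
noncomputable def halfShuf : TensorAlgebra K M →ₗ[K] TensorAlgebra K M →ₗ[K] TensorAlgebra K M :=
  wordRec 0 (LinearMap.mk₂ K (fun x a => LinearMap.mulLeft K (TensorAlgebra.ι K x) ∘ₗ shuf a)
    (fun x y a => by ext; simp [add_mul]) (fun c x a => by ext; simp)
    (fun x a b => by ext; simp [mul_add]) (fun c x a => by ext; simp)) 0

@[simp] theorem one_halfShuf (t : TensorAlgebra K M) : halfShuf 1 t = 0 := by simp [halfShuf]

@[simp] theorem cons_halfShuf (x : M) (a b : TensorAlgebra K M) :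
    halfShuf (TensorAlgebra.ι K x * a) b = TensorAlgebra.ι K x * shuf a b := by
  simp [halfShuf, wordRec_cons]

/-- Linear combinations of nonempty words. -/
theorem ker_algebraMapInv_induction {S : Submodule K (TensorAlgebra K M)}
    (cons : ∀ x t, TensorAlgebra.ι K x * t ∈ S) {t : TensorAlgebra K M}
    (ht : TensorAlgebra.algebraMapInv t = 0) : t ∈ S := by
  have h : ∀ t : TensorAlgebra K M, t - algebraMap K _ (TensorAlgebra.algebraMapInv t) ∈ S := by
    intro t
    refine tensorAlgebra_induction (S := S.comap ((LinearMap.id : TensorAlgebra K M →ₗ[K] _)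
      - Algebra.linearMap K _ ∘ₗ TensorAlgebra.algebraMapInv.toLinearMap)) ?_ ?_ t
    · simp
    · intro x t _
      simpa [TensorAlgebra.algebraMapInv] using cons x t
  simpa [ht] using h t

/-- The two summands are the two terms of `shuf_cons_cons`: the shuffles beginning with the first
letter of `s`, respectively of `t`. -/
theorem halfShuf_add {s t : TensorAlgebra K M} (hs : TensorAlgebra.algebraMapInv s = 0)
    (ht : TensorAlgebra.algebraMapInv t = 0) : shuf s t = halfShuf s t + halfShuf t s := by
  refine ker_algebraMapInv_induction
    (S := LinearMap.eqLocus (shuf.flip t) (halfShuf.flip t + halfShuf t)) (fun x a => ?_) hs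
  refine ker_algebraMapInv_induction
    (S := LinearMap.eqLocus (shuf (TensorAlgebra.ι K x * a))
      (halfShuf (TensorAlgebra.ι K x * a) + halfShuf.flip (TensorAlgebra.ι K x * a)))
      (fun y b => ?_) ht
  simp only [LinearMap.mem_eqLocus, LinearMap.add_apply, LinearMap.flip_apply, cons_halfShuf,
    shuf_cons_cons]
  rw [shuf_comm b]

/-- With `r = x a`, both sides begin with `x`, followed by a shuffle of `a`, `s` and `t`; the
identity is the associativity of the shuffle product. -/
theorem halfShuf_halfShuf {r s t : TensorAlgebra K M} (hr : TensorAlgebra.algebraMapInv r = 0) :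
    halfShuf (halfShuf r s) t = halfShuf r (shuf s t) := by
  refine ker_algebraMapInv_induction
    (S := LinearMap.eqLocus (halfShuf.flip t ∘ₗ halfShuf.flip s) (halfShuf.flip (shuf s t)))
      (fun x a => ?_) hr
  simp [shuf_assoc]

theorem map₂_letterMul_letterMul (x y : M) (s t : TensorAlgebra K M ⊗[K] TensorAlgebra K M) :
    TensorProduct.map₂ shuf shuf (letterMul x s) (letterMul y t)
      = letterMul x (TensorProduct.map₂ shuf shuf s (letterMul y t))
        + letterMul y (TensorProduct.map₂ shuf shuf (letterMul x s) t) := by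
  induction s using TensorProduct.induction_on with
  | zero => simp
  | add a b ha hb => simp only [map_add, LinearMap.add_apply, ha, hb]; abel
  | tmul a b =>
    induction t using TensorProduct.induction_on with
    | zero => simp
    | add c d hc hd => simp only [map_add, hc, hd]; abel
    | tmul c d => simp [shuf_cons_cons, add_tmul]

/-- Expand the coproducts of `x a` and `y b` by `deconc_cons`. The products in which both left
factors begin with a letter split by `map₂_letterMul_letterMul`; grouping the result by the leading
letter `x` or `y` gives the recursion for the left side. -/
theorem deconc_shuf (s t : TensorAlgebra K M) :
    deconc (shuf s t) = TensorProduct.map₂ shuf shuf (deconc s) (deconc t) := by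
  have h : (shuf : TensorAlgebra K M →ₗ[K] _).compr₂ deconc
      = (TensorProduct.map₂ shuf shuf).compl₁₂ deconc deconc := by
    have hone : (TensorProduct.map₂ shuf shuf ((1 : TensorAlgebra K M) ⊗ₜ[K]
        (1 : TensorAlgebra K M))) = LinearMap.id := by
      refine TensorProduct.ext' fun a b => ?_
      simp
    have hone' : (TensorProduct.map₂ shuf shuf).flip
        ((1 : TensorAlgebra K M) ⊗ₜ[K] (1 : TensorAlgebra K M)) = LinearMap.id := by
      refine TensorProduct.ext' fun a b => ?_
      simp
    refine tensorAlgebra_linearMap_ext (N := TensorAlgebra K M →ₗ[K] TensorAlgebra K M ⊗[K]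
      TensorAlgebra K M) ?_ fun x a ha => ?_
    · refine LinearMap.ext fun b => ?_
      simp [hone]
    refine tensorAlgebra_linearMap_ext ?_ fun y b hb => ?_
    · have := LinearMap.congr_fun hone' (deconc (TensorAlgebra.ι K x * a))
      rw [LinearMap.flip_apply] at this
      simp [this]
    have ha' := LinearMap.congr_fun ha (TensorAlgebra.ι K y * b)
    simp only [LinearMap.compr₂_apply, LinearMap.compl₁₂_apply] at ha' hb ⊢
    have h1 : ∀ (x : M) (s : TensorAlgebra K M ⊗[K] TensorAlgebra K M) (c : TensorAlgebra K M),
        TensorProduct.map₂ shuf shuf (letterMul x s) (1 ⊗ₜ[K] c)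
        = letterMul x (TensorProduct.map₂ shuf shuf s (1 ⊗ₜ[K] c)) := by
      intro x s c
      induction s using TensorProduct.induction_on with
      | zero => simp
      | add a b ha hb => simp only [map_add, LinearMap.add_apply, ha, hb]
      | tmul a b => simp
    have h2 : ∀ (y : M) (s : TensorAlgebra K M ⊗[K] TensorAlgebra K M) (c : TensorAlgebra K M),
        TensorProduct.map₂ shuf shuf (1 ⊗ₜ[K] c) (letterMul y s)
        = letterMul y (TensorProduct.map₂ shuf shuf (1 ⊗ₜ[K] c) s) := by
      intro x s c
      induction s using TensorProduct.induction_on with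
      | zero => simp
      | add a b ha hb => simp only [map_add, ha, hb]
      | tmul a b => simp
    rw [shuf_cons_cons, map_add, deconc_cons, deconc_cons, ha', hb]
    simp only [deconc_cons, map_add, LinearMap.add_apply, map₂_letterMul_letterMul, h1, h2,
      map₂_tmul_tmul, one_shuf, shuf_cons_cons, tmul_add]
    abel
  exact LinearMap.congr_fun (LinearMap.congr_fun h s) t

/-- For `s = x a` the difference `Δ(s) - 1 ⊗ s` is `(x ⊗ 1) Δ(a)`, so the formula reduces to
`deconc_cons` for `x (a ⧢ t)` and multiplicativity of `Δ` for shuffles. This is the condensed form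
of the compatibility axiom of shuffle bialgebras. -/
theorem deconc_halfShuf {s t : TensorAlgebra K M} (hs : TensorAlgebra.algebraMapInv s = 0) :
    deconc (halfShuf s t) = 1 ⊗ₜ[K] halfShuf s t
      + TensorProduct.map₂ halfShuf shuf (deconc s - 1 ⊗ₜ[K] s) (deconc t) := by
  refine ker_algebraMapInv_induction
    (S := LinearMap.eqLocus (deconc ∘ₗ halfShuf.flip t)
      (TensorProduct.mk K _ _ 1 ∘ₗ halfShuf.flip t + (TensorProduct.map₂ halfShuf shuf).flip
        (deconc t) ∘ₗ (deconc - TensorProduct.mk K _ _ 1))) (fun x a => ?_) hs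
  have h : ∀ s t : TensorAlgebra K M ⊗[K] TensorAlgebra K M,
      TensorProduct.map₂ halfShuf shuf (letterMul x s) t
        = letterMul x (TensorProduct.map₂ shuf shuf s t) := by
    intro s t
    induction s using TensorProduct.induction_on with
    | zero => simp
    | add a b ha hb => simp only [map_add, LinearMap.add_apply, ha, hb]
    | tmul a b =>
      induction t using TensorProduct.induction_on with
      | zero => simp
      | add c d hc hd => simp only [map_add, hc, hd]
      | tmul c d => simp
  simp only [LinearMap.mem_eqLocus, LinearMap.comp_apply, LinearMap.add_apply,
    LinearMap.flip_apply, LinearMap.sub_apply, TensorProduct.mk_apply, cons_halfShuf, deconc_cons,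
    add_sub_cancel_left, h, deconc_shuf]

/-! The unshuffle coproduct -/

/-- The unshuffle coproduct, for which the letters are primitive. -/
noncomputable def unshuf : TensorAlgebra K M →ₐ[K] TensorAlgebra K M ⊗[K] TensorAlgebra K M :=
  TensorAlgebra.lift K ((TensorProduct.mk K _ _).flip 1 ∘ₗ TensorAlgebra.ι K
    + TensorProduct.mk K _ _ 1 ∘ₗ TensorAlgebra.ι K)

@[simp] theorem unshuf_ι (x : M) : unshuf (TensorAlgebra.ι K x)
    = TensorAlgebra.ι K x ⊗ₜ[K] 1 + 1 ⊗ₜ[K] TensorAlgebra.ι K x := by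
  simp [unshuf]

/-- `unshuf` is an algebra morphism, so cocommutativity, like coassociativity and the counit
identities below, need only be checked on letters. -/
theorem unshuf_comm (t : TensorAlgebra K M) : TensorProduct.comm K _ _ (unshuf t) = unshuf t := by
  have h : (Algebra.TensorProduct.comm K (TensorAlgebra K M) (TensorAlgebra K M)).toAlgHom.comp
      unshuf = unshuf := TensorAlgebra.hom_ext (by ext; simp [add_comm])
  exact AlgHom.congr_fun h t

theorem unshuf_coassoc (t : TensorAlgebra K M) :
    TensorProduct.assoc K _ _ _ (unshuf.toLinearMap.rTensor (TensorAlgebra K M) (unshuf t))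
      = unshuf.toLinearMap.lTensor (TensorAlgebra K M) (unshuf t) := by
  have h : ((Algebra.TensorProduct.assoc K K K (TensorAlgebra K M) (TensorAlgebra K M)
      (TensorAlgebra K M)).toAlgHom.comp (Algebra.TensorProduct.map unshuf (AlgHom.id K _))).comp
        unshuf = (Algebra.TensorProduct.map (AlgHom.id K _) unshuf).comp unshuf :=
    TensorAlgebra.hom_ext (by
      ext; simp [add_tmul, tmul_add, Algebra.TensorProduct.one_def, add_assoc])
  exact AlgHom.congr_fun h t

theorem rTensor_unshuf (t : TensorAlgebra K M) :
    (TensorAlgebra.algebraMapInv (R := K) (M := M)).toLinearMap.rTensor (TensorAlgebra K M)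
      (unshuf t) = 1 ⊗ₜ[K] t := by
  have h : (Algebra.TensorProduct.map (TensorAlgebra.algebraMapInv (R := K) (M := M))
      (AlgHom.id K _)).comp unshuf = Algebra.TensorProduct.includeRight :=
    TensorAlgebra.hom_ext (by ext; simp [TensorAlgebra.algebraMapInv])
  exact AlgHom.congr_fun h t

theorem lTensor_unshuf (t : TensorAlgebra K M) :
    (TensorAlgebra.algebraMapInv (R := K) (M := M)).toLinearMap.lTensor (TensorAlgebra K M)
      (unshuf t) = t ⊗ₜ[K] 1 := by
  have h : (Algebra.TensorProduct.map (AlgHom.id K _)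
      (TensorAlgebra.algebraMapInv (R := K) (M := M))).comp unshuf
      = Algebra.TensorProduct.includeLeft :=
    TensorAlgebra.hom_ext (by ext; simp [TensorAlgebra.algebraMapInv])
  exact AlgHom.congr_fun h t

-- The half-unshuffle

/-- The half-unshuffle, given by `x a ↦ (x ⊗ 1) δ(a)`. -/
noncomputable def halfUnshuf : TensorAlgebra K M →ₗ[K] TensorAlgebra K M ⊗[K] TensorAlgebra K M :=
  wordRec 0 (letterMul.compl₂ unshuf.toLinearMap) 0

@[simp] theorem halfUnshuf_one : halfUnshuf (1 : TensorAlgebra K M) = 0 := by simp [halfUnshuf]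

@[simp] theorem halfUnshuf_cons (x : M) (t : TensorAlgebra K M) :
    halfUnshuf (TensorAlgebra.ι K x * t) = letterMul x (unshuf t) := by
  simp [halfUnshuf, wordRec_cons]

/-- In `δ(x a) = (x ⊗ 1) δ(a) + (1 ⊗ x) δ(a)` the second term is the switch of the first, because
`δ(a)` is symmetric. -/
theorem unshuf_eq_halfUnshuf_add {t : TensorAlgebra K M}
    (ht : TensorAlgebra.algebraMapInv t = 0) :
    unshuf t = halfUnshuf t + TensorProduct.comm K _ _ (halfUnshuf t) := by
  refine ker_algebraMapInv_induction (S := LinearMap.eqLocus unshuf.toLinearMap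
    (halfUnshuf + (TensorProduct.comm K _ _).toLinearMap ∘ₗ halfUnshuf)) (fun x a => ?_) ht
  have h : ∀ s : TensorAlgebra K M ⊗[K] TensorAlgebra K M,
      TensorProduct.comm K _ _ (letterMul x s)
        = (1 ⊗ₜ[K] TensorAlgebra.ι K x) * TensorProduct.comm K _ _ s := by
    intro s
    induction s using TensorProduct.induction_on with
    | zero => simp
    | add a b ha hb => simp only [map_add, mul_add, ha, hb]
    | tmul a b => simp
  simp only [LinearMap.mem_eqLocus, LinearMap.add_apply, LinearMap.comp_apply,
    AlgHom.toLinearMap_apply, LinearEquiv.coe_coe, halfUnshuf_cons, h, unshuf_comm, map_mul,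
    unshuf_ι]
  rw [add_mul, letterMul_apply]

/-- On `x a` both sides are the coassociativity identity of `δ` at `a`, multiplied by `x` in the
first factor. -/
theorem halfUnshuf_assoc {t : TensorAlgebra K M} (ht : TensorAlgebra.algebraMapInv t = 0) :
    TensorProduct.assoc K _ _ _ (halfUnshuf.rTensor (TensorAlgebra K M) (halfUnshuf t))
      = unshuf.toLinearMap.lTensor (TensorAlgebra K M) (halfUnshuf t) := by
  refine ker_algebraMapInv_induction (S := LinearMap.eqLocus
    ((TensorProduct.assoc K _ _ _).toLinearMap ∘ₗ halfUnshuf.rTensor (TensorAlgebra K M) ∘ₗ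
      halfUnshuf) (unshuf.toLinearMap.lTensor (TensorAlgebra K M) ∘ₗ halfUnshuf))
      (fun x a => ?_) ht
  have h1 : ∀ s : TensorAlgebra K M ⊗[K] TensorAlgebra K M,
      TensorProduct.assoc K _ _ _ (halfUnshuf.rTensor (TensorAlgebra K M) (letterMul x s))
        = (LinearMap.mulLeft K (TensorAlgebra.ι K x)).rTensor _ (TensorProduct.assoc K _ _ _
          (unshuf.toLinearMap.rTensor (TensorAlgebra K M) s)) := by
    intro s
    induction s using TensorProduct.induction_on with
    | zero => simp
    | add a b ha hb => simp only [map_add, ha, hb]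
    | tmul a b =>
      rw [letterMul_tmul, LinearMap.rTensor_tmul, LinearMap.rTensor_tmul, halfUnshuf_cons,
        AlgHom.toLinearMap_apply]
      induction unshuf a using TensorProduct.induction_on with
      | zero => simp
      | add a b ha hb => simp only [map_add, add_tmul, ha, hb]
      | tmul a b => simp
  have h2 : unshuf.toLinearMap.lTensor (TensorAlgebra K M) (letterMul x (unshuf a))
        = (LinearMap.mulLeft K (TensorAlgebra.ι K x)).rTensor _
          (unshuf.toLinearMap.lTensor (TensorAlgebra K M) (unshuf a)) := by
    rw [letterMul_eq_rTensor]
    exact LinearMap.congr_fun ((LinearMap.lTensor_comp_rTensor _ _ _).trans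
      (LinearMap.rTensor_comp_lTensor _ _ _).symm) (unshuf a)
  simp only [LinearMap.mem_eqLocus, LinearMap.comp_apply, LinearEquiv.coe_coe, halfUnshuf_cons,
    h1, h2, unshuf_coassoc]

theorem rTensor_halfUnshuf (t : TensorAlgebra K M) :
    (TensorAlgebra.algebraMapInv (R := K) (M := M)).toLinearMap.rTensor (TensorAlgebra K M)
      (halfUnshuf t) = 0 := by
  refine tensorAlgebra_induction (S := LinearMap.ker
    (TensorAlgebra.algebraMapInv.toLinearMap.rTensor (TensorAlgebra K M) ∘ₗ halfUnshuf)) ?_ ?_ t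
  · simp
  · intro x t _
    have h : TensorAlgebra.algebraMapInv.toLinearMap.rTensor (TensorAlgebra K M) ∘ₗ letterMul x
        = 0 := by
      ext; simp [TensorAlgebra.algebraMapInv]
    have h' := LinearMap.congr_fun h (unshuf t)
    rw [LinearMap.comp_apply] at h'
    simp [h']

theorem lTensor_halfUnshuf {t : TensorAlgebra K M} (ht : TensorAlgebra.algebraMapInv t = 0) :
    (TensorAlgebra.algebraMapInv (R := K) (M := M)).toLinearMap.lTensor (TensorAlgebra K M)
      (halfUnshuf t) = t ⊗ₜ[K] 1 := by
  refine ker_algebraMapInv_induction (S := LinearMap.eqLocus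
    (TensorAlgebra.algebraMapInv.toLinearMap.lTensor (TensorAlgebra K M) ∘ₗ halfUnshuf)
    ((TensorProduct.mk K _ K).flip 1)) (fun x t => ?_) ht
  have h : TensorAlgebra.algebraMapInv.toLinearMap.lTensor (TensorAlgebra K M) ∘ₗ letterMul x
      = (LinearMap.mulLeft K (TensorAlgebra.ι K x)).rTensor K ∘ₗ
        TensorAlgebra.algebraMapInv.toLinearMap.lTensor (TensorAlgebra K M) := by
    ext; simp
  have h' := LinearMap.congr_fun h (unshuf t)
  simp only [LinearMap.mem_eqLocus, LinearMap.comp_apply] at h' ⊢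
  rw [halfUnshuf_cons, h', lTensor_unshuf]
  simp

theorem halfUnshuf_mul {s : TensorAlgebra K M} (hs : TensorAlgebra.algebraMapInv s = 0)
    (t : TensorAlgebra K M) : halfUnshuf (s * t) = halfUnshuf s * unshuf t := by
  refine ker_algebraMapInv_induction (S := LinearMap.eqLocus
    (halfUnshuf ∘ₗ (LinearMap.mul K _).flip t) ((LinearMap.mul K _).flip (unshuf t) ∘ₗ halfUnshuf))
    (fun x a => ?_) hs
  simp [mul_assoc, letterMul_apply]

/-! Naturality -/

section

variable {N : Type w} [AddCommGroup N] [Module K N] (f : M →ₗ[K] N)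

theorem tensorMap_cons (x : M) (t : TensorAlgebra K M) :
    tensorMap f (TensorAlgebra.ι K x * t) = TensorAlgebra.ι K (f x) * tensorMap f t := by
  simp [tensorMap]

theorem map_tensorMap_letterMul (x : M) (s : TensorAlgebra K M ⊗[K] TensorAlgebra K M) :
    TensorProduct.map (tensorMap f).toLinearMap (tensorMap f).toLinearMap (letterMul x s)
      = letterMul (f x)
        (TensorProduct.map (tensorMap f).toLinearMap (tensorMap f).toLinearMap s) := by
  induction s using TensorProduct.induction_on with
  | zero => simp
  | add a b ha hb => simp only [map_add, ha, hb]
  | tmul a b => simp [tensorMap_cons]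

theorem deconc_tensorMap (t : TensorAlgebra K M) : deconc (tensorMap f t)
    = TensorProduct.map (tensorMap f).toLinearMap (tensorMap f).toLinearMap (deconc t) := by
  refine LinearMap.congr_fun (f := deconc ∘ₗ (tensorMap f).toLinearMap)
    (g := TensorProduct.map (tensorMap f).toLinearMap (tensorMap f).toLinearMap ∘ₗ deconc)
    (tensorAlgebra_linearMap_ext (by simp) fun x t ht => ?_) t
  simp only [LinearMap.comp_apply, AlgHom.toLinearMap_apply] at ht ⊢
  rw [tensorMap_cons, deconc_cons, deconc_cons, map_add, map_tensorMap_letterMul, ht]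
  simp [tensorMap_cons]

theorem tensorMap_shuf (s t : TensorAlgebra K M) :
    tensorMap f (shuf s t) = shuf (tensorMap f s) (tensorMap f t) := by
  have h : shuf.compr₂ (tensorMap f).toLinearMap
      = shuf.compl₁₂ (tensorMap f).toLinearMap (tensorMap f).toLinearMap := by
    refine tensorAlgebra_linearMap_ext (by ext; simp) fun x a ha => ?_
    refine tensorAlgebra_linearMap_ext (by simp) fun y b hb => ?_
    have ha' := LinearMap.congr_fun ha (TensorAlgebra.ι K y * b)
    simp only [LinearMap.compr₂_apply, LinearMap.compl₁₂_apply, AlgHom.toLinearMap_apply,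
      tensorMap_cons] at ha' hb ⊢
    rw [shuf_cons_cons, map_add, tensorMap_cons, tensorMap_cons, ha', hb, shuf_cons_cons]
  exact LinearMap.congr_fun (LinearMap.congr_fun h s) t

theorem tensorMap_halfShuf (s t : TensorAlgebra K M) :
    tensorMap f (halfShuf s t) = halfShuf (tensorMap f s) (tensorMap f t) := by
  refine LinearMap.congr_fun (f := (tensorMap f).toLinearMap ∘ₗ halfShuf.flip t)
    (g := halfShuf.flip (tensorMap f t) ∘ₗ (tensorMap f).toLinearMap)
    (tensorAlgebra_linearMap_ext (by simp) fun x a _ => ?_) s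
  simp [tensorMap_cons, tensorMap_shuf]

theorem unshuf_tensorMap (t : TensorAlgebra K M) : unshuf (tensorMap f t)
    = TensorProduct.map (tensorMap f).toLinearMap (tensorMap f).toLinearMap (unshuf t) := by
  have h : unshuf.comp (tensorMap f)
      = (Algebra.TensorProduct.map (tensorMap f) (tensorMap f)).comp unshuf :=
    TensorAlgebra.hom_ext (by ext; simp [tensorMap])
  exact AlgHom.congr_fun h t

theorem halfUnshuf_tensorMap (t : TensorAlgebra K M) : halfUnshuf (tensorMap f t)
    = TensorProduct.map (tensorMap f).toLinearMap (tensorMap f).toLinearMap (halfUnshuf t) := by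
  refine LinearMap.congr_fun (f := halfUnshuf ∘ₗ (tensorMap f).toLinearMap)
    (g := TensorProduct.map (tensorMap f).toLinearMap (tensorMap f).toLinearMap ∘ₗ halfUnshuf)
    (tensorAlgebra_linearMap_ext (by simp) fun x t _ => ?_) t
  simp [tensorMap_cons, map_tensorMap_letterMul, unshuf_tensorMap]

end

end

/-! ### The bialgebra structures on tensor spaces -/

section

variable {K : Type u} [Field K]

theorem CoalgStr.comul_eq_reduced {V : GrVectPlus.{u, w} K} (C : CoalgStr V) (x : V.carrier) :
    C.comul x = x ⊗ₜ[K] V.one + V.one ⊗ₜ[K] x + C.reduced x := by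
  simp [CoalgStr.reduced]

/-- For `x` in `Ker ε` the counit annihilates the first leg of the reduced coproduct, so `red` acts
trivially there. -/
theorem CoalgStr.map_red_reduced {V : GrVectPlus.{u, w} K} (C : CoalgStr V) {M : Type*}
    [AddCommGroup M] [Module K M] (f : V.carrier →ₗ[K] M) {x : V.carrier}
    (hx : x ∈ LinearMap.ker V.aug) :
    TensorProduct.map V.red f (C.reduced x) = f.lTensor V.carrier (C.reduced x) := by
  have h : TensorProduct.map V.red f = f.lTensor V.carrier
      - TensorProduct.map (LinearMap.toSpanSingleton K _ V.one) f ∘ₗ V.aug.rTensor V.carrier := by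
    ext a b
    simp [V.red_apply, sub_tmul, smul_tmul]
  have h2 : V.aug.rTensor V.carrier (C.reduced x) = 0 := by
    simp [CoalgStr.reduced, C.rTensor_counit, LinearMap.mem_ker.1 hx]
  rw [h, LinearMap.sub_apply, LinearMap.comp_apply, h2, map_zero, sub_zero]

/-- The condensed form `Δ(x ≺ y) = 1 ⊗ x ≺ y + (Δ(x) - 1 ⊗ x)(≺ ⊗ *)Δ(y)` of the compatibility
relation of a half-shuffle and a coproduct. -/
theorem CoalgStr.map₂_prec_mul {V : GrVectPlus.{u, w} K} (C : CoalgStr V)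
    {mul prec : V.carrier →ₗ[K] V.carrier →ₗ[K] V.carrier} (one_mul : ∀ x, mul V.one x = x)
    (mul_one : ∀ x, mul x V.one = x)
    (prec_one : ∀ x ∈ LinearMap.ker V.aug, prec x V.one = x) (one_prec : ∀ x, prec V.one x = 0)
    {x y : V.carrier} (hx : x ∈ LinearMap.ker V.aug) :
    V.one ⊗ₜ[K] prec x y
      + TensorProduct.map₂ prec mul (C.comul x - V.one ⊗ₜ[K] x) (C.comul y)
    = prec x y ⊗ₜ[K] V.one + V.one ⊗ₜ[K] prec x y + x ⊗ₜ[K] y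
      + (prec x).rTensor V.carrier (C.reduced y)
      + (prec.flip y).rTensor V.carrier (C.reduced x)
      + (mul.flip y).lTensor V.carrier (C.reduced x)
      + TensorProduct.map₂ prec mul (C.reduced x) (C.reduced y) := by
  have h1 : ∀ t : V.carrier ⊗[K] V.carrier,
      TensorProduct.map₂ prec mul (x ⊗ₜ[K] V.one) t = (prec x).rTensor V.carrier t := by
    intro t
    induction t using TensorProduct.induction_on with
    | zero => simp
    | add a b ha hb => simp only [map_add, ha, hb]
    | tmul a b => simp [one_mul]
  have h2 : ∀ t : V.carrier ⊗[K] V.carrier,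
      TensorProduct.map₂ prec mul t (y ⊗ₜ[K] V.one) = (prec.flip y).rTensor V.carrier t := by
    intro t
    induction t using TensorProduct.induction_on with
    | zero => simp
    | add a b ha hb => simp only [map_add, LinearMap.add_apply, ha, hb]
    | tmul a b => simp [mul_one]
  have h3 : ∀ t : V.carrier ⊗[K] V.carrier,
      TensorProduct.map₂ prec mul t (V.one ⊗ₜ[K] y)
        = TensorProduct.map (prec.flip V.one) (mul.flip y) t := by
    intro t
    induction t using TensorProduct.induction_on with
    | zero => simp
    | add a b ha hb => simp only [map_add, LinearMap.add_apply, ha, hb]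
    | tmul a b => simp
  -- The convention `1 ≺ 1 = 0` enters here: `≺ 1` is the projection onto `Ker ε`, not the identity.
  have h4 : prec.flip V.one = V.red := by
    refine LinearMap.ext fun z => ?_
    conv_lhs => rw [← V.red_add_aug z]
    rw [map_add, map_smul, LinearMap.flip_apply, LinearMap.flip_apply, one_prec, smul_zero,
      add_zero, prec_one _ (V.red_mem z)]
  have h5 : C.comul x - V.one ⊗ₜ[K] x = x ⊗ₜ[K] V.one + C.reduced x := by
    rw [C.comul_eq_reduced]
    abel
  rw [h5, C.comul_eq_reduced y]
  simp only [map_add, LinearMap.add_apply, h1, h2]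
  rw [h3 (C.reduced x), h4, C.map_red_reduced _ hx]
  simp only [LinearMap.rTensor_tmul, prec_one x hx]
  abel

/-- The tensor space `T(M)` as an object of `Vect⁺`. -/
noncomputable abbrev tensorPlus (M : GrVect.{u, w} K) : GrVectPlus.{u, max u w} K where
  carrier := TensorAlgebra K M.carrier
  deg := tensorGrading M.toGrSpace
  internal := tensorGrading_internal M.toGrSpace
  one := 1
  one_ne_zero := one_ne_zero
  deg_zero := tensorGrading_zero M

variable (M : GrVect.{u, w} K)

theorem aug_tensorPlus : (tensorPlus M).aug = TensorAlgebra.algebraMapInv.toLinearMap := by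
  refine GrVectPlus.hom_ext_deg (tensorPlus M).toGrSpace _ _ fun n x hx => ?_
  by_cases hn : n = 0
  · subst hn
    rw [(tensorPlus M).eq_smul_one hx, map_smul, map_smul]
    congr 1
    exact (tensorPlus M).aug_one.trans
      (map_one (TensorAlgebra.algebraMapInv (R := K) (M := M.carrier))).symm
  · rw [(tensorPlus M).aug_of_deg_pos n hn x hx]
    -- The target is graded by `⊤` in degree `0` and `⊥` in all others, so homogeneity means
    -- vanishing in positive degrees.
    have := tensorGrading_induction (W := M.toGrSpace) (D := fun n => if n = 0 then ⊤ else ⊥)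
      (F := (TensorAlgebra.algebraMapInv (R := K) (M := M.carrier)).toLinearMap) (by simp)
      (fun i j x _ t _ _ => by simp [TensorAlgebra.algebraMapInv]) n x hx
    simp only [if_neg hn, Submodule.mem_bot] at this
    exact this.symm

theorem mem_ker_aug_tensorPlus {t : TensorAlgebra K M.carrier} :
    t ∈ LinearMap.ker (tensorPlus M).aug ↔ TensorAlgebra.algebraMapInv t = 0 := by
  rw [aug_tensorPlus]
  exact Iff.rfl

-- Homogeneity of the operations on tensor spaces

theorem letterMul_mem_tensorDeg {i j : ℕ} {x : M.carrier} (hx : x ∈ M.deg i)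
    {s : TensorAlgebra K M.carrier ⊗[K] TensorAlgebra K M.carrier}
    (hs : s ∈ (tensorPlus M).toGrSpace.tensorDeg j) :
    letterMul x s ∈ (tensorPlus M).toGrSpace.tensorDeg (i + j) := by
  refine (tensorPlus M).toGrSpace.tensorDeg_le
    (S := ((tensorPlus M).toGrSpace.tensorDeg (i + j)).comap (letterMul x))
    (fun k l hkl a ha b hb => ?_) hs
  rw [Submodule.mem_comap, letterMul_tmul]
  exact (tensorPlus M).toGrSpace.tmul_mem_tensorDeg (i := i + k) (j := l) (by omega)
    (SetLike.GradedMul.mul_mem (ι_mem_tensorGrading M.toGrSpace i x hx) ha) hb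

theorem deconc_deg (n : ℕ) : ∀ t ∈ tensorGrading M.toGrSpace n,
    deconc t ∈ (tensorPlus M).toGrSpace.tensorDeg n := by
  refine tensorGrading_induction ?_ (fun i j x hx t ht h => ?_) n
  · rw [deconc_one]
    exact (tensorPlus M).toGrSpace.tmul_mem_tensorDeg (zero_add 0)
      (tensorPlus M).one_mem (tensorPlus M).one_mem
  · rw [deconc_cons]
    exact Submodule.add_mem _ ((tensorPlus M).toGrSpace.tmul_mem_tensorDeg (zero_add _)
      (tensorPlus M).one_mem
      (SetLike.GradedMul.mul_mem (ι_mem_tensorGrading M.toGrSpace i x hx) ht))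
      (letterMul_mem_tensorDeg M hx h)

theorem unshuf_deg (n : ℕ) : ∀ t ∈ tensorGrading M.toGrSpace n,
    unshuf t ∈ (tensorPlus M).toGrSpace.tensorDeg n := by
  refine tensorGrading_induction (F := unshuf.toLinearMap) ?_ (fun i j x hx t ht h => ?_) n
  · rw [AlgHom.toLinearMap_apply, map_one]
    exact (tensorPlus M).toGrSpace.tmul_mem_tensorDeg (zero_add 0)
      (tensorPlus M).one_mem (tensorPlus M).one_mem
  · rw [AlgHom.toLinearMap_apply] at h ⊢
    rw [map_mul, unshuf_ι, add_mul]
    refine Submodule.add_mem _ (letterMul_mem_tensorDeg M hx h) ?_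
    refine (tensorPlus M).toGrSpace.tensorDeg_le
      (S := ((tensorPlus M).toGrSpace.tensorDeg (i + j)).comap
        (LinearMap.mulLeft K (1 ⊗ₜ[K] TensorAlgebra.ι K x)))
      (fun k l hkl a ha b hb => ?_) h
    rw [Submodule.mem_comap, LinearMap.mulLeft_apply, Algebra.TensorProduct.tmul_mul_tmul, one_mul]
    exact (tensorPlus M).toGrSpace.tmul_mem_tensorDeg (i := k) (j := i + l) (by omega) ha
      (SetLike.GradedMul.mul_mem (ι_mem_tensorGrading M.toGrSpace i x hx) hb)

theorem halfUnshuf_deg (n : ℕ) : ∀ t ∈ tensorGrading M.toGrSpace n,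
    halfUnshuf t ∈ (tensorPlus M).toGrSpace.tensorDeg n := by
  refine tensorGrading_induction ?_ (fun i j x hx t ht _ => ?_) n
  · rw [halfUnshuf_one]
    exact Submodule.zero_mem _
  · rw [halfUnshuf_cons]
    exact letterMul_mem_tensorDeg M hx (unshuf_deg M j t ht)

/-- The linear endomorphisms of degree `n`. -/
def GrSpace.endDeg (V : GrSpace.{u, w} K) (n : ℕ) : Submodule K (V.carrier →ₗ[K] V.carrier) where
  carrier := {f | ∀ m, ∀ x ∈ V.deg m, f x ∈ V.deg (n + m)}
  add_mem' hf hg m x hx := Submodule.add_mem _ (hf m x hx) (hg m x hx)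
  zero_mem' _ _ _ := Submodule.zero_mem _
  smul_mem' c _ hf m x hx := Submodule.smul_mem _ c (hf m x hx)

/-- The induction on words is applied to `shuf` as a map with values in endomorphisms, graded by
`GrSpace.endDeg`; this keeps the right argument arbitrary. -/
theorem shuf_deg (m n : ℕ) (s : TensorAlgebra K M.carrier) (hs : s ∈ tensorGrading M.toGrSpace m)
    (t : TensorAlgebra K M.carrier) (ht : t ∈ tensorGrading M.toGrSpace n) :
    shuf s t ∈ tensorGrading M.toGrSpace (m + n) := by
  refine tensorGrading_induction (D := (tensorPlus M).toGrSpace.endDeg) (F := shuf) ?_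
    (fun i j x hx t ht h => ?_) m s hs n t ht
  · intro m x hx
    rwa [one_shuf, zero_add]
  · intro n y hy
    rw [cons_shuf]
    refine (tensorPlus M).toGrSpace.tensorDeg_le
      (S := (tensorGrading M.toGrSpace (i + j + n)).comap (LinearMap.mul' K _ ∘ₗ
        (LinearMap.mulLeft K (TensorAlgebra.ι K x) ∘ₗ shuf t).lTensor _))
      (fun k l hkl a ha b hb => ?_) (deconc_deg M n y hy)
    have := SetLike.GradedMul.mul_mem ha (SetLike.GradedMul.mul_mem
      (ι_mem_tensorGrading M.toGrSpace i x hx) (h l b hb))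
    rw [Submodule.mem_comap, LinearMap.comp_apply, LinearMap.lTensor_tmul, LinearMap.mul'_apply]
    rwa [show i + j + n = k + (i + (j + l)) by omega]

theorem halfShuf_deg (m n : ℕ) (s : TensorAlgebra K M.carrier)
    (hs : s ∈ tensorGrading M.toGrSpace m) (t : TensorAlgebra K M.carrier)
    (ht : t ∈ tensorGrading M.toGrSpace n) :
    halfShuf s t ∈ tensorGrading M.toGrSpace (m + n) := by
  refine tensorGrading_induction (D := (tensorPlus M).toGrSpace.endDeg) (F := halfShuf) ?_
    (fun i j x hx t ht _ => ?_) m s hs n t ht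
  · intro m x hx
    rw [one_halfShuf]
    exact Submodule.zero_mem _
  · intro n y hy
    rw [cons_halfShuf, add_assoc]
    exact SetLike.GradedMul.mul_mem (ι_mem_tensorGrading M.toGrSpace i x hx)
      (shuf_deg M j n t ht y hy)

-- The three bialgebra structures on a tensor space

/-- The concatenation product. -/
noncomputable def concatAlg : AlgStr (tensorPlus M) where
  mul := LinearMap.mul K _
  one_mul := one_mul
  mul_one := mul_one
  mul_assoc := mul_assoc
  mul_deg _ _ _ hx _ hy := SetLike.GradedMul.mul_mem hx hy

/-- The shuffle product. -/
noncomputable def shufAlg : AlgStr (tensorPlus M) where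
  mul := shuf
  one_mul := one_shuf
  mul_one := shuf_one
  mul_assoc := shuf_assoc
  mul_deg := shuf_deg M

/-- The deconcatenation coproduct. -/
noncomputable def deconcCoalg : CoalgStr (tensorPlus M) where
  comul := deconc
  coassoc := LinearMap.ext deconc_coassoc
  rTensor_counit t := by rw [aug_tensorPlus]; exact rTensor_deconc t
  lTensor_counit t := by rw [aug_tensorPlus]; exact lTensor_deconc t
  comul_deg := deconc_deg M

/-- The unshuffle coproduct. -/
noncomputable def unshufCoalg : CoalgStr (tensorPlus M) where
  comul := unshuf.toLinearMap
  coassoc := LinearMap.ext unshuf_coassoc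
  rTensor_counit t := by rw [aug_tensorPlus]; exact rTensor_unshuf t
  lTensor_counit t := by rw [aug_tensorPlus]; exact lTensor_unshuf t
  comul_deg := unshuf_deg M

/-- Concatenation and deconcatenation. -/
noncomputable def tensorInfinitesimal : InfinitesimalStr (tensorPlus M) where
  toAlgStr := concatAlg M
  toCoalgStr := deconcCoalg M
  comul_mul := deconc_mul

theorem halfShuf_one {t : TensorAlgebra K M.carrier} (ht : TensorAlgebra.algebraMapInv t = 0) :
    halfShuf t 1 = t := by
  refine ker_algebraMapInv_induction (S := LinearMap.eqLocus (halfShuf.flip 1) LinearMap.id)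
    (fun x a => ?_) ht
  simp

/-- The half-shuffle and deconcatenation. -/
noncomputable def tensorShuffle : ShuffleStr (tensorPlus M) where
  toAlgStr := shufAlg M
  toCoalgStr := deconcCoalg M
  mul_comm := shuf_comm
  bialg := ⟨deconc_one, deconc_shuf⟩
  prec := halfShuf
  prec_deg := halfShuf_deg M
  prec_one x hx := halfShuf_one M ((mem_ker_aug_tensorPlus M).1 hx)
  one_prec := one_halfShuf
  mul_eq x hx y hy := halfShuf_add ((mem_ker_aug_tensorPlus M).1 hx)
    ((mem_ker_aug_tensorPlus M).1 hy)
  prec_prec x hx y hy z hz := by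
    rw [← halfShuf_add ((mem_ker_aug_tensorPlus M).1 hy) ((mem_ker_aug_tensorPlus M).1 hz)]
    exact halfShuf_halfShuf ((mem_ker_aug_tensorPlus M).1 hx)
  comul_prec x hx y hy := by
    refine (deconc_halfShuf ((mem_ker_aug_tensorPlus M).1 hx)).trans ?_
    exact (deconcCoalg M).map₂_prec_mul one_shuf shuf_one
      (fun x hx => halfShuf_one M ((mem_ker_aug_tensorPlus M).1 hx)) one_halfShuf hx

/-- Concatenation and the half-unshuffle. -/
noncomputable def tensorUnshuffle : UnshuffleStr (tensorPlus M) where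
  toAlgStr := concatAlg M
  toCoalgStr := unshufCoalg M
  cocomm := unshuf_comm
  bialg := ⟨map_one unshuf, fun x y => (map_mul unshuf x y).trans (map₂_mul_mul _ _).symm⟩
  halfComul := halfUnshuf
  halfComul_deg := halfUnshuf_deg M
  halfComul_one := halfUnshuf_one
  comul_eq x hx := unshuf_eq_halfUnshuf_add ((mem_ker_aug_tensorPlus M).1 hx)
  halfComul_assoc x hx := halfUnshuf_assoc ((mem_ker_aug_tensorPlus M).1 hx)
  rTensor_halfComul x hx := by rw [aug_tensorPlus]; exact rTensor_halfUnshuf x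
  lTensor_halfComul x hx := by
    rw [aug_tensorPlus]; exact lTensor_halfUnshuf ((mem_ker_aug_tensorPlus M).1 hx)
  halfComul_mul x hx y hy :=
    (halfUnshuf_mul ((mem_ker_aug_tensorPlus M).1 hx) y).trans (map₂_mul_mul _ _).symm

end

/-! ### Transport of structures -/

section

variable {K : Type u} [Field K]

section

variable {A A' B B' C C' D D' : Type*} [AddCommGroup A] [Module K A] [AddCommGroup A'] [Module K A']
  [AddCommGroup B] [Module K B] [AddCommGroup B'] [Module K B'] [AddCommGroup C] [Module K C]
  [AddCommGroup C'] [Module K C'] [AddCommGroup D] [Module K D] [AddCommGroup D'] [Module K D']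

theorem rTensor_map_of_comm {e : A →ₗ[K] A'} {f : A →ₗ[K] B} {f' : A' →ₗ[K] B'} {e' : B →ₗ[K] B'}
    (h : ∀ x, f' (e x) = e' (f x)) (k : C →ₗ[K] C') (s : A ⊗[K] C) :
    f'.rTensor C' (TensorProduct.map e k s) = TensorProduct.map e' k (f.rTensor C s) := by
  induction s using TensorProduct.induction_on with
  | zero => simp
  | add a b ha hb => simp only [map_add, ha, hb]
  | tmul a b => simp [h]

theorem lTensor_map_of_comm {e : A →ₗ[K] A'} {f : A →ₗ[K] B} {f' : A' →ₗ[K] B'} {e' : B →ₗ[K] B'}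
    (h : ∀ x, f' (e x) = e' (f x)) (k : C →ₗ[K] C') (s : C ⊗[K] A) :
    f'.lTensor C' (TensorProduct.map k e s) = TensorProduct.map k e' (f.lTensor C s) := by
  induction s using TensorProduct.induction_on with
  | zero => simp
  | add a b ha hb => simp only [map_add, ha, hb]
  | tmul a b => simp [h]

theorem assoc_map (e : A →ₗ[K] A') (f : B →ₗ[K] B') (g : C →ₗ[K] C') (s : (A ⊗[K] B) ⊗[K] C) :
    TensorProduct.assoc K A' B' C' (TensorProduct.map (TensorProduct.map e f) g s)
      = TensorProduct.map e (TensorProduct.map f g) (TensorProduct.assoc K A B C s) := by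
  have h : (TensorProduct.assoc K A' B' C').toLinearMap ∘ₗ
        TensorProduct.map (TensorProduct.map e f) g
      = TensorProduct.map e (TensorProduct.map f g) ∘ₗ
        (TensorProduct.assoc K A B C).toLinearMap := by
    ext; simp
  exact LinearMap.congr_fun h s

theorem comm_map (e : A →ₗ[K] A') (f : B →ₗ[K] B') (s : A ⊗[K] B) :
    TensorProduct.comm K A' B' (TensorProduct.map e f s)
      = TensorProduct.map f e (TensorProduct.comm K A B s) := by
  induction s using TensorProduct.induction_on with
  | zero => simp
  | add a b ha hb => simp only [map_add, ha, hb]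
  | tmul a b => simp

end

theorem map₂_map_of_comm {A A' : Type*} [AddCommGroup A] [Module K A] [AddCommGroup A']
    [Module K A'] {e : A →ₗ[K] A'} {f g : A →ₗ[K] A →ₗ[K] A} {f' g' : A' →ₗ[K] A' →ₗ[K] A'}
    (hf : ∀ x y, f' (e x) (e y) = e (f x y)) (hg : ∀ x y, g' (e x) (e y) = e (g x y))
    (s t : A ⊗[K] A) :
    TensorProduct.map₂ f' g' (TensorProduct.map e e s) (TensorProduct.map e e t)
      = TensorProduct.map e e (TensorProduct.map₂ f g s t) := by
  induction s using TensorProduct.induction_on with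
  | zero => simp
  | add a b ha hb => simp only [map_add, LinearMap.add_apply, ha, hb]
  | tmul a b =>
    induction t using TensorProduct.induction_on with
    | zero => simp
    | add a b ha hb => simp only [map_add, ha, hb]
    | tmul a b => simp [hf, hg]

section

variable {A B : Type*} [AddCommGroup A] [Module K A] [AddCommGroup B] [Module K B] (e : A ≃ₗ[K] B)

/-- Transport of a binary operation along a linear isomorphism. -/
def conjOp₂ (f : A →ₗ[K] A →ₗ[K] A) : B →ₗ[K] B →ₗ[K] B :=
  (f.compl₁₂ e.symm.toLinearMap e.symm.toLinearMap).compr₂ e.toLinearMap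

theorem conjOp₂_apply (f : A →ₗ[K] A →ₗ[K] A) (x y : A) : conjOp₂ e f (e x) (e y) = e (f x y) := by
  simp [conjOp₂]

/-- Transport of a cooperation along a linear isomorphism. -/
def conjCoop (f : A →ₗ[K] A ⊗[K] A) : B →ₗ[K] B ⊗[K] B :=
  TensorProduct.map e.toLinearMap e.toLinearMap ∘ₗ f ∘ₗ e.symm.toLinearMap

theorem conjCoop_apply (f : A →ₗ[K] A ⊗[K] A) (x : A) :
    conjCoop e f (e x) = TensorProduct.map e.toLinearMap e.toLinearMap (f x) := by
  simp [conjCoop]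

end

/-- An isomorphism of `Vect⁺`, given by a bijective linear map. -/
structure PlusEquiv (V : GrVectPlus.{u, v} K) (W : GrVectPlus.{u, w} K) where
  equiv : V.carrier ≃ₗ[K] W.carrier
  map_one : equiv V.one = W.one
  map_deg : ∀ n, ∀ x ∈ V.deg n, equiv x ∈ W.deg n

variable {V : GrVectPlus.{u, v} K} {W : GrVectPlus.{u, w} K} (e : PlusEquiv V W)

namespace PlusEquiv

/-- The underlying linear map. -/
def lin : V.carrier →ₗ[K] W.carrier := e.equiv.toLinearMap

theorem symm_deg (n : ℕ) (x : W.carrier) (hx : x ∈ W.deg n) : e.equiv.symm x ∈ V.deg n :=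
  GrSpace.mem_deg_of_bijective (f := e.lin) e.equiv.injective e.map_deg
    (show e.equiv (e.equiv.symm x) ∈ W.deg n by rwa [e.equiv.apply_symm_apply])

theorem aug_lin (x : V.carrier) : W.aug (e.lin x) = V.aug x := by
  suffices h : W.aug ∘ₗ e.lin = V.aug from LinearMap.congr_fun h x
  refine GrVectPlus.hom_ext_deg V.toGrSpace _ _ fun n x hx => ?_
  have hx' : e.lin x ∈ W.deg n := e.map_deg n x hx
  by_cases hn : n = 0
  · subst hn
    rw [V.deg_zero] at hx
    obtain ⟨c, rfl⟩ := Submodule.mem_span_singleton.1 hx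
    have h1 : e.lin V.one = W.one := e.map_one
    rw [LinearMap.comp_apply, map_smul, h1, W.aug_of_deg_zero, V.aug_of_deg_zero]
  · rw [LinearMap.comp_apply, W.aug_of_deg_pos n hn _ hx', V.aug_of_deg_pos n hn x hx]

theorem surj (x : W.carrier) : ∃ y, e.lin y = x := e.equiv.surjective x

theorem lin_one : e.lin V.one = W.one := e.map_one

theorem lin_mem_ker {x : V.carrier} : e.lin x ∈ LinearMap.ker W.aug ↔ x ∈ LinearMap.ker V.aug := by
  rw [LinearMap.mem_ker, LinearMap.mem_ker, e.aug_lin]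

theorem exists_mem_ker {x : W.carrier} (hx : x ∈ LinearMap.ker W.aug) :
    ∃ y ∈ LinearMap.ker V.aug, e.lin y = x := by
  obtain ⟨y, rfl⟩ := e.surj x
  exact ⟨y, e.lin_mem_ker.1 hx, rfl⟩

theorem exists_mem_deg {n : ℕ} {x : W.carrier} (hx : x ∈ W.deg n) :
    ∃ y ∈ V.deg n, e.lin y = x :=
  ⟨e.equiv.symm x, e.symm_deg n x hx, e.equiv.apply_symm_apply x⟩

/-- Transport of a binary operation. -/
def op₂ (f : V.carrier →ₗ[K] V.carrier →ₗ[K] V.carrier) :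
    W.carrier →ₗ[K] W.carrier →ₗ[K] W.carrier :=
  conjOp₂ e.equiv f

@[simp] theorem op₂_lin (f : V.carrier →ₗ[K] V.carrier →ₗ[K] V.carrier) (x y : V.carrier) :
    e.op₂ f (e.lin x) (e.lin y) = e.lin (f x y) := by
  exact conjOp₂_apply e.equiv f x y

/-- Transport of a cooperation. -/
def coop (f : V.carrier →ₗ[K] V.carrier ⊗[K] V.carrier) :
    W.carrier →ₗ[K] W.carrier ⊗[K] W.carrier :=
  conjCoop e.equiv f

@[simp] theorem coop_lin (f : V.carrier →ₗ[K] V.carrier ⊗[K] V.carrier) (x : V.carrier) :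
    e.coop f (e.lin x) = TensorProduct.map e.lin e.lin (f x) := by
  exact conjCoop_apply e.equiv f x

theorem op₂_deg {f : V.carrier →ₗ[K] V.carrier →ₗ[K] V.carrier}
    (hf : ∀ m n, ∀ x ∈ V.deg m, ∀ y ∈ V.deg n, f x y ∈ V.deg (m + n)) (m n : ℕ) :
    ∀ x ∈ W.deg m, ∀ y ∈ W.deg n, e.op₂ f x y ∈ W.deg (m + n) := by
  intro x hx₀ y hy₀
  obtain ⟨x, hx, rfl⟩ := e.exists_mem_deg hx₀
  obtain ⟨y, hy, rfl⟩ := e.exists_mem_deg hy₀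
  rw [op₂_lin]
  exact e.map_deg _ _ (hf m n x hx y hy)

theorem coop_deg {f : V.carrier →ₗ[K] V.carrier ⊗[K] V.carrier}
    (hf : ∀ n, ∀ x ∈ V.deg n, f x ∈ V.toGrSpace.tensorDeg n) (n : ℕ) :
    ∀ x ∈ W.deg n, e.coop f x ∈ W.toGrSpace.tensorDeg n := by
  intro x hx₀
  obtain ⟨x, hx, rfl⟩ := e.exists_mem_deg hx₀
  rw [coop_lin]
  exact GrSpace.map_mem_tensorDeg e.map_deg e.map_deg (hf n x hx)

theorem rTensor_aug (s : V.carrier ⊗[K] V.carrier) :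
    W.aug.rTensor W.carrier (TensorProduct.map e.lin e.lin s)
      = TensorProduct.map LinearMap.id e.lin (V.aug.rTensor V.carrier s) :=
  rTensor_map_of_comm e.aug_lin _ s

theorem lTensor_aug (s : V.carrier ⊗[K] V.carrier) :
    W.aug.lTensor W.carrier (TensorProduct.map e.lin e.lin s)
      = TensorProduct.map e.lin LinearMap.id (V.aug.lTensor V.carrier s) :=
  lTensor_map_of_comm e.aug_lin _ s

theorem assoc_coop (f g : V.carrier →ₗ[K] V.carrier ⊗[K] V.carrier) (x : V.carrier) :
    TensorProduct.assoc K W.carrier W.carrier W.carrier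
      ((e.coop f).rTensor W.carrier (e.coop g (e.lin x)))
    = TensorProduct.map e.lin (TensorProduct.map e.lin e.lin)
      (TensorProduct.assoc K V.carrier V.carrier V.carrier (f.rTensor V.carrier (g x))) := by
  rw [coop_lin, rTensor_map_of_comm (e.coop_lin f), assoc_map]

theorem lTensor_coop (f g : V.carrier →ₗ[K] V.carrier ⊗[K] V.carrier) (x : V.carrier) :
    (e.coop f).lTensor W.carrier (e.coop g (e.lin x))
    = TensorProduct.map e.lin (TensorProduct.map e.lin e.lin) (f.lTensor V.carrier (g x)) := by
  rw [coop_lin, lTensor_map_of_comm (e.coop_lin f)]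

end PlusEquiv

/-- Transport of an algebra structure. -/
def AlgStr.transport (A : AlgStr V) : AlgStr W where
  mul := e.op₂ A.mul
  one_mul x := by
    obtain ⟨x, rfl⟩ := e.surj x
    rw [← e.lin_one, e.op₂_lin, A.one_mul]
  mul_one x := by
    obtain ⟨x, rfl⟩ := e.surj x
    rw [← e.lin_one, e.op₂_lin, A.mul_one]
  mul_assoc x y z := by
    obtain ⟨x, rfl⟩ := e.surj x
    obtain ⟨y, rfl⟩ := e.surj y
    obtain ⟨z, rfl⟩ := e.surj z
    simp only [e.op₂_lin, A.mul_assoc]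
  mul_deg := e.op₂_deg A.mul_deg

/-- Transport of a coalgebra structure. -/
def CoalgStr.transport (C : CoalgStr V) : CoalgStr W where
  comul := e.coop C.comul
  coassoc := by
    refine LinearMap.ext fun x => ?_
    obtain ⟨x, rfl⟩ := e.surj x
    have h := LinearMap.congr_fun C.coassoc x
    simp only [LinearMap.comp_apply, LinearEquiv.coe_coe] at h ⊢
    rw [e.assoc_coop, e.lTensor_coop, h]
  rTensor_counit x := by
    obtain ⟨x, rfl⟩ := e.surj x
    rw [e.coop_lin, e.rTensor_aug, C.rTensor_counit, TensorProduct.map_tmul, LinearMap.id_apply]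
  lTensor_counit x := by
    obtain ⟨x, rfl⟩ := e.surj x
    rw [e.coop_lin, e.lTensor_aug, C.lTensor_counit, TensorProduct.map_tmul, LinearMap.id_apply]
  comul_deg := e.coop_deg C.comul_deg

theorem CoalgStr.transport_reduced (C : CoalgStr V) (x : V.carrier) :
    (C.transport e).reduced (e.lin x) = TensorProduct.map e.lin e.lin (C.reduced x) := by
  have h : (C.transport e).comul (e.lin x) = TensorProduct.map e.lin e.lin (C.comul x) :=
    e.coop_lin _ x
  simp [CoalgStr.reduced, h, e.lin_one]

theorem IsBialg.transport {A : AlgStr V} {C : CoalgStr V} (h : IsBialg A C) :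
    IsBialg (A.transport e) (C.transport e) where
  comul_one := by
    change e.coop C.comul W.one = _
    rw [← e.lin_one, e.coop_lin, h.comul_one, TensorProduct.map_tmul]
  comul_mul x y := by
    change e.coop C.comul (e.op₂ A.mul x y)
      = TensorProduct.map₂ (e.op₂ A.mul) (e.op₂ A.mul) (e.coop C.comul x) (e.coop C.comul y)
    obtain ⟨x, rfl⟩ := e.surj x
    obtain ⟨y, rfl⟩ := e.surj y
    rw [e.op₂_lin, e.coop_lin, e.coop_lin, e.coop_lin, h.comul_mul,
      map₂_map_of_comm (e.op₂_lin _) (e.op₂_lin _)]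

/-- Transport of an infinitesimal bialgebra structure. -/
def InfinitesimalStr.transport (S : InfinitesimalStr V) : InfinitesimalStr W where
  toAlgStr := S.toAlgStr.transport e
  toCoalgStr := S.toCoalgStr.transport e
  comul_mul x y := by
    change e.coop S.comul (e.op₂ S.mul x y)
      = (e.op₂ S.mul x).rTensor W.carrier (e.coop S.comul y)
        + ((e.op₂ S.mul).flip y).lTensor W.carrier (e.coop S.comul x) - x ⊗ₜ[K] y
    obtain ⟨x, rfl⟩ := e.surj x
    obtain ⟨y, rfl⟩ := e.surj y
    rw [e.op₂_lin, e.coop_lin, e.coop_lin, e.coop_lin, S.comul_mul, map_sub, map_add,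
      rTensor_map_of_comm (f := S.mul x) (e' := e.lin) (fun z => e.op₂_lin _ x z),
      lTensor_map_of_comm (f := S.mul.flip y) (e' := e.lin) (fun z => e.op₂_lin _ z y),
      TensorProduct.map_tmul]

/-- Transport of a shuffle bialgebra structure. -/
def ShuffleStr.transport (S : ShuffleStr V) : ShuffleStr W where
  toAlgStr := S.toAlgStr.transport e
  toCoalgStr := S.toCoalgStr.transport e
  mul_comm x y := by
    change e.op₂ S.mul x y = e.op₂ S.mul y x
    obtain ⟨x, rfl⟩ := e.surj x
    obtain ⟨y, rfl⟩ := e.surj y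
    rw [e.op₂_lin, e.op₂_lin, S.mul_comm]
  bialg := S.bialg.transport e
  prec := e.op₂ S.prec
  prec_deg := e.op₂_deg S.prec_deg
  prec_one x hx₀ := by
    obtain ⟨x, hx, rfl⟩ := e.exists_mem_ker hx₀
    rw [← e.lin_one, e.op₂_lin, S.prec_one x hx]
  one_prec x := by
    obtain ⟨x, rfl⟩ := e.surj x
    rw [← e.lin_one, e.op₂_lin, S.one_prec, map_zero]
  mul_eq x hx₀ y hy₀ := by
    change e.op₂ S.mul x y = _
    obtain ⟨x, hx, rfl⟩ := e.exists_mem_ker hx₀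
    obtain ⟨y, hy, rfl⟩ := e.exists_mem_ker hy₀
    rw [e.op₂_lin, e.op₂_lin, e.op₂_lin, S.mul_eq x hx y hy, map_add]
  prec_prec x hx₀ y hy₀ z hz₀ := by
    obtain ⟨x, hx, rfl⟩ := e.exists_mem_ker hx₀
    obtain ⟨y, hy, rfl⟩ := e.exists_mem_ker hy₀
    obtain ⟨z, hz, rfl⟩ := e.exists_mem_ker hz₀
    simp only [e.op₂_lin, ← map_add, S.prec_prec x hx y hy z hz]
  comul_prec x hx₀ y hy₀ := by
    change e.coop S.comul (e.op₂ S.prec x y) = _ + ((e.op₂ S.mul).flip y).lTensor W.carrier _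
      + TensorProduct.map₂ (e.op₂ S.prec) (e.op₂ S.mul) _ _
    obtain ⟨x, hx, rfl⟩ := e.exists_mem_ker hx₀
    obtain ⟨y, hy, rfl⟩ := e.exists_mem_ker hy₀
    rw [e.op₂_lin, e.coop_lin, S.comul_prec x hx y hy, CoalgStr.transport_reduced,
      CoalgStr.transport_reduced, map₂_map_of_comm (e.op₂_lin _) (e.op₂_lin _),
      rTensor_map_of_comm (f := S.prec x) (e' := e.lin) (fun z => e.op₂_lin _ x z),
      rTensor_map_of_comm (f := S.prec.flip y) (e' := e.lin) (fun z => e.op₂_lin _ z y),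
      lTensor_map_of_comm (f := S.mul.flip y) (e' := e.lin) (fun z => e.op₂_lin _ z y)]
    simp only [map_add, TensorProduct.map_tmul, e.lin_one]

/-- Transport of an unshuffle bialgebra structure. -/
def UnshuffleStr.transport (S : UnshuffleStr V) : UnshuffleStr W where
  toAlgStr := S.toAlgStr.transport e
  toCoalgStr := S.toCoalgStr.transport e
  cocomm x := by
    change TensorProduct.comm K _ _ (e.coop S.comul x) = e.coop S.comul x
    obtain ⟨x, rfl⟩ := e.surj x
    rw [e.coop_lin, comm_map, S.cocomm]
  bialg := S.bialg.transport e
  halfComul := e.coop S.halfComul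
  halfComul_deg := e.coop_deg S.halfComul_deg
  halfComul_one := by rw [← e.lin_one, e.coop_lin, S.halfComul_one, map_zero]
  comul_eq x hx₀ := by
    change e.coop S.comul x = _
    obtain ⟨x, hx, rfl⟩ := e.exists_mem_ker hx₀
    rw [e.coop_lin, e.coop_lin, comm_map, S.comul_eq x hx, map_add]
  halfComul_assoc x hx₀ := by
    change _ = (e.coop S.comul).lTensor W.carrier _
    obtain ⟨x, hx, rfl⟩ := e.exists_mem_ker hx₀
    rw [e.assoc_coop, e.lTensor_coop, S.halfComul_assoc x hx]
  rTensor_halfComul x hx₀ := by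
    obtain ⟨x, hx, rfl⟩ := e.exists_mem_ker hx₀
    rw [e.coop_lin, e.rTensor_aug, S.rTensor_halfComul x hx, map_zero]
  lTensor_halfComul x hx₀ := by
    obtain ⟨x, hx, rfl⟩ := e.exists_mem_ker hx₀
    rw [e.coop_lin, e.lTensor_aug, S.lTensor_halfComul x hx, TensorProduct.map_tmul,
      LinearMap.id_apply]
  halfComul_mul x hx₀ y hy₀ := by
    change e.coop S.halfComul (e.op₂ S.mul x y) = TensorProduct.map₂ (e.op₂ S.mul) (e.op₂ S.mul)
      (e.coop S.halfComul x) (e.coop S.comul y)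
    obtain ⟨x, hx, rfl⟩ := e.exists_mem_ker hx₀
    obtain ⟨y, hy, rfl⟩ := e.exists_mem_ker hy₀
    rw [e.op₂_lin, e.coop_lin, e.coop_lin, e.coop_lin, S.halfComul_mul x hx y hy,
      map₂_map_of_comm (e.op₂_lin _) (e.op₂_lin _)]

end

/-! ### Rigidity of the three types of bialgebras -/

section

variable {K : Type u} [Field K]

theorem GrVectPlus.mem_ker_of_tmul_one (V : GrVectPlus.{u, w} K) {x : V.carrier}
    (h : V.aug.lTensor V.carrier (x ⊗ₜ[K] V.one) = V.red x ⊗ₜ[K] 1) :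
    x ∈ LinearMap.ker V.aug := by
  rw [LinearMap.lTensor_tmul, V.aug_one] at h
  have h2 : x = V.red x := by
    simpa using congrArg (TensorProduct.rid K V.carrier) h
  rw [h2]
  exact V.red_mem x

/-- The linear extension of a statement from `Ker ε` and `1` to the whole space. -/
theorem GrVectPlus.linearMap_ext (V : GrVectPlus.{u, w} K) {M : Type*} [AddCommGroup M]
    [Module K M] {f g : V.carrier →ₗ[K] M} (one : f V.one = g V.one)
    (ker : ∀ x ∈ LinearMap.ker V.aug, f x = g x) : f = g := by
  refine LinearMap.ext fun x => ?_
  rw [← V.red_add_aug x, map_add, map_add, map_smul, map_smul, one, ker _ (V.red_mem x)]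

variable {V : GrVectPlus.{u, w} K}

/-- The half-coproduct `Δ - 1 ⊗ Id`. -/
noncomputable def CoalgStr.half (C : CoalgStr V) : V.carrier →ₗ[K] V.carrier ⊗[K] V.carrier :=
  C.comul - TensorProduct.mk K V.carrier V.carrier V.one

theorem CoalgStr.half_apply (C : CoalgStr V) (x : V.carrier) :
    C.half x = C.comul x - V.one ⊗ₜ[K] x := rfl

theorem CoalgStr.half_eq_iff (C : CoalgStr V) (x : V.carrier) :
    C.half x = x ⊗ₜ[K] V.one ↔ C.comul x = x ⊗ₜ[K] V.one + V.one ⊗ₜ[K] x := by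
  rw [C.half_apply, sub_eq_iff_eq_add]

theorem CoalgStr.lTensor_half (C : CoalgStr V) (x : V.carrier) :
    V.aug.lTensor V.carrier (C.half x) = V.red x ⊗ₜ[K] 1 := by
  rw [C.half_apply, map_sub, C.lTensor_counit, LinearMap.lTensor_tmul, V.red_apply, sub_tmul,
    smul_tmul, smul_eq_mul, mul_one]

theorem CoalgStr.mem_ker_of_half (C : CoalgStr V) {x : V.carrier}
    (hx : C.half x = x ⊗ₜ[K] V.one) : x ∈ LinearMap.ker V.aug :=
  V.mem_ker_of_tmul_one (hx ▸ C.lTensor_half x)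

/-- The half-bialgebra given by the half-coproduct `Δ - 1 ⊗ Id`. -/
noncomputable def CoalgStr.toHalf (C : CoalgStr V) (comul_one : C.comul V.one = V.one ⊗ₜ[K] V.one)
    (op : V.carrier →ₗ[K] V.carrier →ₗ[K] V.carrier)
    (op_deg : ∀ m n, ∀ x ∈ V.deg m, ∀ y ∈ V.deg n, C.half x = x ⊗ₜ[K] V.one →
      op x y ∈ V.deg (m + n))
    (op_one : ∀ x, op x V.one = x)
    (half_op : ∀ x y, C.half x = x ⊗ₜ[K] V.one →
      C.half (op x y) = (op x).rTensor V.carrier (C.comul y)) : HalfBialg V where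
  comul := C.comul
  half := C.half
  op := op
  rTensor_counit := C.rTensor_counit
  lTensor_counit := C.lTensor_counit
  comul_deg := C.comul_deg
  comul_one := comul_one
  half_deg n x hx := Submodule.sub_mem _ (C.comul_deg n x hx)
    (V.toGrSpace.tmul_mem_tensorDeg (zero_add n) V.one_mem hx)
  half_one := by rw [C.half_apply, comul_one, sub_self]
  rTensor_half x := by
    rw [C.half_apply, map_sub, C.rTensor_counit, LinearMap.rTensor_tmul, V.aug_one, sub_self]
  lTensor_half := C.lTensor_half
  half_assoc x := by
    -- As `D(1) = 0`, the term `1 ⊗ x` of `D(x)` disappears under `D ⊗ Id`. What remains is `(Δ ⊗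
    -- Id) Δ(x) - 1 ⊗ Δ(x)`, which coassociativity turns into `(Id ⊗ Δ)(Δ(x) - 1 ⊗ x)`.
    have h1 : C.half V.one = 0 := by rw [C.half_apply, comul_one, sub_self]
    have h2 : ∀ s : V.carrier ⊗[K] V.carrier,
        TensorProduct.assoc K V.carrier V.carrier V.carrier (C.half.rTensor V.carrier s)
        = TensorProduct.assoc K V.carrier V.carrier V.carrier (C.comul.rTensor V.carrier s)
          - V.one ⊗ₜ[K] s := by
      intro s
      induction s using TensorProduct.induction_on with
      | zero => simp
      | tmul a b => simp [C.half_apply, sub_tmul]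
      | add a b ha hb => simp only [map_add, tmul_add, ha, hb]; abel
    have h3 := LinearMap.congr_fun C.coassoc x
    simp only [LinearMap.comp_apply, LinearEquiv.coe_coe] at h3
    rw [C.half_apply x, map_sub, LinearMap.rTensor_tmul, h1, zero_tmul, sub_zero, h2, h3, map_sub,
      LinearMap.lTensor_tmul]
  op_deg := op_deg
  op_one := op_one
  half_op := half_op

-- The half-bialgebras underlying the three types of bialgebras

theorem InfinitesimalStr.comul_one (S : InfinitesimalStr V) :
    S.comul V.one = V.one ⊗ₜ[K] V.one := by
  -- The compatibility relation at `x = y = 1` reads `Δ(1) = Δ(1) + Δ(1) - 1 ⊗ 1`.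
  have h := S.comul_mul V.one V.one
  have h1 : S.mul V.one = LinearMap.id := LinearMap.ext S.one_mul
  have h2 : S.mul.flip V.one = LinearMap.id := LinearMap.ext S.mul_one
  rw [S.one_mul, h1, h2, LinearMap.rTensor_id, LinearMap.lTensor_id, LinearMap.id_apply,
    add_sub_assoc, left_eq_add, sub_eq_zero] at h
  exact h

/-- The half-bialgebra underlying an infinitesimal bialgebra. -/
noncomputable def InfinitesimalStr.toHalf (S : InfinitesimalStr V) : HalfBialg V :=
  S.toCoalgStr.toHalf S.comul_one S.mul
    (fun m n x hx y hy _ => S.mul_deg m n x hx y hy) S.mul_one (fun x y hx => by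
      rw [S.half_eq_iff] at hx
      rw [S.half_apply, S.comul_mul, hx]
      simp only [map_add, LinearMap.lTensor_tmul, LinearMap.flip_apply, S.one_mul]
      abel)

theorem ShuffleStr.prec_one_eq (S : ShuffleStr V) (x : V.carrier) :
    S.prec x V.one = V.red x := by
  refine LinearMap.congr_fun (f := S.prec.flip V.one) (V.linearMap_ext ?_ fun x hx => ?_) x
  · simp [S.one_prec]
  · rw [LinearMap.flip_apply, S.prec_one x hx, V.red_of_mem hx]

/-- The half-shuffle extended by `1 ≺ 1 = 1`. -/
noncomputable def ShuffleStr.op (S : ShuffleStr V) :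
    V.carrier →ₗ[K] V.carrier →ₗ[K] V.carrier :=
  S.prec + V.aug.smulRight (V.aug.smulRight V.one)

theorem ShuffleStr.op_of_mem (S : ShuffleStr V) {x : V.carrier} (hx : x ∈ LinearMap.ker V.aug) :
    S.op x = S.prec x := by
  simp [ShuffleStr.op, LinearMap.mem_ker.1 hx]

/-- The half-bialgebra underlying a shuffle bialgebra. -/
noncomputable def ShuffleStr.toHalf (S : ShuffleStr V) : HalfBialg V :=
  S.toCoalgStr.toHalf S.bialg.comul_one S.op
    (fun m n x hx y hy h => by
      rw [S.op_of_mem (S.mem_ker_of_half h)]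
      exact S.prec_deg m n x hx y hy)
    -- `x ≺ 1` is only `red(x)`; the correction term in `ShuffleStr.op` supplies the missing `ε(x)
    -- 1`.
    (fun x => by simp [ShuffleStr.op, S.prec_one_eq, V.red_add_aug])
    (fun x y hx => by
      have hk := S.mem_ker_of_half hx
      rw [S.op_of_mem hk]
      refine LinearMap.congr_fun (f := S.half ∘ₗ S.prec x)
        (g := (S.prec x).rTensor V.carrier ∘ₗ S.comul) (V.linearMap_ext ?_ fun y hy => ?_) y
      · rw [LinearMap.comp_apply, LinearMap.comp_apply, S.bialg.comul_one, LinearMap.rTensor_tmul,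
          S.prec_one x hk, hx]
      -- For primitive `x` the factor `Δ(x) - 1 ⊗ x` is `x ⊗ 1`, so the condensed compatibility
      -- relation leaves only `x ≺ y₁ ⊗ y₂`.
      · have h := S.map₂_prec_mul S.one_mul S.mul_one S.prec_one S.one_prec (y := y) hk
        rw [← S.comul_prec x hk y hy, ← S.half_apply, hx] at h
        rw [LinearMap.comp_apply, LinearMap.comp_apply, S.half_apply, ← h, add_sub_cancel_left]
        induction S.comul y using TensorProduct.induction_on with
        | zero => simp
        | tmul a b => simp [S.one_mul]
        | add a b ha hb => simp only [map_add, ha, hb])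

theorem UnshuffleStr.lTensor_halfComul_eq (S : UnshuffleStr V) (x : V.carrier) :
    V.aug.lTensor V.carrier (S.halfComul x) = V.red x ⊗ₜ[K] 1 := by
  refine LinearMap.congr_fun (f := V.aug.lTensor V.carrier ∘ₗ S.halfComul)
    (g := (TensorProduct.mk K V.carrier K).flip 1 ∘ₗ V.red)
    (V.linearMap_ext (by simp [S.halfComul_one]) fun x hx => ?_) x
  simp [S.lTensor_halfComul x hx, V.red_of_mem hx]

/-- The half-bialgebra underlying an unshuffle bialgebra. -/
noncomputable def UnshuffleStr.toHalf (S : UnshuffleStr V) : HalfBialg V where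
  comul := S.comul
  half := S.halfComul
  op := S.mul
  rTensor_counit := S.rTensor_counit
  lTensor_counit := S.lTensor_counit
  comul_deg := S.comul_deg
  comul_one := S.bialg.comul_one
  half_deg := S.halfComul_deg
  half_one := S.halfComul_one
  rTensor_half x := LinearMap.congr_fun (f := V.aug.rTensor V.carrier ∘ₗ S.halfComul) (g := 0)
    (V.linearMap_ext (by simp [S.halfComul_one]) S.rTensor_halfComul) x
  lTensor_half := S.lTensor_halfComul_eq
  half_assoc x := LinearMap.congr_fun
    (f := (TensorProduct.assoc K V.carrier V.carrier V.carrier).toLinearMap ∘ₗ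
      S.halfComul.rTensor V.carrier ∘ₗ S.halfComul)
    (g := S.comul.lTensor V.carrier ∘ₗ S.halfComul)
    (V.linearMap_ext (by simp [S.halfComul_one]) S.halfComul_assoc) x
  op_deg m n x hx y hy _ := S.mul_deg m n x hx y hy
  op_one := S.mul_one
  half_op x y hx := by
    have hk : x ∈ LinearMap.ker V.aug :=
      V.mem_ker_of_tmul_one (hx ▸ S.lTensor_halfComul_eq x)
    refine LinearMap.congr_fun (f := S.halfComul ∘ₗ S.mul x)
      (g := (S.mul x).rTensor V.carrier ∘ₗ S.comul) (V.linearMap_ext ?_ fun y hy => ?_) y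
    · rw [LinearMap.comp_apply, LinearMap.comp_apply, S.bialg.comul_one, LinearMap.rTensor_tmul,
        S.mul_one, hx]
    -- Here `δ_≺(x · y) = (x ⊗ 1) · δ(y)`; the axiom covers only `y` in `Ker ε`, whence the separate
    -- case `y = 1`.
    · rw [LinearMap.comp_apply, LinearMap.comp_apply, S.halfComul_mul x hk y hy, hx]
      induction S.comul y using TensorProduct.induction_on with
      | zero => simp
      | tmul a b => simp [S.one_mul]
      | add a b ha hb => simp only [map_add, ha, hb]

theorem InfinitesimalStr.coe_prim (S : InfinitesimalStr V) : (S.toHalf.prim : Set _) = S.Prim :=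
  Set.ext fun x => S.half_eq_iff x

theorem ShuffleStr.coe_prim (S : ShuffleStr V) : (S.toHalf.prim : Set _) = S.Prim :=
  Set.ext fun x => S.half_eq_iff x

theorem UnshuffleStr.coe_prim (S : UnshuffleStr V) : (S.toHalf.prim : Set _) = S.PrimPrec :=
  Set.ext fun _ => ⟨fun hx => ⟨S.toHalf.prim_le hx, hx⟩, fun hx => hx.2⟩

/-! The isomorphism with the tensor space is compatible with the operations. -/

/-- With `D = Δ - 1 ⊗ Id`, the rule `half_op` becomes `Δ(op(p, y)) = 1 ⊗ op(p, y) + op(p, y₁) ⊗ y₂`,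
which is the recursion defining deconcatenation. -/
theorem CoalgStr.comul_word (C : CoalgStr V) {H : HalfBialg V} (hC : H.comul = C.comul)
    (hH : H.half = C.half) (t : TensorAlgebra K H.prim) :
    C.comul (H.word H.prim t) = TensorProduct.map (H.word H.prim) (H.word H.prim) (deconc t) := by
  refine LinearMap.congr_fun (f := C.comul ∘ₗ H.word H.prim)
    (g := TensorProduct.map (H.word H.prim) (H.word H.prim) ∘ₗ deconc)
    (tensorAlgebra_linearMap_ext ?_ fun p t ht => ?_) t
  · simp [← hC, H.comul_one]
  · rw [LinearMap.comp_apply, LinearMap.comp_apply] at ht ⊢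
    have h1 := H.half_op p (H.word H.prim t) p.2
    have h2 : H.word H.prim ∘ₗ LinearMap.mulLeft K (TensorAlgebra.ι K p)
        = H.op p ∘ₗ H.word H.prim := LinearMap.ext fun s => H.word_cons _ p s
    have h3 : TensorProduct.map (H.op p ∘ₗ H.word H.prim) (H.word H.prim)
        = (H.op p).rTensor V.carrier ∘ₗ TensorProduct.map (H.word H.prim) (H.word H.prim) :=
      (LinearMap.rTensor_comp_map _ _ _ _).symm
    rw [hH, C.half_apply, hC, ht, sub_eq_iff_eq_add'] at h1
    rw [H.word_cons, h1, deconc_cons, map_add, map_letterMul, h2, h3, TensorProduct.map_tmul,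
      H.word_one, H.word_cons]
    rfl

theorem HalfBialg.mul_word (H : HalfBialg V) (A : AlgStr V) (hA : H.op = A.mul)
    (s t : TensorAlgebra K H.prim) :
    A.mul (H.word H.prim s) (H.word H.prim t) = H.word H.prim (s * t) := by
  refine LinearMap.congr_fun (f := A.mul.flip (H.word H.prim t) ∘ₗ H.word H.prim)
    (g := H.word H.prim ∘ₗ (LinearMap.mul K _).flip t)
    (tensorAlgebra_linearMap_ext ?_ fun p s hs => ?_) s
  · simp [A.one_mul]
  · simp only [LinearMap.comp_apply, LinearMap.flip_apply, LinearMap.mul_apply'] at hs ⊢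
    rw [H.word_cons, hA, A.mul_assoc, hs, mul_assoc, H.word_cons, hA]

-- Words in a shuffle bialgebra

namespace ShuffleStr

variable (S : ShuffleStr V)

theorem word_cons (p : S.toHalf.prim) (t : TensorAlgebra K S.toHalf.prim) :
    S.toHalf.word S.toHalf.prim (TensorAlgebra.ι K p * t)
      = S.prec p (S.toHalf.word S.toHalf.prim t) := by
  rw [S.toHalf.word_cons, ← S.op_of_mem (S.toHalf.prim_le p.2)]
  rfl

theorem prec_mem_ker (p : S.toHalf.prim) (y : V.carrier) :
    S.prec p y ∈ LinearMap.ker V.aug := by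
  have h := S.toHalf.aug_op p.2 y
  rw [← S.op_of_mem (S.toHalf.prim_le p.2)]
  change V.red (S.op p y) = S.op p y at h
  rw [← h]
  exact V.red_mem _

/-- The axiom concerns `Ker ε` only. With a primitive left argument it extends to all `y` and `z`,
the cases `y = 1` and `z = 1` following from the unit conventions. -/
theorem prec_prec_eq (p : S.toHalf.prim) (y z : V.carrier) :
    S.prec (S.prec p y) z = S.prec p (S.mul y z) := by
  have hp := S.toHalf.prim_le p.2
  refine LinearMap.congr_fun (f := S.prec (S.prec p y)) (g := S.prec p ∘ₗ S.mul y)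
    (V.linearMap_ext ?_ fun z hz => ?_) z
  · rw [S.prec_one _ (S.prec_mem_ker p y), LinearMap.comp_apply, S.mul_one]
  refine LinearMap.congr_fun (f := S.prec.flip z ∘ₗ S.prec p) (g := S.prec p ∘ₗ S.mul.flip z)
    (V.linearMap_ext ?_ fun y hy => ?_) y
  · simp [S.prec_one _ hp, S.one_mul]
  · simp [S.prec_prec _ hp y hy z hz, S.mul_eq y hy z hz]

/-- For nonempty words `*` is the sum of two half-shuffles, and `prec_prec_eq` moves the first
letter outside: `x a * y b = x ≺ (a * y b) + y ≺ (b * x a)`. This is the recursion `shuf_cons_cons`.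
-/
theorem mul_word (s t : TensorAlgebra K S.toHalf.prim) :
    S.mul (S.toHalf.word S.toHalf.prim s) (S.toHalf.word S.toHalf.prim t)
      = S.toHalf.word S.toHalf.prim (shuf s t) := by
  have h : S.mul.compl₁₂ (S.toHalf.word S.toHalf.prim) (S.toHalf.word S.toHalf.prim)
      = shuf.compr₂ (S.toHalf.word S.toHalf.prim) := by
    refine tensorAlgebra_linearMap_ext (N := TensorAlgebra K S.toHalf.prim →ₗ[K] V.carrier)
      (LinearMap.ext fun t => by simp [S.one_mul]) fun x a ha => ?_
    refine tensorAlgebra_linearMap_ext (by simp [S.mul_one]) fun y b hb => ?_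
    have ha' := LinearMap.congr_fun ha (TensorAlgebra.ι K y * b)
    simp only [LinearMap.compr₂_apply, LinearMap.compl₁₂_apply] at ha' hb ⊢
    rw [S.mul_eq _ (by rw [word_cons]; exact S.prec_mem_ker x _) _
      (by rw [word_cons]; exact S.prec_mem_ker y _), shuf_cons_cons, map_add, S.word_cons x,
      S.word_cons y, S.prec_prec_eq, S.prec_prec_eq, ← S.word_cons y b, ← S.word_cons x a, ha',
      S.mul_comm _ (S.toHalf.word S.toHalf.prim (TensorAlgebra.ι K x * a)), hb, ← S.word_cons,
      ← S.word_cons]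
  exact LinearMap.congr_fun (LinearMap.congr_fun h s) t

theorem prec_word (s t : TensorAlgebra K S.toHalf.prim) :
    S.prec (S.toHalf.word S.toHalf.prim s) (S.toHalf.word S.toHalf.prim t)
      = S.toHalf.word S.toHalf.prim (halfShuf s t) := by
  refine LinearMap.congr_fun
    (f := S.prec.flip (S.toHalf.word S.toHalf.prim t) ∘ₗ S.toHalf.word S.toHalf.prim)
    (g := S.toHalf.word S.toHalf.prim ∘ₗ halfShuf.flip t)
    (tensorAlgebra_linearMap_ext ?_ fun p s _ => ?_) s
  · simp [S.one_prec]
  · simp only [LinearMap.comp_apply, LinearMap.flip_apply]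
    rw [S.word_cons, S.prec_prec_eq, S.mul_word, cons_halfShuf, S.word_cons]

end ShuffleStr

-- Words in an unshuffle bialgebra

namespace UnshuffleStr

variable (S : UnshuffleStr V)

/-- Letters are primitive for the full coproduct `δ = δ_≺ + τ ∘ δ_≺` as well; this is what
identifies `δ` with the unshuffle coproduct. -/
theorem comul_prim (p : S.toHalf.prim) :
    S.comul p = p.1 ⊗ₜ[K] V.one + V.one ⊗ₜ[K] p.1 := by
  have h : S.halfComul p = p.1 ⊗ₜ[K] V.one := p.2
  rw [S.comul_eq _ (S.toHalf.prim_le p.2), h, TensorProduct.comm_tmul]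

theorem map₂_mul_word (s t : TensorAlgebra K S.toHalf.prim ⊗[K] TensorAlgebra K S.toHalf.prim) :
    TensorProduct.map₂ S.mul S.mul
      (TensorProduct.map (S.toHalf.word S.toHalf.prim) (S.toHalf.word S.toHalf.prim) s)
      (TensorProduct.map (S.toHalf.word S.toHalf.prim) (S.toHalf.word S.toHalf.prim) t)
    = TensorProduct.map (S.toHalf.word S.toHalf.prim) (S.toHalf.word S.toHalf.prim) (s * t) := by
  induction s using TensorProduct.induction_on with
  | zero => simp
  | add a b ha hb => simp only [map_add, LinearMap.add_apply, add_mul, ha, hb]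
  | tmul a b =>
    induction t using TensorProduct.induction_on with
    | zero => simp
    | add a b ha hb => simp only [map_add, mul_add, ha, hb]
    | tmul c d =>
      simp [S.toHalf.mul_word S.toAlgStr rfl]

theorem comul_word (t : TensorAlgebra K S.toHalf.prim) :
    S.comul (S.toHalf.word S.toHalf.prim t)
      = TensorProduct.map (S.toHalf.word S.toHalf.prim) (S.toHalf.word S.toHalf.prim)
        (unshuf t) := by
  refine LinearMap.congr_fun (f := S.comul ∘ₗ S.toHalf.word S.toHalf.prim)
    (g := TensorProduct.map (S.toHalf.word S.toHalf.prim) (S.toHalf.word S.toHalf.prim) ∘ₗ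
      unshuf.toLinearMap) (tensorAlgebra_linearMap_ext ?_ fun p t ht => ?_) t
  · simp [S.bialg.comul_one, Algebra.TensorProduct.one_def]
  · simp only [LinearMap.comp_apply, AlgHom.toLinearMap_apply] at ht ⊢
    rw [← S.toHalf.mul_word S.toAlgStr rfl, S.bialg.comul_mul, ht, map_mul, ← S.map₂_mul_word,
      S.toHalf.word_ι, S.comul_prim, unshuf_ι, map_add (TensorProduct.map _ _),
      TensorProduct.map_tmul, TensorProduct.map_tmul, S.toHalf.word_ι, S.toHalf.word_one]

theorem halfComul_word (t : TensorAlgebra K S.toHalf.prim) :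
    S.halfComul (S.toHalf.word S.toHalf.prim t)
      = TensorProduct.map (S.toHalf.word S.toHalf.prim) (S.toHalf.word S.toHalf.prim)
        (halfUnshuf t) := by
  refine LinearMap.congr_fun (f := S.halfComul ∘ₗ S.toHalf.word S.toHalf.prim)
    (g := TensorProduct.map (S.toHalf.word S.toHalf.prim) (S.toHalf.word S.toHalf.prim) ∘ₗ
      halfUnshuf) (tensorAlgebra_linearMap_ext ?_ fun p t _ => ?_) t
  · simp [S.halfComul_one]
  · rw [LinearMap.comp_apply, LinearMap.comp_apply, S.toHalf.word_cons, halfUnshuf_cons,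
      letterMul_apply, ← S.map₂_mul_word, TensorProduct.map_tmul, S.toHalf.word_ι,
      S.toHalf.word_one, ← S.comul_word]
    refine (S.toHalf.half_op _ _ p.2).trans ?_
    change (S.mul p).rTensor V.carrier (S.comul _) = _
    induction S.comul (S.toHalf.word S.toHalf.prim t) using TensorProduct.induction_on with
    | zero => simp
    | tmul a b => simp [S.one_mul]
    | add a b ha hb => simp only [map_add, ha, hb]

end UnshuffleStr

end

/-! ### Spaces of words -/

section

variable {K : Type u} [Field K]

/-- An identification of `V` with the tensor space over a graded subspace `P`. -/
structure WordStr (V : GrVectPlus.{u, w} K) where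
  P : Submodule K V.carrier
  proj_mem : ∀ n, ∀ x ∈ P, V.proj n x ∈ P
  le_ker : P ≤ LinearMap.ker V.aug
  lin : TensorAlgebra K (V.sub P proj_mem le_ker).carrier →ₗ[K] V.carrier
  lin_one : lin 1 = V.one
  lin_ι : ∀ p : (V.sub P proj_mem le_ker).carrier, lin (TensorAlgebra.ι K p) = p.1
  lin_deg : ∀ n, ∀ t ∈ tensorGrading (V.sub P proj_mem le_ker).toGrSpace n, lin t ∈ V.deg n
  bijective : Function.Bijective lin

/-- The space of letters as an object of `Vect`. -/
abbrev WordStr.letters {V : GrVectPlus.{u, w} K} (E : WordStr V) : GrVect.{u, w} K :=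
  V.sub E.P E.proj_mem E.le_ker

/-- The type of `lin` depends on `P`. Comparing the two maps through a map of letters lying over the
identity of `V` avoids transport along `P = P'`; once the subspaces are identified, `i` is the
identity. -/
theorem WordStr.ext_of_inclusion {V : GrVectPlus.{u, w} K} {E E' : WordStr V} (hP : E.P = E'.P)
    (i : E.letters.carrier →ₗ[K] E'.letters.carrier) (hi : ∀ p, (i p).1 = p.1)
    (hlin : ∀ t, E.lin t = E'.lin (tensorMap i t)) : E = E' := by
  obtain ⟨P, h1, h2, lin, h3, h4, h5, h6⟩ := E
  obtain ⟨P', h1', h2', lin', h3', h4', h5', h6'⟩ := E'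
  obtain rfl : P = P' := hP
  have h : lin = lin' := by
    refine LinearMap.ext fun t => (hlin t).trans ?_
    have h7 : tensorMap i = AlgHom.id K _ := by
      have h8 : i = LinearMap.id := LinearMap.ext fun p => Subtype.ext (hi p)
      rw [h8]
      exact TensorAlgebra.hom_ext (by ext; simp [tensorMap])
    exact congrArg lin' (AlgHom.congr_fun h7 t)
  subst h
  rfl

/-- The space of words given by the primitive elements. -/
noncomputable def HalfBialg.toWord {V : GrVectPlus.{u, w} K} (H : HalfBialg V) : WordStr V where
  P := H.prim
  proj_mem := H.proj_mem_prim
  le_ker := H.prim_le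
  lin := H.word H.prim
  lin_one := H.word_one _
  lin_ι := H.word_ι _
  lin_deg := H.word_deg le_rfl H.proj_mem_prim
  bijective := H.word_bijective

theorem HalfBialg.toWord_lin_cons {V : GrVectPlus.{u, w} K} (H : HalfBialg V)
    (p : H.toWord.letters.carrier) (t : TensorAlgebra K H.toWord.letters.carrier) :
    H.toWord.lin (TensorAlgebra.ι K p * t) = H.op p.1 (H.toWord.lin t) :=
  H.word_cons _ p t

/-- The space of words underlying a half-bialgebra is unique. -/
theorem HalfBialg.toWord_eq {V : GrVectPlus.{u, w} K} (H : HalfBialg V) (E : WordStr V)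
    (hP : E.P ≤ H.prim)
    (hlin : ∀ (p : E.letters.carrier) t, E.lin (TensorAlgebra.ι K p * t) = H.op p.1 (E.lin t)) :
    H.toWord = E := by
  have h1 : ∀ t, E.lin t = H.word E.P t := by
    refine fun t => LinearMap.congr_fun (f := E.lin) (g := H.word E.P)
      (tensorAlgebra_linearMap_ext ?_ fun p t ht => ?_) t
    · exact E.lin_one.trans (H.word_one _).symm
    · refine (hlin p t).trans ?_
      rw [ht]
      exact (H.word_cons _ p t).symm
  -- Words in the letters of `E` already fill `V`, so there is no room for further primitive
  -- elements.
  have h2 : H.prim ≤ E.P := H.prim_le_of_surjective hP fun x => by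
    obtain ⟨t, ht⟩ := E.bijective.2 x
    exact ⟨t, (h1 t).symm.trans ht⟩
  let i : E.letters.carrier →ₗ[K] H.toWord.letters.carrier := Submodule.inclusion hP
  refine (WordStr.ext_of_inclusion (E := E) (E' := H.toWord) (le_antisymm hP h2) i
    (fun _ => rfl) fun t => ?_).symm
  refine LinearMap.congr_fun (g := H.toWord.lin ∘ₗ (tensorMap i).toLinearMap)
    (tensorAlgebra_linearMap_ext ?_ fun p t ht => ?_) t
  · rw [LinearMap.comp_apply, AlgHom.toLinearMap_apply, map_one (tensorMap i), E.lin_one,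
      H.toWord.lin_one]
  · rw [LinearMap.comp_apply, AlgHom.toLinearMap_apply] at ht ⊢
    rw [hlin, ht, tensorMap_cons, H.toWord_lin_cons]
    rfl

/-- Morphisms of spaces of words. -/
structure WordStr.IsHom {V W : GrVectPlus.{u, w} K} (E : WordStr V) (E' : WordStr W)
    (f : V.carrier →ₗ[K] W.carrier) : Prop where
  map_mem : ∀ x ∈ E.P, f x ∈ E'.P
  map_lin : ∀ g : E.letters.carrier →ₗ[K] E'.letters.carrier, (∀ p, (g p).1 = f p.1) →
    ∀ t, f (E.lin t) = E'.lin (tensorMap g t)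

/-- The restriction of a morphism to the letters. -/
def WordStr.IsHom.restrict {V W : GrVectPlus.{u, w} K} {E : WordStr V} {E' : WordStr W}
    {f : V.carrier →ₗ[K] W.carrier} (hf : E.IsHom E' f) :
    E.letters.carrier →ₗ[K] E'.letters.carrier :=
  f.restrict hf.map_mem

theorem WordStr.IsHom.map_lin_restrict {V W : GrVectPlus.{u, w} K} {E : WordStr V}
    {E' : WordStr W} {f : V.carrier →ₗ[K] W.carrier} (hf : E.IsHom E' f)
    (t : TensorAlgebra K E.letters.carrier) : f (E.lin t) = E'.lin (tensorMap hf.restrict t) :=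
  hf.map_lin hf.restrict (fun _ => rfl) t

/-- The map of letters is determined by `f`, so verifying the condition for one restriction verifies
it for all. -/
theorem WordStr.IsHom.of_restrict {V W : GrVectPlus.{u, w} K} {E : WordStr V} {E' : WordStr W}
    {f : V.carrier →ₗ[K] W.carrier} (h : ∀ x ∈ E.P, f x ∈ E'.P)
    (g : E.letters.carrier →ₗ[K] E'.letters.carrier) (hg : ∀ p, (g p).1 = f p.1)
    (hlin : ∀ t, f (E.lin t) = E'.lin (tensorMap g t)) : E.IsHom E' f where
  map_mem := h
  map_lin g' hg' t := by
    obtain rfl : g = g' := LinearMap.ext fun p => Subtype.ext ((hg p).trans (hg' p).symm)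
    exact hlin t

theorem tensorMap_comp {A B C : Type w} [AddCommGroup A] [Module K A] [AddCommGroup B] [Module K B]
    [AddCommGroup C] [Module K C] (g : B →ₗ[K] C) (f : A →ₗ[K] B) (t : TensorAlgebra K A) :
    tensorMap (g ∘ₗ f) t = tensorMap g (tensorMap f t) := by
  have h : tensorMap (g ∘ₗ f) = (tensorMap g).comp (tensorMap f) :=
    TensorAlgebra.hom_ext (by ext x; simp [tensorMap])
  exact AlgHom.congr_fun h t

theorem tensorMap_id {A : Type w} [AddCommGroup A] [Module K A] (t : TensorAlgebra K A) :
    tensorMap (LinearMap.id : A →ₗ[K] A) t = t := by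
  have h : tensorMap (LinearMap.id : A →ₗ[K] A) = AlgHom.id K _ :=
    TensorAlgebra.hom_ext (by ext x; simp [tensorMap])
  exact AlgHom.congr_fun h t

theorem WordStr.IsHom.comp {U V W : GrVectPlus.{u, w} K} {E : WordStr U} {E' : WordStr V}
    {E'' : WordStr W} {f : U.carrier →ₗ[K] V.carrier} {g : V.carrier →ₗ[K] W.carrier}
    (hg : E'.IsHom E'' g) (hf : E.IsHom E' f) : E.IsHom E'' (g ∘ₗ f) :=
  .of_restrict (fun x hx => hg.map_mem _ (hf.map_mem x hx)) (hg.restrict ∘ₗ hf.restrict)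
    (fun _ => rfl) fun t => by
      rw [LinearMap.comp_apply, hf.map_lin_restrict, hg.map_lin_restrict, tensorMap_comp]

theorem WordStr.IsHom.id {V : GrVectPlus.{u, w} K} (E : WordStr V) : E.IsHom E LinearMap.id :=
  .of_restrict (fun _ hx => hx) LinearMap.id (fun _ => rfl) fun t => by
    rw [tensorMap_id, LinearMap.id_apply]

/-- Preserving `D` and `1`, `f` maps primitive elements to primitive elements. Words use `op` only
with a primitive left argument, so compatibility with `op` is needed only there. -/
theorem HalfBialg.isHom {V W : GrVectPlus.{u, w} K} {H : HalfBialg V} {H' : HalfBialg W}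
    {f : V.carrier →ₗ[K] W.carrier} (h1 : f V.one = W.one)
    (hhalf : ∀ x, H'.half (f x) = TensorProduct.map f f (H.half x))
    (hop : ∀ x ∈ H.prim, ∀ y, f (H.op x y) = H'.op (f x) (f y)) :
    H.toWord.IsHom H'.toWord f := by
  have hmem : ∀ x ∈ H.prim, f x ∈ H'.prim := by
    intro x hx
    rw [H'.mem_prim, hhalf, H.mem_prim.1 hx, TensorProduct.map_tmul, h1]
  let g : H.toWord.letters.carrier →ₗ[K] H'.toWord.letters.carrier := f.restrict hmem
  refine .of_restrict hmem g (fun _ => rfl) fun t => ?_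
  refine LinearMap.congr_fun (f := f ∘ₗ H.toWord.lin) (g := H'.toWord.lin ∘ₗ
    (tensorMap g).toLinearMap) (tensorAlgebra_linearMap_ext ?_ fun p t ht => ?_) t
  · rw [LinearMap.comp_apply, LinearMap.comp_apply, AlgHom.toLinearMap_apply,
      map_one (tensorMap g), H.toWord.lin_one, H'.toWord.lin_one, h1]
  · rw [LinearMap.comp_apply, LinearMap.comp_apply, AlgHom.toLinearMap_apply] at ht ⊢
    rw [H.toWord_lin_cons, hop _ p.2, ht, tensorMap_cons, H'.toWord_lin_cons]
    rfl

-- Transport of operations to a space of words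

namespace WordStr

variable {V W : GrVectPlus.{u, w} K} (E : WordStr V) {E' : WordStr W}

/-- The linear isomorphism with the tensor space over the letters. -/
noncomputable def equiv : TensorAlgebra K E.letters.carrier ≃ₗ[K] V.carrier :=
  LinearEquiv.ofBijective E.lin E.bijective

/-- The isomorphism with the tensor space over the letters. -/
noncomputable def plusEquiv : PlusEquiv (tensorPlus E.letters) V where
  equiv := E.equiv
  map_one := E.lin_one
  map_deg := E.lin_deg

/-- The shuffle bialgebra structure on a space of words. -/
noncomputable def toShuffle : ShuffleStr V := (tensorShuffle E.letters).transport E.plusEquiv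

/-- The unshuffle bialgebra structure on a space of words. -/
noncomputable def toUnshuffle : UnshuffleStr V := (tensorUnshuffle E.letters).transport E.plusEquiv

/-- The infinitesimal bialgebra structure on a space of words. -/
noncomputable def toInfinitesimal : InfinitesimalStr V :=
  (tensorInfinitesimal E.letters).transport E.plusEquiv

theorem conjOp₂_lin (f : TensorAlgebra K E.letters.carrier →ₗ[K] TensorAlgebra K E.letters.carrier →ₗ[K] TensorAlgebra K E.letters.carrier)
    (s t : TensorAlgebra K E.letters.carrier) :
    conjOp₂ E.equiv f (E.lin s) (E.lin t) = E.lin (f s t) :=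
  conjOp₂_apply E.equiv f s t

theorem conjCoop_lin (f : TensorAlgebra K E.letters.carrier →ₗ[K] TensorAlgebra K E.letters.carrier ⊗[K] TensorAlgebra K E.letters.carrier)
    (t : TensorAlgebra K E.letters.carrier) :
    conjCoop E.equiv f (E.lin t) = TensorProduct.map E.lin E.lin (f t) :=
  conjCoop_apply E.equiv f t

theorem conjOp₂_lin_eq
    {f : TensorAlgebra K E.letters.carrier →ₗ[K] TensorAlgebra K E.letters.carrier →ₗ[K] TensorAlgebra K E.letters.carrier}
    {g : V.carrier →ₗ[K] V.carrier →ₗ[K] V.carrier}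
    (h : ∀ s t, g (E.lin s) (E.lin t) = E.lin (f s t)) : conjOp₂ E.equiv f = g := by
  refine LinearMap.ext fun x => LinearMap.ext fun y => ?_
  obtain ⟨s, rfl⟩ := E.bijective.2 x
  obtain ⟨t, rfl⟩ := E.bijective.2 y
  rw [h]
  exact E.conjOp₂_lin f s t

theorem conjCoop_lin_eq
    {f : TensorAlgebra K E.letters.carrier →ₗ[K] TensorAlgebra K E.letters.carrier ⊗[K] TensorAlgebra K E.letters.carrier}
    {g : V.carrier →ₗ[K] V.carrier ⊗[K] V.carrier}
    (h : ∀ t, g (E.lin t) = TensorProduct.map E.lin E.lin (f t)) : conjCoop E.equiv f = g := by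
  refine LinearMap.ext fun x => ?_
  obtain ⟨t, rfl⟩ := E.bijective.2 x
  rw [h]
  exact E.conjCoop_lin f t

variable {E}

/-- A morphism of words is `tensorMap` in disguise, so it respects every operation on tensor spaces
that is natural in the letters. Together with `IsHom.map_coop`, this makes the passage from words to
bialgebras functorial. -/
theorem IsHom.map_op₂ {f : V.carrier →ₗ[K] W.carrier} (hf : E.IsHom E' f)
    {m : TensorAlgebra K E.letters.carrier →ₗ[K] TensorAlgebra K E.letters.carrier →ₗ[K] TensorAlgebra K E.letters.carrier}
    {m' : TensorAlgebra K E'.letters.carrier →ₗ[K] TensorAlgebra K E'.letters.carrier →ₗ[K] TensorAlgebra K E'.letters.carrier}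
    (hm : ∀ (g : E.letters.carrier →ₗ[K] E'.letters.carrier) s t, tensorMap g (m s t) = m' (tensorMap g s) (tensorMap g t))
    (x y : V.carrier) : f (conjOp₂ E.equiv m x y) = conjOp₂ E'.equiv m' (f x) (f y) := by
  obtain ⟨s, rfl⟩ := E.bijective.2 x
  obtain ⟨t, rfl⟩ := E.bijective.2 y
  refine (congrArg f (E.conjOp₂_lin m s t)).trans ?_
  rw [hf.map_lin_restrict, hf.map_lin_restrict, hf.map_lin_restrict, hm]
  exact (E'.conjOp₂_lin m' _ _).symm

theorem IsHom.map_coop {f : V.carrier →ₗ[K] W.carrier} (hf : E.IsHom E' f)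
    {c : TensorAlgebra K E.letters.carrier →ₗ[K] TensorAlgebra K E.letters.carrier ⊗[K] TensorAlgebra K E.letters.carrier}
    {c' : TensorAlgebra K E'.letters.carrier →ₗ[K] TensorAlgebra K E'.letters.carrier ⊗[K] TensorAlgebra K E'.letters.carrier}
    (hc : ∀ (g : E.letters.carrier →ₗ[K] E'.letters.carrier) t, c' (tensorMap g t)
      = TensorProduct.map (tensorMap g).toLinearMap (tensorMap g).toLinearMap (c t))
    (x : V.carrier) :
    conjCoop E'.equiv c' (f x) = TensorProduct.map f f (conjCoop E.equiv c x) := by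
  obtain ⟨t, rfl⟩ := E.bijective.2 x
  have h := congrArg (TensorProduct.map f f) (E.conjCoop_lin c t)
  refine Eq.trans ?_ h.symm
  rw [hf.map_lin_restrict]
  refine (E'.conjCoop_lin c' _).trans ?_
  have h2 : f ∘ₗ E.lin = E'.lin ∘ₗ (tensorMap hf.restrict).toLinearMap :=
    LinearMap.ext hf.map_lin_restrict
  rw [hc, TensorProduct.map_map, TensorProduct.map_map, h2]

end WordStr

/-! The structures determine each other. -/

section

variable {V : GrVectPlus.{u, w} K}

theorem WordStr.toShuffle_eq (E : WordStr V) (S : ShuffleStr V)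
    (h1 : ∀ s t, S.mul (E.lin s) (E.lin t) = E.lin (shuf s t))
    (h2 : ∀ s t, S.prec (E.lin s) (E.lin t) = E.lin (halfShuf s t))
    (h3 : ∀ t, S.comul (E.lin t) = TensorProduct.map E.lin E.lin (deconc t)) :
    E.toShuffle = S := by
  -- All fields other than these three operations are propositions.
  have ext : ∀ S S' : ShuffleStr V, S.mul = S'.mul → S.prec = S'.prec → S.comul = S'.comul →
      S = S' := by
    rintro ⟨⟨⟩, ⟨⟩⟩ ⟨⟨⟩, ⟨⟩⟩ rfl rfl rfl
    rfl
  exact ext _ _ (E.conjOp₂_lin_eq h1) (E.conjOp₂_lin_eq h2) (E.conjCoop_lin_eq h3)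

theorem WordStr.toInfinitesimal_eq (E : WordStr V) (S : InfinitesimalStr V)
    (h1 : ∀ s t, S.mul (E.lin s) (E.lin t) = E.lin (s * t))
    (h2 : ∀ t, S.comul (E.lin t) = TensorProduct.map E.lin E.lin (deconc t)) :
    E.toInfinitesimal = S := by
  have ext : ∀ S S' : InfinitesimalStr V, S.mul = S'.mul → S.comul = S'.comul → S = S' := by
    rintro ⟨⟨⟩, ⟨⟩⟩ ⟨⟨⟩, ⟨⟩⟩ rfl rfl
    rfl
  exact ext _ _ (E.conjOp₂_lin_eq (f := LinearMap.mul K _) h1) (E.conjCoop_lin_eq h2)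

theorem WordStr.toUnshuffle_eq (E : WordStr V) (S : UnshuffleStr V)
    (h1 : ∀ s t, S.mul (E.lin s) (E.lin t) = E.lin (s * t))
    (h2 : ∀ t, S.comul (E.lin t) = TensorProduct.map E.lin E.lin (unshuf t))
    (h3 : ∀ t, S.halfComul (E.lin t) = TensorProduct.map E.lin E.lin (halfUnshuf t)) :
    E.toUnshuffle = S := by
  have ext : ∀ S S' : UnshuffleStr V, S.mul = S'.mul → S.comul = S'.comul →
      S.halfComul = S'.halfComul → S = S' := by
    rintro ⟨⟨⟩, ⟨⟩⟩ ⟨⟨⟩, ⟨⟩⟩ rfl rfl rfl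
    rfl
  exact ext _ _ (E.conjOp₂_lin_eq (f := LinearMap.mul K _) h1)
    (E.conjCoop_lin_eq (f := unshuf.toLinearMap) h2) (E.conjCoop_lin_eq h3)

theorem HalfBialg.toShuffle_eq (H : HalfBialg V) (S : ShuffleStr V)
    (h1 : ∀ s t, S.mul (H.word H.prim s) (H.word H.prim t) = H.word H.prim (shuf s t))
    (h2 : ∀ s t, S.prec (H.word H.prim s) (H.word H.prim t) = H.word H.prim (halfShuf s t))
    (h3 : ∀ t, S.comul (H.word H.prim t)
      = TensorProduct.map (H.word H.prim) (H.word H.prim) (deconc t)) :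
    H.toWord.toShuffle = S :=
  H.toWord.toShuffle_eq S h1 h2 h3

theorem HalfBialg.toInfinitesimal_eq (H : HalfBialg V) (S : InfinitesimalStr V)
    (h1 : ∀ s t, S.mul (H.word H.prim s) (H.word H.prim t) = H.word H.prim (s * t))
    (h2 : ∀ t, S.comul (H.word H.prim t)
      = TensorProduct.map (H.word H.prim) (H.word H.prim) (deconc t)) :
    H.toWord.toInfinitesimal = S :=
  H.toWord.toInfinitesimal_eq S h1 h2

theorem HalfBialg.toUnshuffle_eq (H : HalfBialg V) (S : UnshuffleStr V)
    (h1 : ∀ s t, S.mul (H.word H.prim s) (H.word H.prim t) = H.word H.prim (s * t))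
    (h2 : ∀ t, S.comul (H.word H.prim t)
      = TensorProduct.map (H.word H.prim) (H.word H.prim) (unshuf t))
    (h3 : ∀ t, S.halfComul (H.word H.prim t)
      = TensorProduct.map (H.word H.prim) (H.word H.prim) (halfUnshuf t)) :
    H.toWord.toUnshuffle = S :=
  H.toWord.toUnshuffle_eq S h1 h2 h3

theorem ShuffleStr.toShuffle_toWord (S : ShuffleStr V) : S.toHalf.toWord.toShuffle = S :=
  S.toHalf.toShuffle_eq S S.mul_word S.prec_word (S.comul_word rfl rfl)

theorem InfinitesimalStr.toInfinitesimal_toWord (S : InfinitesimalStr V) :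
    S.toHalf.toWord.toInfinitesimal = S :=
  S.toHalf.toInfinitesimal_eq S (S.toHalf.mul_word S.toAlgStr rfl) (S.comul_word rfl rfl)

theorem UnshuffleStr.toUnshuffle_toWord (S : UnshuffleStr V) :
    S.toHalf.toWord.toUnshuffle = S :=
  S.toHalf.toUnshuffle_eq S (S.toHalf.mul_word S.toAlgStr rfl) S.comul_word S.halfComul_word

-- Recovering the words from the three structures

variable (E : WordStr V)

theorem WordStr.coop_deconc_letter (p : E.letters.carrier) :
    conjCoop E.equiv deconc p.1 = p.1 ⊗ₜ[K] V.one + V.one ⊗ₜ[K] p.1 := by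
  have h : deconc (TensorAlgebra.ι K p) = 1 ⊗ₜ[K] TensorAlgebra.ι K p
      + TensorAlgebra.ι K p ⊗ₜ[K] 1 := by
    rw [← mul_one (TensorAlgebra.ι K p), deconc_cons, deconc_one, letterMul_tmul]
  have h2 := E.conjCoop_lin deconc (TensorAlgebra.ι K p)
  rw [E.lin_ι, h, map_add, TensorProduct.map_tmul, TensorProduct.map_tmul, E.lin_ι, E.lin_one,
    add_comm] at h2
  exact h2

/-- The letters of `E` are primitive for the transported structure, and putting a letter in front of
a word is `op`; uniqueness of the presentation by words does the rest. -/
theorem WordStr.toWord_toShuffle : E.toShuffle.toHalf.toWord = E := by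
  refine HalfBialg.toWord_eq _ E
    (fun p hp => (E.toShuffle.half_eq_iff p).2 (E.coop_deconc_letter ⟨p, hp⟩)) fun p t => ?_
  change _ = E.toShuffle.op _ _
  rw [E.toShuffle.op_of_mem (E.le_ker p.2)]
  have h := E.conjOp₂_lin halfShuf (TensorAlgebra.ι K p) t
  have h2 : halfShuf (TensorAlgebra.ι K p) t = TensorAlgebra.ι K p * t := by
    rw [← mul_one (TensorAlgebra.ι K p), cons_halfShuf, one_shuf, mul_one]
  rw [E.lin_ι, h2] at h
  exact h.symm

theorem WordStr.toInfinitesimal_mul (s t : TensorAlgebra K E.letters.carrier) :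
    E.toInfinitesimal.mul (E.lin s) (E.lin t) = E.lin (s * t) :=
  E.conjOp₂_lin (LinearMap.mul K _) s t

theorem WordStr.toUnshuffle_mul (s t : TensorAlgebra K E.letters.carrier) :
    E.toUnshuffle.mul (E.lin s) (E.lin t) = E.lin (s * t) :=
  E.conjOp₂_lin (LinearMap.mul K _) s t

theorem WordStr.toWord_toInfinitesimal : E.toInfinitesimal.toHalf.toWord = E := by
  refine HalfBialg.toWord_eq _ E
    (fun p hp => (E.toInfinitesimal.half_eq_iff p).2 (E.coop_deconc_letter ⟨p, hp⟩)) fun p t => ?_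
  refine (E.toInfinitesimal_mul _ _).symm.trans ?_
  rw [E.lin_ι]
  rfl

theorem WordStr.toWord_toUnshuffle : E.toUnshuffle.toHalf.toWord = E := by
  refine HalfBialg.toWord_eq _ E (fun p hp => ?_) fun p t => ?_
  · have h : halfUnshuf (TensorAlgebra.ι K (⟨p, hp⟩ : E.letters.carrier))
        = TensorAlgebra.ι K (⟨p, hp⟩ : E.letters.carrier) ⊗ₜ[K] 1 := by
      rw [← mul_one (TensorAlgebra.ι K (⟨p, hp⟩ : E.letters.carrier)), halfUnshuf_cons, map_one,
        letterMul_apply, mul_one, mul_one]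
    have h2 := E.conjCoop_lin halfUnshuf (TensorAlgebra.ι K (⟨p, hp⟩ : E.letters.carrier))
    rw [E.lin_ι, h, TensorProduct.map_tmul, E.lin_ι, E.lin_one] at h2
    exact h2
  · refine (E.toUnshuffle_mul _ _).symm.trans ?_
    rw [E.lin_ι]
    rfl

end

end

/-! ### The category of spaces of words -/

/-- Graded vector spaces identified with a tensor space. -/
structure WordObj (K : Type u) [Field K] where
  space : GrVectPlus.{u, w} K
  str : WordStr space

section

variable {K : Type u} [Field K]

/-- Morphisms of `Vect⁺` compatible with the words. -/
@[ext]
structure WordObj.Hom (A B : WordObj.{u, w} K) where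
  toHom : A.space ⟶ B.space
  isHom : A.str.IsHom B.str toHom.lin

instance : Category (WordObj.{u, w} K) where
  Hom := WordObj.Hom
  id A := ⟨𝟙 A.space, .id A.str⟩
  comp f g := ⟨f.toHom ≫ g.toHom, g.isHom.comp f.isHom⟩

end

/-- The forgetful functor from spaces of words to `Vect⁺`. -/
def WordObj.forget (K : Type u) [Field K] : WordObj.{u, w} K ⥤ GrVectPlus.{u, w} K where
  obj A := A.space
  map f := f.toHom

instance (K : Type u) [Field K] : (WordObj.forget.{u, w} K).Faithful :=
  ⟨fun h => WordObj.Hom.ext h⟩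

instance (K : Type u) [Field K] : (ShuffleBialg.forget.{u, w} K).Faithful :=
  ⟨fun h => ShuffleBialg.Hom.ext h⟩

instance (K : Type u) [Field K] : (UnshuffleBialg.forget.{u, w} K).Faithful :=
  ⟨fun h => UnshuffleBialg.Hom.ext h⟩

instance (K : Type u) [Field K] : (InfinitesimalBialg.forget.{u, w} K).Faithful :=
  ⟨fun h => InfinitesimalBialg.Hom.ext h⟩

/-- Equality of functors on morphisms can be tested after the faithful functor `F`, where `Φ`
becomes invisible up to the identifications of objects. -/
theorem eq_id_of_comp_faithful {C D : Type*} [Category C] [Category D] {F : C ⥤ D} [F.Faithful]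
    {Φ : C ⥤ C} (h : Φ ⋙ F = F) (hobj : ∀ X, Φ.obj X = X) : Φ = 𝟭 C := by
  refine CategoryTheory.Functor.ext hobj fun X Y f => F.map_injective ?_
  have h1 := Functor.congr_hom h f
  simp only [Functor.comp_map] at h1
  rw [h1, F.map_comp, F.map_comp, eqToHom_map, eqToHom_map, Functor.id_map]

section

variable {K : Type u} [Field K]

theorem CoalgStr.half_map {V W : GrVectPlus.{u, w} K} {C : CoalgStr V} {D : CoalgStr W} (f : V ⟶ W)
    (h : ∀ x, D.comul (f.lin x) = TensorProduct.map f.lin f.lin (C.comul x)) (x : V.carrier) :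
    D.half (f.lin x) = TensorProduct.map f.lin f.lin (C.half x) := by
  simp [CoalgStr.half, h, f.map_one]

-- The functors between bialgebras and spaces of words

/-- Shuffle bialgebras as spaces of words. -/
noncomputable def ShuffleBialg.toWord (K : Type u) [Field K] :
    ShuffleBialg.{u, w} K ⥤ WordObj.{u, w} K where
  obj B := ⟨B.space, B.str.toHalf.toWord⟩
  map {A B} f := ⟨f.toHom, HalfBialg.isHom f.toHom.map_one
    (CoalgStr.half_map f.toHom f.map_comul) fun x hx y => by
      have hx' := A.str.toHalf.prim_le hx
      have hfx := f.toHom.lin_mem_ker hx'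
      change f.toHom.lin (A.str.op x y) = B.str.op (f.toHom.lin x) (f.toHom.lin y)
      rw [A.str.op_of_mem hx', B.str.op_of_mem hfx]
      -- Morphisms are only known to respect `≺` on `Ker ε`, so the unit part of `y` is treated
      -- separately.
      obtain ⟨c, z, hz, rfl⟩ : ∃ (c : K) (z : A.space.carrier), z ∈ LinearMap.ker A.space.aug ∧
          y = c • A.space.one + z := ⟨A.space.aug y, y - A.space.aug y • A.space.one, by
            rw [LinearMap.mem_ker, map_sub, A.space.aug_of_deg_zero, sub_self], by abel⟩
      rw [map_add, map_add, map_smul, map_smul, map_add, map_smul, map_add, map_smul,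
        f.map_prec _ hx' _ hz, A.str.prec_one _ hx', f.toHom.map_one, B.str.prec_one _ hfx]⟩

/-- Unshuffle bialgebras as spaces of words. -/
noncomputable def UnshuffleBialg.toWord (K : Type u) [Field K] :
    UnshuffleBialg.{u, w} K ⥤ WordObj.{u, w} K where
  obj B := ⟨B.space, B.str.toHalf.toWord⟩
  map f := ⟨f.toHom, HalfBialg.isHom f.toHom.map_one f.map_halfComul fun x _ y => f.map_mul x y⟩

/-- Infinitesimal bialgebras as spaces of words. -/
noncomputable def InfinitesimalBialg.toWord (K : Type u) [Field K] :
    InfinitesimalBialg.{u, w} K ⥤ WordObj.{u, w} K where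
  obj B := ⟨B.space, B.str.toHalf.toWord⟩
  map f := ⟨f.toHom, HalfBialg.isHom f.toHom.map_one (CoalgStr.half_map f.toHom f.map_comul)
    fun x _ y => f.map_mul x y⟩

/-- Spaces of words as shuffle bialgebras. -/
noncomputable def WordObj.toShuffle (K : Type u) [Field K] :
    WordObj.{u, w} K ⥤ ShuffleBialg.{u, w} K where
  obj E := ⟨E.space, E.str.toShuffle⟩
  map f := ⟨f.toHom, f.isHom.map_op₂ tensorMap_shuf, f.isHom.map_coop deconc_tensorMap,
    fun x _ y _ => f.isHom.map_op₂ tensorMap_halfShuf x y⟩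

/-- Spaces of words as infinitesimal bialgebras. -/
noncomputable def WordObj.toInfinitesimal (K : Type u) [Field K] :
    WordObj.{u, w} K ⥤ InfinitesimalBialg.{u, w} K where
  obj E := ⟨E.space, E.str.toInfinitesimal⟩
  map f := ⟨f.toHom, f.isHom.map_op₂ (m := LinearMap.mul K _) (m' := LinearMap.mul K _)
    fun g s t => map_mul (tensorMap g) s t, f.isHom.map_coop deconc_tensorMap⟩

/-- Spaces of words as unshuffle bialgebras. -/
noncomputable def WordObj.toUnshuffle (K : Type u) [Field K] :
    WordObj.{u, w} K ⥤ UnshuffleBialg.{u, w} K where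
  obj E := ⟨E.space, E.str.toUnshuffle⟩
  map f := ⟨f.toHom, f.isHom.map_op₂ (m := LinearMap.mul K _) (m' := LinearMap.mul K _)
    fun g s t => map_mul (tensorMap g) s t,
    f.isHom.map_coop (c := unshuf.toLinearMap) (c' := unshuf.toLinearMap) unshuf_tensorMap,
    f.isHom.map_coop halfUnshuf_tensorMap⟩

/-- Shuffle bialgebras are the same as spaces of words. -/
noncomputable def ShuffleBialg.isoWord (K : Type u) [Field K] :
    IsoOver (ShuffleBialg.forget.{u, w} K) (WordObj.forget.{u, w} K) where
  functor := ShuffleBialg.toWord K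
  inverse := WordObj.toShuffle K
  functor_inverse := eq_id_of_comp_faithful (F := ShuffleBialg.forget K) rfl
    fun B => congrArg (ShuffleBialg.mk B.space) B.str.toShuffle_toWord
  inverse_functor := eq_id_of_comp_faithful (F := WordObj.forget K) rfl
    fun E => congrArg (WordObj.mk E.space) E.str.toWord_toShuffle
  functor_forget := rfl

/-- Unshuffle bialgebras are the same as spaces of words. -/
noncomputable def UnshuffleBialg.isoWord (K : Type u) [Field K] :
    IsoOver (UnshuffleBialg.forget.{u, w} K) (WordObj.forget.{u, w} K) where
  functor := UnshuffleBialg.toWord K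
  inverse := WordObj.toUnshuffle K
  functor_inverse := eq_id_of_comp_faithful (F := UnshuffleBialg.forget K) rfl
    fun B => congrArg (UnshuffleBialg.mk B.space) B.str.toUnshuffle_toWord
  inverse_functor := eq_id_of_comp_faithful (F := WordObj.forget K) rfl
    fun E => congrArg (WordObj.mk E.space) E.str.toWord_toUnshuffle
  functor_forget := rfl

/-- Infinitesimal bialgebras are the same as spaces of words. -/
noncomputable def InfinitesimalBialg.isoWord (K : Type u) [Field K] :
    IsoOver (InfinitesimalBialg.forget.{u, w} K) (WordObj.forget.{u, w} K) where
  functor := InfinitesimalBialg.toWord K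
  inverse := WordObj.toInfinitesimal K
  functor_inverse := eq_id_of_comp_faithful (F := InfinitesimalBialg.forget K) rfl
    fun B => congrArg (InfinitesimalBialg.mk B.space) B.str.toInfinitesimal_toWord
  inverse_functor := eq_id_of_comp_faithful (F := WordObj.forget K) rfl
    fun E => congrArg (WordObj.mk E.space) E.str.toWord_toInfinitesimal
  functor_forget := rfl

end

/-! ### The action of graded permutations on words -/

section

variable {K : Type u} [Field K]

theorem tprod_mem_tensorGrading (V : GrSpace.{u, w} K) {k : ℕ} {x : Fin k → V.carrier}
    {c : Fin k → ℕ} (hx : ∀ i, x i ∈ V.deg (c i)) :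
    TensorAlgebra.tprod K V.carrier k x ∈ tensorGrading V (∑ i, c i) := by
  refine Submodule.subset_span ⟨List.ofFn fun i => (c i, x i), fun p hp => ?_, ?_, ?_⟩
  · obtain ⟨i, rfl⟩ := (List.mem_ofFn' _ _).1 hp
    exact hx i
  · rw [List.map_ofFn, List.sum_ofFn]
    rfl
  · rw [List.map_ofFn, TensorAlgebra.tprod_apply]
    rfl

theorem tensorGrading_le {V : GrSpace.{u, w} K} {n : ℕ}
    {S : Submodule K (TensorAlgebra K V.carrier)}
    (h : ∀ (k : ℕ) (x : Fin k → V.carrier) (c : Fin k → ℕ), (∀ i, x i ∈ V.deg (c i)) →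
      ∑ i, c i = n → TensorAlgebra.tprod K V.carrier k x ∈ S) : tensorGrading V n ≤ S := by
  refine Submodule.span_le.2 ?_
  rintro _ ⟨l, hl, hs, rfl⟩
  have h1 := h l.length (fun i => (l.get i).2) (fun i => (l.get i).1)
    (fun i => hl _ (l.get_mem i)) (by
      rw [← List.sum_ofFn, ← hs]
      congr 1
      conv_rhs => rw [← List.ofFn_get l, List.map_ofFn]
      rfl)
  have h2 : (List.ofFn fun i => TensorAlgebra.ι K (l.get i).2)
      = l.map fun p => TensorAlgebra.ι K p.2 := by
    conv_rhs => rw [← List.ofFn_get l, List.map_ofFn]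
    rfl
  rw [TensorAlgebra.tprod_apply, h2] at h1
  exact h1

theorem tensorAlgebra_ext_homogeneous (V : GrSpace.{u, w} K) {N : Type*} [AddCommGroup N]
    [Module K N] {f g : TensorAlgebra K V.carrier →ₗ[K] N}
    (h : ∀ (k : ℕ) (x : Fin k → V.carrier) (c : Fin k → ℕ), (∀ i, x i ∈ V.deg (c i)) →
      f (TensorAlgebra.tprod K V.carrier k x) = g (TensorAlgebra.tprod K V.carrier k x)) :
    f = g := by
  refine GrVectPlus.hom_ext_deg ⟨_, tensorGrading V, tensorGrading_internal V⟩ f g fun n x hx => ?_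
  exact tensorGrading_le (S := LinearMap.eqLocus f g) (fun k x c hx _ => h k x c hx) hx

theorem tensorMap_tprod {M N : Type w} [AddCommGroup M] [Module K M] [AddCommGroup N] [Module K N]
    (f : M →ₗ[K] N) {k : ℕ} (x : Fin k → M) :
    tensorMap f (TensorAlgebra.tprod K M k x) = TensorAlgebra.tprod K N k fun i => f (x i) := by
  rw [TensorAlgebra.tprod_apply, TensorAlgebra.tprod_apply, map_list_prod, List.map_ofFn]
  congr 2
  funext i
  simp [tensorMap]

theorem gradedPermMap_deg (V : GrVect.{u, w} K) (p : GradedPerm) (n : ℕ) :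
    tensorGrading V.toGrSpace n ≤ (tensorGrading V.toGrSpace n).comap (gradedPermMap V p) := by
  obtain ⟨k, σ, d⟩ := p
  refine tensorGrading_le fun l x c hx hn => ?_
  rw [Submodule.mem_comap]
  by_cases hkl : k = l
  · subst hkl
    rw [gradedPermMap_tprod V σ d x c hx]
    split_ifs
    · have h := tprod_mem_tensorGrading V.toGrSpace (x := fun i => x (σ i)) (c := fun i => c (σ i))
        fun i => hx (σ i)
      rwa [Equiv.sum_comp σ c, hn] at h
    · exact Submodule.zero_mem _
  · rw [gradedPermMap_tprod_of_ne V hkl]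
    exact Submodule.zero_mem _

theorem tensorMap_gradedPermMap {V W : GrVect.{u, w} K} (f : V ⟶ W) (p : GradedPerm)
    (t : TensorAlgebra K V.carrier) :
    tensorMap f.lin (gradedPermMap V p t) = gradedPermMap W p (tensorMap f.lin t) := by
  obtain ⟨k, σ, d⟩ := p
  refine LinearMap.congr_fun (f := (tensorMap f.lin).toLinearMap ∘ₗ gradedPermMap V ⟨k, σ, d⟩)
    (g := gradedPermMap W ⟨k, σ, d⟩ ∘ₗ (tensorMap f.lin).toLinearMap)
    (tensorAlgebra_ext_homogeneous V.toGrSpace fun l x c hx => ?_) t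
  rw [LinearMap.comp_apply, LinearMap.comp_apply, AlgHom.toLinearMap_apply,
    AlgHom.toLinearMap_apply, tensorMap_tprod]
  by_cases hkl : k = l
  · subst hkl
    rw [gradedPermMap_tprod V σ d x c hx,
      gradedPermMap_tprod W σ d _ c fun i => f.map_deg _ _ (hx i)]
    split_ifs
    · rw [tensorMap_tprod]
    · exact map_zero _
  · rw [gradedPermMap_tprod_of_ne V hkl, gradedPermMap_tprod_of_ne W hkl, map_zero]

/-- The action of `𝐒` on `T(V)`. -/
noncomputable def permAction (V : GrVect.{u, w} K) :
    GradedPermAlg K →ₗ[K] Module.End K (TensorAlgebra K V.carrier) :=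
  (Finsupp.linearCombination K (gradedPermMap V) :
    (GradedPerm →₀ K) →ₗ[K] Module.End K (TensorAlgebra K V.carrier))

theorem permAction_of (V : GrVect.{u, w} K) (p : GradedPerm) :
    permAction V (GradedPermAlg.of K p) = gradedPermMap V p :=
  (Finsupp.linearCombination_single K (1 : K) p).trans (one_smul _ _)

/-- Letting `τ` act first and `σ` second turns `v_i` into `v_{τ(σ(i))}`, hence the order `τ ∘ σ` in
the product of 𝐒. After `τ` the letters have degrees `e(i)`, so `σ` with degrees `d` gives a nonzero
result only if `d = e ∘ σ`. -/
theorem permAction_basisMul (V : GrVect.{u, w} K) (p q : GradedPerm) :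
    permAction V (GradedPermAlg.basisMul K p q) = gradedPermMap V p * gradedPermMap V q := by
  obtain ⟨k, σ, d⟩ := p
  obtain ⟨l, τ, e⟩ := q
  refine tensorAlgebra_ext_homogeneous V.toGrSpace fun m x c hx => ?_
  rw [Module.End.mul_apply]
  by_cases hlm : l = m
  · subst hlm
    rw [gradedPermMap_tprod V τ e x c hx]
    by_cases hkl : k = l
    · subst hkl
      by_cases hc : ∀ i, c (τ i) = e i
      · rw [if_pos hc, gradedPermMap_tprod V σ d _ (fun i => c (τ i)) fun i => hx _]
        by_cases hd : d = e ∘ σ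
        · subst hd
          simp only [GradedPermAlg.basisMul, dif_pos, if_true, permAction_of]
          rw [gradedPermMap_tprod V _ _ x c hx]
          rfl
        · have h : ¬ ∀ i, c (τ (σ i)) = d i := fun h => hd <| funext fun i => PNat.coe_injective <| by
            rw [← h i, hc]
            rfl
          rw [if_neg h]
          simp [GradedPermAlg.basisMul, hd]
      · rw [if_neg hc, map_zero]
        by_cases hd : d = e ∘ σ
        · subst hd
          simp only [GradedPermAlg.basisMul, dif_pos, if_true, permAction_of]
          rw [gradedPermMap_tprod V _ _ x c hx, if_neg]
          intro h
          refine hc fun i => ?_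
          -- Since `σ` is bijective, the degree condition for the composite implies the one for `τ`
          -- alone.
          have h2 := h (σ.symm i)
          simpa using h2
        · simp [GradedPermAlg.basisMul, hd]
    · have h : (if ∀ i, c (τ i) = e i then
          TensorAlgebra.tprod K V.carrier l (fun i => x (τ i)) else 0) ∈
          LinearMap.ker (gradedPermMap V ⟨k, σ, d⟩) := by
        split_ifs
        · exact gradedPermMap_tprod_of_ne V hkl _ _ _
        · exact Submodule.zero_mem _
      rw [LinearMap.mem_ker.1 h]
      simp [GradedPermAlg.basisMul, hkl]
  · rw [gradedPermMap_tprod_of_ne V hlm, map_zero]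
    by_cases hkl : k = l
    · subst hkl
      by_cases hd : d = e ∘ σ
      · subst hd
        simp only [GradedPermAlg.basisMul, dif_pos, if_true, permAction_of]
        rw [gradedPermMap_tprod_of_ne V hlm]
      · simp [GradedPermAlg.basisMul, hd]
    · simp [GradedPermAlg.basisMul, hkl]

theorem permAction_mul (V : GrVect.{u, w} K) (a b : GradedPermAlg K) :
    permAction V (a * b) = permAction V a * permAction V b := by
  change permAction V (GradedPermAlg.mulLin K a b) = _
  induction a using GradedPermAlg.induction with
  | zero => simp
  | add a a' h h' => rw [map_add, LinearMap.add_apply, map_add, map_add, h, h', add_mul]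
  | smul r p =>
    induction b using GradedPermAlg.induction with
    | zero => simp
    | add b b' h h' => rw [map_add, map_add, map_add, h, h', mul_add]
    | smul s q =>
      simp only [map_smul, LinearMap.smul_apply, GradedPermAlg.mulLin_of, permAction_basisMul,
        permAction_of, smul_mul_assoc, mul_smul_comm]

theorem permAction_deg (V : GrVect.{u, w} K) (a : GradedPermAlg K) (n : ℕ) :
    tensorGrading V.toGrSpace n ≤ (tensorGrading V.toGrSpace n).comap (permAction V a) := by
  intro x hx
  rw [Submodule.mem_comap]
  induction a using GradedPermAlg.induction with
  | zero => simp
  | add a a' h h' =>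
    rw [map_add, LinearMap.add_apply]
    exact Submodule.add_mem _ h h'
  | smul r p =>
    rw [map_smul, permAction_of]
    exact Submodule.smul_mem _ r (gradedPermMap_deg V p n hx)

theorem tensorMap_permAction {V W : GrVect.{u, w} K} (f : V ⟶ W) (a : GradedPermAlg K)
    (t : TensorAlgebra K V.carrier) :
    tensorMap f.lin (permAction V a t) = permAction W a (tensorMap f.lin t) := by
  induction a using GradedPermAlg.induction with
  | zero => simp
  | add a a' h h' => simp only [map_add, LinearMap.add_apply, h, h']
  | smul r p => simp only [map_smul, LinearMap.smul_apply, permAction_of, tensorMap_gradedPermMap]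

end

/-! ### Spaces of words as a Schur-Weyl category -/

section

variable {K : Type u} [Field K]

/-- The action of `𝐒` on a space of words. -/
noncomputable def WordStr.action {V : GrVectPlus.{u, w} K} (E : WordStr V) :
    GradedPermAlg K →ₙₐ[K] Module.End K V.carrier where
  toFun a := E.equiv.conj (permAction E.letters a)
  map_smul' c a := by
    rw [map_smul, map_smul]
    rfl
  map_zero' := by rw [map_zero, map_zero]
  map_add' a b := by rw [map_add, map_add]
  map_mul' a b := by
    rw [permAction_mul]
    exact LinearEquiv.conj_comp _ _ _

theorem WordStr.action_lin {V : GrVectPlus.{u, w} K} (E : WordStr V) (a : GradedPermAlg K)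
    (t : TensorAlgebra K E.letters.carrier) :
    E.action a (E.lin t) = E.lin (permAction E.letters a t) := by
  change E.equiv (permAction E.letters a (E.equiv.symm (E.equiv t))) = _
  rw [E.equiv.symm_apply_apply]
  rfl

theorem WordStr.IsHom.map_action {V W : GrVectPlus.{u, w} K} {E : WordStr V} {E' : WordStr W}
    {f : V.carrier →ₗ[K] W.carrier} (hf : E.IsHom E' f) (hdeg : ∀ n, ∀ x ∈ V.deg n, f x ∈ W.deg n)
    (a : GradedPermAlg K) (x : V.carrier) : f (E.action a x) = E'.action a (f x) := by
  obtain ⟨t, rfl⟩ := E.bijective.2 x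
  rw [E.action_lin, hf.map_lin_restrict, hf.map_lin_restrict, E'.action_lin]
  exact congrArg E'.lin (tensorMap_permAction
    (⟨hf.restrict, fun n x hx => hdeg n x.1 hx⟩ : GrVect.Hom E.letters E'.letters) a t)

/-- The functor of letters. -/
def WordObj.lettersFunctor (K : Type u) [Field K] : WordObj.{u, w} K ⥤ GrVect.{u, w} K where
  obj E := E.str.letters
  map f := (⟨f.isHom.restrict, fun n x hx => f.toHom.map_deg n x.1 hx⟩ : GrVect.Hom _ _)

/-- Spaces of words are naturally isomorphic to tensor spaces. -/
noncomputable def WordObj.schurWeyl (K : Type u) [Field K] :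
    SchurWeylStructure.{u, v} (WordObj.forget.{u, max u v} K) where
  P := WordObj.lettersFunctor K
  iso := NatIso.ofComponents (fun E =>
    { hom := (⟨E.str.lin, E.str.lin_deg, E.str.lin_one⟩ : GrVectPlus.Hom _ _)
      inv := (⟨E.str.equiv.symm.toLinearMap, E.str.plusEquiv.symm_deg,
        (LinearEquiv.symm_apply_eq _).2 E.str.lin_one.symm⟩ : GrVectPlus.Hom _ _)
      hom_inv_id := GrVectPlus.Hom.ext (LinearMap.ext fun t => E.str.equiv.symm_apply_apply t)
      inv_hom_id := GrVectPlus.Hom.ext (LinearMap.ext fun x => E.str.equiv.apply_symm_apply x) })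
    fun f => GrVectPlus.Hom.ext (LinearMap.ext fun t => (f.isHom.map_lin_restrict t).symm)

/-- The action of `𝐒` on spaces of words. -/
noncomputable def WordObj.action (K : Type u) [Field K] :
    NaturalAction (WordObj.forget.{u, w} K) where
  act E := E.str.action
  act_deg E a n x hx := E.str.lin_deg n _
    (permAction_deg E.str.letters a n (E.str.plusEquiv.symm_deg n x hx))
  natural f a x := f.isHom.map_action f.toHom.map_deg a x

theorem WordObj.action_isInduced : (WordObj.action K).IsInduced (WordObj.schurWeyl.{u, v} K) :=
  fun E p t => (E.str.action_lin _ t).trans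
    (congrArg E.str.lin (LinearMap.congr_fun (permAction_of E.str.letters p) t))

/-! ### Categories isomorphic to spaces of words -/

section

variable {C D E : Type*} [Category C] [Category D] [Category E]

/-- The inverse of an isomorphism over `Vect⁺`. -/
def IsoOver.symm {F : C ⥤ GrVectPlus.{u, w} K} {G : D ⥤ GrVectPlus.{u, w} K} (α : IsoOver F G) :
    IsoOver G F where
  functor := α.inverse
  inverse := α.functor
  functor_inverse := α.inverse_functor
  inverse_functor := α.functor_inverse
  functor_forget := by
    have h := congrArg (α.inverse ⋙ ·) α.functor_forget
    exact h.symm.trans (congrArg (· ⋙ G) α.inverse_functor)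

/-- The composition of isomorphisms over `Vect⁺`. -/
def IsoOver.trans {F : C ⥤ GrVectPlus.{u, w} K} {G : D ⥤ GrVectPlus.{u, w} K}
    {H : E ⥤ GrVectPlus.{u, w} K} (α : IsoOver F G) (β : IsoOver G H) : IsoOver F H where
  functor := α.functor ⋙ β.functor
  inverse := β.inverse ⋙ α.inverse
  functor_inverse := by
    rw [Functor.assoc, ← Functor.assoc β.functor, β.functor_inverse, Functor.id_comp,
      α.functor_inverse]
  inverse_functor := by
    rw [Functor.assoc, ← Functor.assoc α.inverse, α.inverse_functor, Functor.id_comp,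
      β.inverse_functor]
  functor_forget := by
    rw [Functor.assoc, β.functor_forget, α.functor_forget]

/-- A Schur-Weyl structure is carried over by an isomorphism over `Vect⁺`. -/
noncomputable def SchurWeylStructure.pullback {F : C ⥤ GrVectPlus.{u, max u v} K}
    {G : D ⥤ GrVectPlus.{u, max u v} K} (S : SchurWeylStructure.{u, v} G) (Φ : C ⥤ D)
    (h : Φ ⋙ G = F) : SchurWeylStructure.{u, v} F where
  P := Φ ⋙ S.P
  iso := Functor.isoWhiskerLeft Φ S.iso ≪≫ eqToIso h

/-- An action of `𝐒` is carried over by a functor over `Vect⁺`. -/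
def NaturalAction.pullback {G : D ⥤ GrVectPlus.{u, w} K} (ρ : NaturalAction G) (Φ : C ⥤ D) :
    NaturalAction (Φ ⋙ G) where
  act X := ρ.act (Φ.obj X)
  act_deg X := ρ.act_deg (Φ.obj X)
  natural f := ρ.natural (Φ.map f)

variable {F : C ⥤ GrVectPlus.{u, max u v} K} {G : D ⥤ GrVectPlus.{u, max u v} K}
  {H : E ⥤ GrVectPlus.{u, max u v} K}

/-- Structures carried over along two functors to the same category are compatible with
isomorphisms which commute with these functors. -/
theorem IsoOver.compatible_pullback (S : SchurWeylStructure.{u, v} H) (α : IsoOver F G) (Φ : C ⥤ E)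
    (Ψ : D ⥤ E) (hΦ : Φ ⋙ H = F) (hΨ : Ψ ⋙ H = G) (h : α.functor ⋙ Ψ = Φ) :
    α.Compatible (S.pullback Φ hΦ) (S.pullback Ψ hΨ) := by
  subst hΨ
  subst h
  have e : α.functor ⋙ Ψ ⋙ H = F := α.functor_forget
  -- Both functors of letters come from the one on `H`, so they coincide along `α`.
  refine ⟨Iso.refl _, fun X => ?_⟩
  simp only [SchurWeylStructure.pullback, IsoOver.ident]
  simp [eqToHom_app]

theorem NaturalAction.isInduced_pullback {ρ : NaturalAction H} {S : SchurWeylStructure.{u, v} H}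
    (h : ρ.IsInduced S) (Φ : C ⥤ E) : (ρ.pullback Φ).IsInduced (S.pullback Φ rfl) :=
  fun X p t => h (Φ.obj X) p t

/-- Both actions are the same action of 𝐒 on the objects of `E`. Once the equalities between
forgetful functors are substituted, the identification `α.ident` is trivial and nothing is left to
check. -/
theorem IsoOver.equivariant_pullback {F : C ⥤ GrVectPlus.{u, w} K} {G : D ⥤ GrVectPlus.{u, w} K}
    {H : E ⥤ GrVectPlus.{u, w} K} (ρ : NaturalAction H) (α : IsoOver F G)
    (Φ : C ⥤ E) (Ψ : D ⥤ E) (h : α.functor ⋙ Ψ = Φ) (hΦ : Φ ⋙ H = F) (hΨ : Ψ ⋙ H = G) :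
    α.Equivariant (hΦ ▸ ρ.pullback Φ) (hΨ ▸ ρ.pullback Ψ) := by
  subst hΨ
  subst h
  obtain ⟨f, i, h1, h2, h3⟩ := α
  subst h3
  intro X s x
  rfl

end

end

/-! ### The three categories of bialgebras -/

section

variable {K : Type u} [Field K]

/-- For isomorphisms to a common category this is the commutation required by
`IsoOver.compatible_pullback` and `IsoOver.equivariant_pullback`. -/
theorem IsoOver.trans_symm_comp {C D E : Type*} [Category C] [Category D] [Category E]
    {F : C ⥤ GrVectPlus.{u, w} K} {G : D ⥤ GrVectPlus.{u, w} K} {H : E ⥤ GrVectPlus.{u, w} K}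
    (α : IsoOver F H) (β : IsoOver G H) : (α.trans β.symm).functor ⋙ β.functor = α.functor :=
  congrArg (α.functor ⋙ ·) β.inverse_functor

theorem WordStr.range_lin_ι {V : GrVectPlus.{u, w} K} (E : WordStr V) :
    (Set.range fun p => E.lin (TensorAlgebra.ι K p)) = (E.P : Set V.carrier) := by
  simp only [E.lin_ι]
  exact Subtype.range_val

theorem ShuffleStr.toWord_lin_cons {V : GrVectPlus.{u, w} K} (S : ShuffleStr V)
    (p : S.toHalf.toWord.letters.carrier) (t : TensorAlgebra K S.toHalf.toWord.letters.carrier) :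
    S.toHalf.toWord.lin (TensorAlgebra.ι K p * t)
      = S.prec (S.toHalf.toWord.lin (TensorAlgebra.ι K p)) (S.toHalf.toWord.lin t) := by
  rw [HalfBialg.toWord_lin_cons, S.toHalf.toWord.lin_ι]
  exact LinearMap.congr_fun (S.op_of_mem (S.toHalf.prim_le p.2)) _

end

-- The Schur-Weyl structures on the three categories

/-- The Schur-Weyl structure on shuffle bialgebras. -/
noncomputable def ShuffleBialg.schurWeyl (K : Type u) [Field K] :
    SchurWeylStructure.{u, v} (ShuffleBialg.forget.{u, max u v} K) :=
  (WordObj.schurWeyl.{u, v} K).pullback (ShuffleBialg.isoWord K).functor rfl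

/-- The Schur-Weyl structure on unshuffle bialgebras. -/
noncomputable def UnshuffleBialg.schurWeyl (K : Type u) [Field K] :
    SchurWeylStructure.{u, v} (UnshuffleBialg.forget.{u, max u v} K) :=
  (WordObj.schurWeyl.{u, v} K).pullback (UnshuffleBialg.isoWord K).functor rfl

/-- The Schur-Weyl structure on infinitesimal bialgebras. -/
noncomputable def InfinitesimalBialg.schurWeyl (K : Type u) [Field K] :
    SchurWeylStructure.{u, v} (InfinitesimalBialg.forget.{u, max u v} K) :=
  (WordObj.schurWeyl.{u, v} K).pullback (InfinitesimalBialg.isoWord K).functor rfl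

theorem ShuffleBialg.schurWeyl_isStandard (K : Type u) [Field K] :
    IsShuffleStandard (ShuffleBialg.schurWeyl.{u, v} K) := fun B =>
  ⟨B.str.toHalf.toWord.range_lin_ι.trans B.str.coe_prim, B.str.toWord_lin_cons⟩

theorem UnshuffleBialg.schurWeyl_isStandard (K : Type u) [Field K] :
    IsUnshuffleStandard (UnshuffleBialg.schurWeyl.{u, v} K) := fun B =>
  ⟨B.str.toHalf.toWord.range_lin_ι.trans B.str.coe_prim,
    fun t t' => (B.str.toHalf.mul_word B.str.toAlgStr rfl t t').symm⟩

theorem InfinitesimalBialg.schurWeyl_isStandard (K : Type u) [Field K] :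
    IsInfinitesimalStandard (InfinitesimalBialg.schurWeyl.{u, v} K) := fun B =>
  ⟨B.str.toHalf.toWord.range_lin_ι.trans B.str.coe_prim,
    fun t t' => (B.str.toHalf.mul_word B.str.toAlgStr rfl t t').symm⟩

end SchurWeyl

theorem mainTheorem4 (K : Type u) [Field K] :
    ∃ (S : SchurWeyl.SchurWeylStructure.{u, v} (SchurWeyl.ShuffleBialg.forget.{u, max u v} K))
      (U : SchurWeyl.SchurWeylStructure.{u, v} (SchurWeyl.UnshuffleBialg.forget.{u, max u v} K))
      (I : SchurWeyl.SchurWeylStructure.{u, v} (SchurWeyl.InfinitesimalBialg.forget.{u, max u v} K))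
      (α : SchurWeyl.IsoOver (SchurWeyl.ShuffleBialg.forget.{u, max u v} K)
        (SchurWeyl.InfinitesimalBialg.forget.{u, max u v} K))
      (β : SchurWeyl.IsoOver (SchurWeyl.InfinitesimalBialg.forget.{u, max u v} K)
        (SchurWeyl.UnshuffleBialg.forget.{u, max u v} K))
      (ρS : SchurWeyl.NaturalAction (SchurWeyl.ShuffleBialg.forget.{u, max u v} K))
      (ρU : SchurWeyl.NaturalAction (SchurWeyl.UnshuffleBialg.forget.{u, max u v} K))
      (ρI : SchurWeyl.NaturalAction (SchurWeyl.InfinitesimalBialg.forget.{u, max u v} K)),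
      SchurWeyl.IsShuffleStandard S ∧ SchurWeyl.IsUnshuffleStandard U ∧
      SchurWeyl.IsInfinitesimalStandard I ∧
      α.Compatible S I ∧ β.Compatible I U ∧
      ρS.IsInduced S ∧ ρU.IsInduced U ∧ ρI.IsInduced I ∧
      α.Equivariant ρS ρI ∧ β.Equivariant ρI ρU := by
  let ΦS := SchurWeyl.ShuffleBialg.isoWord.{u, max u v} K
  let ΦU := SchurWeyl.UnshuffleBialg.isoWord.{u, max u v} K
  let ΦI := SchurWeyl.InfinitesimalBialg.isoWord.{u, max u v} K
  let ρ := SchurWeyl.WordObj.action.{u, max u v} K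
  refine ⟨SchurWeyl.ShuffleBialg.schurWeyl.{u, v} K, SchurWeyl.UnshuffleBialg.schurWeyl.{u, v} K,
    SchurWeyl.InfinitesimalBialg.schurWeyl.{u, v} K, ΦS.trans ΦI.symm, ΦI.trans ΦU.symm,
    ρ.pullback ΦS.functor, ρ.pullback ΦU.functor, ρ.pullback ΦI.functor,
    SchurWeyl.ShuffleBialg.schurWeyl_isStandard K, SchurWeyl.UnshuffleBialg.schurWeyl_isStandard K,
    SchurWeyl.InfinitesimalBialg.schurWeyl_isStandard K, ?_, ?_, ?_, ?_, ?_, ?_, ?_⟩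
  · exact SchurWeyl.IsoOver.compatible_pullback (SchurWeyl.WordObj.schurWeyl.{u, v} K)
      (ΦS.trans ΦI.symm) ΦS.functor ΦI.functor rfl rfl (ΦS.trans_symm_comp ΦI)
  · exact SchurWeyl.IsoOver.compatible_pullback (SchurWeyl.WordObj.schurWeyl.{u, v} K)
      (ΦI.trans ΦU.symm) ΦI.functor ΦU.functor rfl rfl (ΦI.trans_symm_comp ΦU)
  · exact SchurWeyl.NaturalAction.isInduced_pullback
      SchurWeyl.WordObj.action_isInduced.{u, v} ΦS.functor
  · exact SchurWeyl.NaturalAction.isInduced_pullback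
      SchurWeyl.WordObj.action_isInduced.{u, v} ΦU.functor
  · exact SchurWeyl.NaturalAction.isInduced_pullback
      SchurWeyl.WordObj.action_isInduced.{u, v} ΦI.functor
  · exact SchurWeyl.IsoOver.equivariant_pullback ρ (ΦS.trans ΦI.symm) ΦS.functor ΦI.functor
      (ΦS.trans_symm_comp ΦI) rfl rfl
  · exact SchurWeyl.IsoOver.equivariant_pullback ρ (ΦI.trans ΦU.symm) ΦI.functor ΦU.functor
      (ΦI.trans_symm_comp ΦU) rfl rfl
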